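/- Let $1<p<\infty$ and $\alpha,\beta\in\mathbb R$ with $p-1+\beta\neq 0$, let $(M,g)$ be a complete Riemannian manifold with volume measure $dV_g$, and let $\Omega\subseteq M$ be a domain. Let $\rho:\Omega\to(0,\infty)$ be weakly differentiable, in the sense that there is a vector field $\nabla\rho$ such that for all $0<a<b$ the truncation $\max(a,\min(\rho,b))$ lies in $W^{1,1}_{loc}(\Omega)$ with weak gradient $\mathbf 1_{\{a<\rho<b\}}\nabla\rho$ (for $\rho\in W^{1,1}_{loc}(\Omega)$ this is the usual weak gradient). Suppose $|\nabla\rho|\,\rho^{\frac{-p+\alpha}{p}}\in L^p_{loc}(\Omega)$ and $$\frac{1}{p-1+\beta}\int_\Omega\langle\nabla\xi,|\nabla\rho|^{p-2}\nabla\rho\rangle\,\rho^{-p+1+\alpha}\,dV_g\ \ge\ \int_\Omega\frac{|\nabla\rho|^p}{\rho^{p-\alpha}}\,\xi\,dV_g\qquad\text{for all }\xi\in C_c^1(\Omega),\ \xi\ge 0.$$ If $p<2$, suppose in addition that $\rho^{\frac{-p+1-\beta}{p}}\in W^{1,p}_{loc}(\Omega)$ and $$\frac{1}{p-1+\beta}\int_\Omega\langle\nabla\xi,|\nabla\rho|^{p-2}\nabla\rho\rangle\,\rho^{\alpha+\beta}\,dV_g\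 \ge\ \int_\Omega\frac{|\nabla\rho|^p}{\rho}\,\rho^{\alpha+\beta}\,\xi\,dV_g\qquad\text{for all }\xi\in C_c^1(\Omega),\ \xi\ge 0.$$ Let $C(p)$ be the following constant, which depends only on $p$. If $p\ge2$, $C(p)$ is any positive constant such that $|X+Y|^p-|X|^p\ge C(p)|Y|^p+p|X|^{p-2}\langle X,Y\rangle$ for all vectors $X,Y$ of every Euclidean space (such a constant exists); if $p<2$, $C(p)=2^{p-3}p(p-1)$. Suppose that there are a measurable function $V:\Omega\to[0,\infty)$ and a function $\varphi\in W^{1,p}_{loc}(\Omega)$ with $\varphi>0$ a.e. such that for all $\xi\in C_c^1(\Omega)$ with $\xi\ge0$ $$\int_\Omega\langle|\nabla\varphi|^{p-2}\nabla\varphi,\nabla\xi\rangle\varphi^{-p+1}\rho^\alpha\,dV_g-(p-1)\int_\Omega|\nabla\varphi|^p\,\xi\,\rho^\alpha\varphi^{-p}\,dV_g-(p-1+\beta)\int_\Omega\langle|\nabla\varphi|^{p-2}\nabla\varphi,\nabla\rho\rangle\,\xi\,\varphi^{-p+1}\rho^{-1+\alpha}\,dV_g\ \ge\ \int_\Omega\frac{V}{C(p)}\,\xi\,\rho^\alpha\,dV_g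 .$$ In all these conditions it is understood that the integrals converge absolutely. Then for every $u\in W^{1,p}_0(\Omega;\rho^\alpha)$, $$\int_\Omega|\nabla u|^p\rho^\alpha\,dV_g\ \ge\ \Big(\frac{|p-1+\beta|}{p}\Big)^p\int_\Omega\frac{|u|^p|\nabla\rho|^p}{\rho^p}\,\rho^\alpha\,dV_g+\int_\Omega V|u|^p\rho^\alpha\,dV_g ,$$ where both sides take values in $[0,\infty]$. Here $W^{1,p}_0(\Omega;\rho^\alpha)$ is the set of all $u\in W^{1,1}_{loc}(\Omega)$ for which there are $u_k\in C_c^1(\Omega)$ with $\int_\Omega\big(|u_k-u|^p+|\nabla u_k-\nabla u|^p\big)\rho^\alpha\,dV_g\to0$. It contains $C_c^1(\Omega)$, it is the usual $W^{1,p}_0(\Omega)$ if $\alpha=0$, and it contains $W^{1,p}_0(\Omega)$ if $\rho^\alpha$ is bounded. -/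

import Mathlib

open MeasureTheory Filter Bundle
open scoped Manifold ContDiff Topology ENNReal

noncomputable section

section RiemannianCalculus

variable {n : ℕ} {M : Type*} [TopologicalSpace M] [ChartedSpace (EuclideanSpace ℝ (Fin n)) M]

/-- The coordinate vector field `∂ᵢ` of the chart `chartAt x₀`, at the point of `M` with
coordinates `y`. -/
def coordVector (x₀ : M) (y : EuclideanSpace ℝ (Fin n)) (i : Fin n) :
    TangentSpace (𝓡 n) ((chartAt (EuclideanSpace ℝ (Fin n)) x₀).symm y) :=
  mfderiv (𝓡 n) (𝓡 n) (chartAt (EuclideanSpace ℝ (Fin n)) x₀).symm y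
    (EuclideanSpace.single i (1 : ℝ) : EuclideanSpace ℝ (Fin n))

variable [RiemannianBundle (fun x : M => TangentSpace (𝓡 n) x)]

/-- The matrix `g_{ij}` of the metric in the chart `chartAt x₀`, at the point with
coordinates `y`. -/
def metricMatrix (x₀ : M) (y : EuclideanSpace ℝ (Fin n)) : Matrix (Fin n) (Fin n) ℝ :=
  Matrix.of fun i j => inner ℝ (coordVector x₀ y i) (coordVector x₀ y j)

/-- The Riemannian volume on the domain of `chartAt x₀`, that is `√(det g_{ij}) dy` carried over
to `M`; it vanishes outside the domain of the chart. -/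
def chartVolume [MeasurableSpace M] (x₀ : M) : Measure M :=
  ((volume.restrict (chartAt (EuclideanSpace ℝ (Fin n)) x₀).target).withDensity
    (fun y => ENNReal.ofReal (Real.sqrt (metricMatrix x₀ y).det))).map
      (chartAt (EuclideanSpace ℝ (Fin n)) x₀).symm

variable (n M) in
/-- The Riemannian volume measure `dV_g`. The measures `chartVolume x₀` agree on the overlaps of
the charts, so their supremum is the measure that restricts to `√(det g_{ij}) dy` on each chart
domain. -/
def riemannianVolume [MeasurableSpace M] : Measure M :=
  ⨆ x₀ : M, chartVolume (n := n) x₀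

/-- The gradient of a function at `x`: the vector dual to its differential with respect to the
metric. -/
def riemannianGradient (f : M → ℝ) (x : M) : TangentSpace (𝓡 n) x :=
  letI : FiniteDimensional ℝ (TangentSpace (𝓡 n) x) :=
    inferInstanceAs (FiniteDimensional ℝ (EuclideanSpace ℝ (Fin n)))
  letI : CompleteSpace (TangentSpace (𝓡 n) x) := FiniteDimensional.complete ℝ _
  (InnerProductSpace.toDual ℝ (TangentSpace (𝓡 n) x)).symm (mfderiv (𝓡 n) 𝓘(ℝ, ℝ) f x)

theorem inner_riemannianGradient (f : M → ℝ) (x : M) (X : TangentSpace (𝓡 n) x) :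
    inner ℝ (riemannianGradient f x) X = mfderiv (𝓡 n) 𝓘(ℝ, ℝ) f x X := by
  let _ : FiniteDimensional ℝ (TangentSpace (𝓡 n) x) :=
    inferInstanceAs (FiniteDimensional ℝ (EuclideanSpace ℝ (Fin n)))
  let _ : CompleteSpace (TangentSpace (𝓡 n) x) := FiniteDimensional.complete ℝ _
  exact InnerProductSpace.toDual_symm_apply (𝕜 := ℝ) (E := TangentSpace (𝓡 n) x)
    (y := (mfderiv (𝓡 n) 𝓘(ℝ, ℝ) f x)) (x := X)

variable (n) in
/-- `ξ ∈ C_c^1(Ω)`, extended by zero to `M`. -/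
structure IsTestFunction (Ω : Set M) (ξ : M → ℝ) : Prop where
  contMDiff : ContMDiff (𝓡 n) 𝓘(ℝ, ℝ) 1 ξ
  hasCompactSupport : HasCompactSupport ξ
  tsupport_subset : tsupport ξ ⊆ Ω

/-- `f ∈ W^{1,1}_loc(Ω)` with weak gradient `G`: in each chart, `f` and `⟨G, ∂ᵢ⟩` are locally
integrable and `⟨G, ∂ᵢ⟩` is the `i`-th weak partial derivative of `f`. -/
def HasWeakGradientOn (Ω : Set M) (f : M → ℝ) (G : (x : M) → TangentSpace (𝓡 n) x) : Prop :=
  ∀ x₀ : M,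
    let e := chartAt (EuclideanSpace ℝ (Fin n)) x₀
    let U : Set (EuclideanSpace ℝ (Fin n)) := e.target ∩ e.symm ⁻¹' Ω
    LocallyIntegrableOn (fun y => f (e.symm y)) U volume ∧
    ∀ i : Fin n,
      LocallyIntegrableOn (fun y => inner ℝ (G (e.symm y)) (coordVector x₀ y i)) U volume ∧
      ∀ ψ : EuclideanSpace ℝ (Fin n) → ℝ, ContDiff ℝ ∞ ψ → HasCompactSupport ψ →
        tsupport ψ ⊆ U →
        ∫ y, f (e.symm y) * fderiv ℝ ψ y (EuclideanSpace.single i 1) =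
          -∫ y, inner ℝ (G (e.symm y)) (coordVector x₀ y i) * ψ y

/-- `G` is the gradient of the positive function `f` in the sense of truncations: every truncation
`max a (min f b)` with `0 < a < b` lies in `W^{1,1}_loc(Ω)` and has the weak gradient
`G · 1_{a < f < b}`. For `f` in `W^{1,1}_loc(Ω)` this is the usual weak gradient; but `f` itself
need not be locally integrable (for instance a high negative power of the distance to a point). -/
def HasTruncatedGradientOn (Ω : Set M) (f : M → ℝ) (G : (x : M) → TangentSpace (𝓡 n) x) : Prop :=
  ∀ a b : ℝ, 0 < a → a < b →
    HasWeakGradientOn Ω (fun x => max a (min (f x) b))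
      (fun x => {z : M | a < f z ∧ f z < b}.indicator (fun _ => (1 : ℝ)) x • G x)

variable [MeasurableSpace M]

/-- `f ∈ W^{1,p}_loc(Ω)` with weak gradient `G`. -/
structure MemSobolevLoc (Ω : Set M) (p : ℝ) (f : M → ℝ)
    (G : (x : M) → TangentSpace (𝓡 n) x) : Prop where
  hasWeakGradientOn : HasWeakGradientOn Ω f G
  locallyIntegrableOn : LocallyIntegrableOn (fun x => |f x| ^ p) Ω (riemannianVolume n M)
  locallyIntegrableOn_gradient :
    LocallyIntegrableOn (fun x => ‖G x‖ ^ p) Ω (riemannianVolume n M)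

/-- `u ∈ W_0^{1,p}(Ω)` with respect to the weight `w`, with weak gradient `G`: `u` is the limit of
functions of `C_c^1(Ω)` in the norm `(∫_Ω (|u|^p + |∇u|^p) w dV_g)^{1/p}`. For `w = 1` this is the
usual space `W_0^{1,p}(Ω)`. -/
structure MemSobolevZero (Ω : Set M) (p : ℝ) (w : M → ℝ) (u : M → ℝ)
    (G : (x : M) → TangentSpace (𝓡 n) x) : Prop where
  hasWeakGradientOn : HasWeakGradientOn Ω u G
  exists_approx : ∃ v : ℕ → M → ℝ, (∀ k, IsTestFunction n Ω (v k)) ∧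
    Tendsto (fun k => ∫⁻ x in Ω,
        ENNReal.ofReal ((|v k x - u x| ^ p + ‖riemannianGradient (v k) x - G x‖ ^ p) * w x)
          ∂(riemannianVolume n M))
      atTop (𝓝 0)

end RiemannianCalculus

/-- The constants `C = C(p) > 0` of the theorem. If `p ≥ 2`, `C` is any positive constant with
`|X + Y|^p - |X|^p ≥ C |Y|^p + p |X|^{p-2} ⟨X, Y⟩` for all vectors of all Euclidean spaces; if
`p < 2`, it is `2^{p-3} p (p-1)`. -/
def IsRemainderConstant (p C : ℝ) : Prop :=
  (2 ≤ p → 0 < C ∧ ∀ (m : ℕ) (X Y : EuclideanSpace ℝ (Fin m)),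
    C * ‖Y‖ ^ p + p * ‖X‖ ^ (p - 2) * inner ℝ X Y ≤ ‖X + Y‖ ^ p - ‖X‖ ^ p) ∧
  (p < 2 → C = 2 ^ (p - 3) * p * (p - 1))

end

set_option linter.unusedSectionVars false

noncomputable section

section VectorInequalities

variable {V : Type*} [NormedAddCommGroup V] [InnerProductSpace ℝ V]

theorem norm_rpow_sub_two_mul_abs_inner_le (p : ℝ) (X W : V) :
    ‖X‖ ^ (p - 2) * |inner ℝ X W| ≤ ‖X‖ ^ (p - 1) * ‖W‖ := by
  rcases eq_or_ne X 0 with rfl | hX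
  · simp
    positivity
  · have hX' : 0 < ‖X‖ := norm_pos_iff.2 hX
    calc ‖X‖ ^ (p - 2) * |inner ℝ X W| ≤ ‖X‖ ^ (p - 2) * (‖X‖ * ‖W‖) := by
          gcongr; exact abs_real_inner_le_norm X W
      _ = ‖X‖ ^ (p - 1) * ‖W‖ := by
          rw [← mul_assoc, show p - 1 = (p - 2) + 1 by ring, Real.rpow_add_one hX'.ne']

theorem mul_rpow_sub_one_mul_le {p x w : ℝ} (hp : 1 < p) (hx : 0 ≤ x) (hw : 0 ≤ w) :
    p * (x ^ (p - 1) * w) ≤ (p - 1) * x ^ p + w ^ p := by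
  have hpq : (p / (p - 1)).HolderConjugate p := by
    rw [Real.holderConjugate_iff]
    constructor
    · rw [lt_div_iff₀ (by linarith)]; linarith
    · field_simp; ring
  have h := Real.young_inequality_of_nonneg (Real.rpow_nonneg hx (p - 1)) hw hpq
  rw [← Real.rpow_mul hx, mul_div_cancel₀ _ (by linarith : p - 1 ≠ 0)] at h
  have hp0 : 0 < p := by linarith
  have h2 : p * (x ^ (p - 1) * w) ≤ p * (x ^ p / (p / (p - 1)) + w ^ p / p) := by gcongr
  refine h2.trans_eq ?_
  field_simp

/-- The tangent inequality of the convex function `‖·‖ ^ p`. -/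
theorem mul_norm_rpow_sub_two_mul_inner_le {p : ℝ} (hp : 1 < p) (X W : V) :
    p * ‖X‖ ^ (p - 2) * inner ℝ X W ≤ (p - 1) * ‖X‖ ^ p + ‖W‖ ^ p := by
  have h1 := norm_rpow_sub_two_mul_abs_inner_le p X W
  have h2 := mul_rpow_sub_one_mul_le hp (norm_nonneg X) (norm_nonneg W)
  have h3 : ‖X‖ ^ (p - 2) * inner ℝ X W ≤ ‖X‖ ^ (p - 2) * |inner ℝ X W| := by
    gcongr; exact le_abs_self _
  nlinarith

theorem rpow_add_rpow_le_rpow_half {p : ℝ} (hp : 2 ≤ p) {a b : ℝ} (ha : 0 ≤ a) (hb : 0 ≤ b) :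
    a ^ p + b ^ p ≤ (a ^ 2 + b ^ 2) ^ (p / 2) := by
  have h := Real.add_rpow_le_rpow_add (sq_nonneg a) (sq_nonneg b) (by linarith : 1 ≤ p / 2)
  rwa [← Real.rpow_natCast a, ← Real.rpow_natCast b, ← Real.rpow_mul ha, ← Real.rpow_mul hb,
    Nat.cast_ofNat, mul_div_cancel₀ _ (two_ne_zero' ℝ), Real.rpow_two, Real.rpow_two] at h

/-- Clarkson's inequality in an inner product space. -/
theorem norm_half_add_rpow_add_norm_half_sub_rpow_le {p : ℝ} (hp : 2 ≤ p) (A B : V) :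
    ‖(2 : ℝ)⁻¹ • (A + B)‖ ^ p + ‖(2 : ℝ)⁻¹ • (A - B)‖ ^ p ≤ (‖A‖ ^ p + ‖B‖ ^ p) / 2 := by
  refine (rpow_add_rpow_le_rpow_half hp (norm_nonneg _) (norm_nonneg _)).trans ?_
  have h1 : ‖(2 : ℝ)⁻¹ • (A + B)‖ ^ 2 + ‖(2 : ℝ)⁻¹ • (A - B)‖ ^ 2
      = (2 : ℝ)⁻¹ * ‖A‖ ^ 2 + (2 : ℝ)⁻¹ * ‖B‖ ^ 2 := by
    have := parallelogram_law_with_norm ℝ A B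
    rw [norm_smul, norm_smul, mul_pow, mul_pow]
    norm_num
    nlinarith
  rw [h1]
  have h2 := (convexOn_rpow (by linarith : 1 ≤ p / 2)).2 
    (Set.mem_Ici.2 (sq_nonneg ‖A‖)) (Set.mem_Ici.2 (sq_nonneg ‖B‖))
    (by norm_num : (0 : ℝ) ≤ 2⁻¹) (by norm_num : (0 : ℝ) ≤ 2⁻¹) (by norm_num)
  simp only [smul_eq_mul] at h2
  refine h2.trans_eq ?_
  rw [← Real.rpow_natCast ‖A‖, ← Real.rpow_natCast ‖B‖, ← Real.rpow_mul (norm_nonneg _),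
    ← Real.rpow_mul (norm_nonneg _), Nat.cast_ofNat, mul_div_cancel₀ _ (two_ne_zero' ℝ)]
  ring

theorem two_rpow_mul_norm_rpow_add_le {p : ℝ} (hp : 2 ≤ p) (X Y : V) :
    2 ^ (1 - p) * ‖Y‖ ^ p + p * ‖X‖ ^ (p - 2) * inner ℝ X Y ≤ ‖X + Y‖ ^ p - ‖X‖ ^ p := by
  have h1 := norm_half_add_rpow_add_norm_half_sub_rpow_le hp (X + Y) X
  have h2 := mul_norm_rpow_sub_two_mul_inner_le (by linarith : 1 < p) X
    ((2 : ℝ)⁻¹ • (X + Y + X))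
  have h3 : ‖(2 : ℝ)⁻¹ • (X + Y - X)‖ ^ p = 2 ^ (1 - p) * ‖Y‖ ^ p / 2 := by
    rw [add_sub_cancel_left, norm_smul, Real.mul_rpow (norm_nonneg _) (norm_nonneg _),
      Real.rpow_sub two_pos, norm_inv, Real.norm_ofNat, Real.inv_rpow two_pos.le, Real.rpow_one]
    ring
  have h4 : p * ‖X‖ ^ (p - 2) * inner ℝ X ((2 : ℝ)⁻¹ • (X + Y + X))
      = p * ‖X‖ ^ p + p * ‖X‖ ^ (p - 2) * inner ℝ X Y / 2 := by
    rw [inner_smul_right, inner_add_right, inner_add_right, real_inner_self_eq_norm_sq]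
    rcases eq_or_ne X 0 with rfl | hX
    · have : (0 : ℝ) ^ p = 0 := Real.zero_rpow (by linarith)
      simp [this]
    · have : ‖X‖ ^ p = ‖X‖ ^ (p - 2) * ‖X‖ ^ 2 := by
        rw [← Real.rpow_natCast, ← Real.rpow_add (norm_pos_iff.2 hX)]
        norm_num
      rw [this]; ring
  linarith

theorem two_rpow_mul_le_rpow_add_sub {p x y : ℝ} (hp : 1 < p) (hp2 : p < 2) (hx : 0 ≤ x)
    (hxy : x ≤ y) :
    2 ^ (p - 3) * p * (p - 1) * y ^ p ≤ (x + y) ^ p - x ^ p - p * x ^ (p - 1) * y := by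
  rcases hx.eq_or_lt with rfl | hx
  · rw [Real.zero_rpow (by linarith), Real.zero_rpow (by linarith), zero_add]
    have h1 : (2 : ℝ) ^ (p - 3) ≤ 2⁻¹ := by
      rw [← Real.rpow_neg_one]
      exact Real.rpow_le_rpow_of_exponent_le (by norm_num) (by linarith)
    have h2 : 2 ^ (p - 3) * p * (p - 1) ≤ 1 := by
      have : 2 ^ (p - 3) * (p * (p - 1)) ≤ 2⁻¹ * (p * (p - 1)) :=
        mul_le_mul_of_nonneg_right h1 (by nlinarith)
      nlinarith
    nlinarith [Real.rpow_nonneg hxy p]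
  set c : ℝ := 2 ^ (p - 3) * p * (p - 1) * y ^ (p - 2) with hc
  have hy : 0 < y := hx.trans_le hxy
  let f : ℝ → ℝ := fun t => (x + t) ^ p - x ^ p - p * x ^ (p - 1) * t - c * t ^ 2
  have hf : ∀ t ∈ Set.Icc 0 y, HasDerivAt f
      (p * (x + t) ^ (p - 1) - p * x ^ (p - 1) - c * (2 * t)) t := by
    intro t ht
    have h1 : HasDerivAt (fun t => (x + t) ^ p) (p * (x + t) ^ (p - 1)) t := by
      have := ((hasDerivAt_id t).const_add x).rpow_const (p := p)
        (Or.inl (by simp only [id]; linarith [ht.1]))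
      simpa using this
    have h2 : HasDerivAt (fun t : ℝ => p * x ^ (p - 1) * t) (p * x ^ (p - 1)) t := by
      simpa using (hasDerivAt_id t).const_mul (p * x ^ (p - 1))
    have h3 : HasDerivAt (fun t : ℝ => c * t ^ 2) (c * (2 * t)) t := by
      simpa using (hasDerivAt_pow 2 t).const_mul c
    exact ((h1.sub_const _).sub h2).sub h3
  have hmono : MonotoneOn f (Set.Icc 0 y) := by
    refine monotoneOn_of_deriv_nonneg (convex_Icc 0 y)
      (fun t ht => (hf t ht).continuousAt.continuousWithinAt)
      (fun t ht => (hf t (interior_subset ht)).differentiableAt.differentiableWithinAt) ?_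
    intro t ht
    rw [interior_Icc] at ht
    rw [(hf t (Set.Ioo_subset_Icc_self ht)).deriv]
    have hz : 0 < x + t := by linarith [ht.1]
    -- concavity of `τ ^ (p - 1)`, in the form of Young's inequality
    have hconc : (p - 1) * (x + t) ^ (p - 2) * t ≤ (x + t) ^ (p - 1) - x ^ (p - 1) := by
      have h := rpow_one_add_le_one_add_mul_self (s := x / (x + t) - 1) (p := p - 1)
        (by have : 0 ≤ x / (x + t) := by positivity
            linarith) (by linarith) (by linarith)
      rw [add_sub_cancel, Real.div_rpow hx.le hz.le, div_le_iff₀ (by positivity)] at h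
      have h5 : (x + t) ^ (p - 1) = (x + t) ^ (p - 2) * (x + t) := by
        rw [← Real.rpow_add_one hz.ne']; congr 1; ring
      have h6 : (p - 1) * (x / (x + t) - 1) * (x + t) ^ (p - 1)
          = -((p - 1) * (x + t) ^ (p - 2) * t) := by
        rw [h5]; field_simp; ring
      linarith [h6, add_mul 1 ((p - 1) * (x / (x + t) - 1)) ((x + t) ^ (p - 1))]
    have hle : 2 ^ (p - 2) * y ^ (p - 2) ≤ (x + t) ^ (p - 2) := by
      rw [← Real.mul_rpow two_pos.le hy.le]
      exact Real.rpow_le_rpow_of_nonpos hz (by linarith [ht.2]) (by linarith)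
    have h23 : (2 : ℝ) ^ (p - 2) = 2 ^ (p - 3) * 2 := by
      rw [← Real.rpow_add_one two_ne_zero]; congr 1; ring
    have : c * (2 * t) = p * ((p - 1) * (2 ^ (p - 2) * y ^ (p - 2)) * t) := by
      rw [hc, h23]; ring
    rw [this]
    have h7 : (p - 1) * (2 ^ (p - 2) * y ^ (p - 2)) * t ≤ (p - 1) * (x + t) ^ (p - 2) * t := by
      have := ht.1.le
      have : 0 ≤ p - 1 := by linarith
      gcongr
    nlinarith
  have h0 := hmono (Set.left_mem_Icc.2 hy.le) (Set.right_mem_Icc.2 hy.le) hy.le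
  have hy2 : c * y ^ 2 = 2 ^ (p - 3) * p * (p - 1) * y ^ p := by
    rw [hc, mul_assoc, ← Real.rpow_natCast y 2, ← Real.rpow_add hy]
    norm_num
  simp only [f, add_zero, sub_self, mul_zero, zero_pow two_ne_zero] at h0
  linarith

theorem two_rpow_mul_norm_rpow_add_le_of_lt_two {p : ℝ} (hp : 1 < p) (hp2 : p < 2) (X Y : V) :
    2 ^ (p - 3) * p * (p - 1) * ‖Y‖ ^ p + p * ‖X‖ ^ (p - 2) * inner ℝ X Y - p * ‖X‖ ^ p
      ≤ ‖X + Y‖ ^ p - ‖X‖ ^ p := by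
  have hC1 : 2 ^ (p - 3) * p * (p - 1) ≤ 1 := by
    have h1 : (2 : ℝ) ^ (p - 3) ≤ 2⁻¹ := by
      rw [← Real.rpow_neg_one]
      exact Real.rpow_le_rpow_of_exponent_le (by norm_num) (by linarith)
    have : 2 ^ (p - 3) * (p * (p - 1)) ≤ 2⁻¹ * (p * (p - 1)) :=
      mul_le_mul_of_nonneg_right h1 (by nlinarith)
    nlinarith
  have hXX : ‖X‖ ^ (p - 2) * ‖X‖ ^ 2 = ‖X‖ ^ p := by
    rcases eq_or_ne X 0 with rfl | hX
    · simp [Real.zero_rpow (by linarith : p ≠ 0)]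
    · rw [← Real.rpow_natCast, ← Real.rpow_add (norm_pos_iff.2 hX)]; norm_num
  rcases lt_or_ge ‖Y‖ ‖X‖ with h | h
  · have h1 := mul_norm_rpow_sub_two_mul_inner_le hp X (X + Y)
    rw [inner_add_right, real_inner_self_eq_norm_sq, mul_add, mul_assoc, hXX] at h1
    have h2 : ‖Y‖ ^ p ≤ ‖X‖ ^ p := Real.rpow_le_rpow (norm_nonneg _) h.le (by linarith)
    have h3 : 0 ≤ ‖Y‖ ^ p := by positivity
    nlinarith
  rcases eq_or_ne X 0 with rfl | hX
  · have : (0 : ℝ) ^ p = 0 := Real.zero_rpow (by linarith)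
    have h3 : 0 ≤ ‖Y‖ ^ p := by positivity
    simp [this]
    nlinarith
  have hx : 0 < ‖X‖ := norm_pos_iff.2 hX
  have hy : 0 < ‖Y‖ := hx.trans_le h
  set x := ‖X‖
  set y := ‖Y‖
  set c := inner ℝ X Y with hcdef
  have hc : |c| ≤ x * y := abs_real_inner_le_norm X Y
  have hn : ‖X + Y‖ ^ p = (x ^ 2 + 2 * c + y ^ 2) ^ (p / 2) := by
    rw [← norm_add_sq_real, ← Real.rpow_natCast, ← Real.rpow_mul (norm_nonneg _)]
    congr 1; push_cast; ring
  rw [hn]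
  -- the difference of the two sides is concave in `c`
  have hxx : x ^ (p - 2) * x = x ^ (p - 1) := by
    rw [← Real.rpow_add_one hx.ne']; congr 1; ring
  set a := (x * y + c) / (2 * (x * y)) with ha
  set b := (x * y - c) / (2 * (x * y)) with hb
  have hxy : 0 < x * y := by positivity
  have ha0 : 0 ≤ a := div_nonneg (by linarith [neg_abs_le c]) (by positivity)
  have hb0 : 0 ≤ b := div_nonneg (by linarith [le_abs_self c]) (by positivity)
  have hab : a + b = 1 := by rw [ha, hb]; field_simp; ring
  have hcab : c = (a - b) * (x * y) := by rw [ha, hb]; field_simp; ring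
  have hcv := (Real.concaveOn_rpow (by linarith : 0 ≤ p / 2) (by linarith : p / 2 ≤ 1)).2
    (x := (x + y) ^ 2) (y := (y - x) ^ 2) (by simp; positivity) (by simp; positivity) ha0 hb0 hab
  simp only [smul_eq_mul] at hcv
  have e1 : a * (x + y) ^ 2 + b * (y - x) ^ 2 = x ^ 2 + 2 * c + y ^ 2 := by
    rw [hcab]; linear_combination (x ^ 2 + y ^ 2) * hab
  rw [e1, ← Real.rpow_natCast (x + y), ← Real.rpow_natCast (y - x),
    ← Real.rpow_mul (by linarith), ← Real.rpow_mul (by linarith), Nat.cast_ofNat,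
    mul_div_cancel₀ _ (two_ne_zero' ℝ)] at hcv
  have hplus := two_rpow_mul_le_rpow_add_sub hp hp2 hx.le h
  have hminus : 2 ^ (p - 3) * p * (p - 1) * y ^ p ≤ (y - x) ^ p + p * x ^ (p - 1) * y := by
    have hbern := one_add_mul_self_le_rpow_one_add (s := -(x / y)) (p := p)
      (by rw [neg_le_neg_iff, div_le_one hy]; exact h) hp.le
    have e : (y - x) ^ p = y ^ p * (1 + -(x / y)) ^ p := by
      rw [← Real.mul_rpow hy.le (by rw [← sub_eq_add_neg, sub_nonneg, div_le_one hy]; exact h)]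
      congr 1; field_simp; ring
    have h3 : y ^ p * (x / y) ≤ x ^ (p - 1) * y := by
      have h4 : y ^ (p - 2) ≤ x ^ (p - 2) := Real.rpow_le_rpow_of_nonpos hx h (by linarith)
      have h5 : y ^ p = y ^ (p - 2) * y ^ 2 := by
        rw [← Real.rpow_natCast, ← Real.rpow_add hy]; norm_num
      rw [h5, ← hxx]
      calc y ^ (p - 2) * y ^ 2 * (x / y) = y ^ (p - 2) * (x * y) := by field_simp
        _ ≤ x ^ (p - 2) * (x * y) := by gcongr
        _ = _ := by ring
    have h6 : y ^ p * (1 + p * -(x / y)) ≤ y ^ p * (1 + -(x / y)) ^ p := by gcongr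
    have h7 : 0 ≤ y ^ p := by positivity
    rw [e]
    nlinarith
  have hfin : a * (x + y) ^ p + b * (y - x) ^ p
      - p * x ^ (p - 2) * c ≥ 2 ^ (p - 3) * p * (p - 1) * y ^ p := by
    have : p * x ^ (p - 2) * c = (a - b) * (p * x ^ (p - 1) * y) := by
      rw [hcab, ← hxx]; ring
    rw [this]
    have hxp : 0 ≤ x ^ p := by positivity
    have := mul_le_mul_of_nonneg_left hplus ha0
    have := mul_le_mul_of_nonneg_left hminus hb0
    have : 0 ≤ a * x ^ p := by positivity
    have h8 : 2 ^ (p - 3) * p * (p - 1) * y ^ p =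
      a * (2 ^ (p - 3) * p * (p - 1) * y ^ p) + b * (2 ^ (p - 3) * p * (p - 1) * y ^ p) := by
      rw [← add_mul, hab, one_mul]
    nlinarith
  have hxp : 0 ≤ x ^ p := by positivity
  nlinarith

theorem exists_isRemainderConstant {p : ℝ} : ∃ C : ℝ, IsRemainderConstant p C := by
  rcases lt_or_ge p 2 with h | h
  · exact ⟨2 ^ (p - 3) * p * (p - 1), fun h' => absurd h' (not_le.2 h), fun _ => rfl⟩
  · exact ⟨2 ^ (1 - p), fun _ => ⟨by positivity, fun m X Y => two_rpow_mul_norm_rpow_add_le h X Y⟩,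
      fun h' => absurd h' (not_lt.2 h)⟩

theorem IsRemainderConstant.pos {p C : ℝ} (hp : 1 < p) (hC : IsRemainderConstant p C) :
    0 < C := by
  rcases lt_or_ge p 2 with h | h
  · rw [hC.2 h]
    have : 0 < p - 1 := by linarith
    positivity
  · exact (hC.1 h).1

/-- The remainder inequality, in a form that covers all `p > 1`. -/
theorem IsRemainderConstant.norm_rpow_le [FiniteDimensional ℝ V] {p C κ : ℝ} (hp : 1 < p)
    (hC : IsRemainderConstant p C) (hκ : κ = if p < 2 then 2 else 1) (X W : V) :
    (1 - κ * p) * ‖X‖ ^ p + p * ‖X‖ ^ (p - 2) * inner ℝ X W + C * ‖W - X‖ ^ p ≤ ‖W‖ ^ p := by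
  have hXX : ‖X‖ ^ (p - 2) * ‖X‖ ^ 2 = ‖X‖ ^ p := by
    rcases eq_or_ne X 0 with rfl | hX
    · simp [Real.zero_rpow (by linarith : p ≠ 0)]
    · rw [← Real.rpow_natCast, ← Real.rpow_add (norm_pos_iff.2 hX)]; norm_num
  have hin : p * ‖X‖ ^ (p - 2) * inner ℝ X (W - X)
      = p * ‖X‖ ^ (p - 2) * inner ℝ X W - p * ‖X‖ ^ p := by
    rw [inner_sub_right, real_inner_self_eq_norm_sq, ← hXX]; ring
  split_ifs at hκ with h
  · have := two_rpow_mul_norm_rpow_add_le_of_lt_two hp h X (W - X)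
    rw [← hC.2 h, hin, add_sub_cancel] at this
    subst hκ
    linarith
  · have := (hC.1 (not_lt.1 h)).2 _ ((stdOrthonormalBasis ℝ V).repr X)
      ((stdOrthonormalBasis ℝ V).repr (W - X))
    rw [← map_add, LinearIsometryEquiv.norm_map, LinearIsometryEquiv.norm_map,
      LinearIsometryEquiv.norm_map, LinearIsometryEquiv.inner_map_map, hin, add_sub_cancel] at this
    subst hκ
    linarith

end VectorInequalities

section ChartGeometry

variable {n : ℕ} {M : Type*} [TopologicalSpace M] [ChartedSpace (EuclideanSpace ℝ (Fin n)) M]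

/-- The differential of the inverse of `chartAt x₀`, as an endomorphism of the model space. -/
def chartFrame (x₀ : M) (y : EuclideanSpace ℝ (Fin n)) :
    EuclideanSpace ℝ (Fin n) →L[ℝ] EuclideanSpace ℝ (Fin n) :=
  mfderiv (𝓡 n) (𝓡 n) (chartAt (EuclideanSpace ℝ (Fin n)) x₀).symm y

/-- The differential of `chartAt x₀` at the point with coordinates `y`, as an endomorphism of the
model space. -/
def chartCoframe (x₀ : M) (y : EuclideanSpace ℝ (Fin n)) :
    EuclideanSpace ℝ (Fin n) →L[ℝ] EuclideanSpace ℝ (Fin n) :=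
  mfderiv (𝓡 n) (𝓡 n) (chartAt (EuclideanSpace ℝ (Fin n)) x₀)
    ((chartAt (EuclideanSpace ℝ (Fin n)) x₀).symm y)

theorem chartCoframe_chartFrame [IsManifold (𝓡 n) ∞ M] {x₀ : M} {y : EuclideanSpace ℝ (Fin n)}
    (hy : y ∈ (chartAt (EuclideanSpace ℝ (Fin n)) x₀).target) (v : EuclideanSpace ℝ (Fin n)) :
    chartCoframe x₀ y (chartFrame x₀ y v) = v := by
  have : IsManifold (𝓡 n) 1 M := .of_le (n := ∞) (by norm_cast)
  have h := (mdifferentiable_chart (I := 𝓡 n) x₀).comp_symm_deriv hy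
  exact DFunLike.congr_fun h v

theorem chartFrame_chartCoframe [IsManifold (𝓡 n) ∞ M] {x₀ : M} {y : EuclideanSpace ℝ (Fin n)}
    (hy : y ∈ (chartAt (EuclideanSpace ℝ (Fin n)) x₀).target) (v : EuclideanSpace ℝ (Fin n)) :
    chartFrame x₀ y (chartCoframe x₀ y v) = v := by
  have h := LinearMap.comp_eq_id_comm (f := (chartFrame x₀ y).toLinearMap)
    (g := (chartCoframe x₀ y).toLinearMap)
  exact DFunLike.congr_fun (h.2 (LinearMap.ext (chartCoframe_chartFrame hy))) v

theorem chartFrame_transition [IsManifold (𝓡 n) ∞ M] {x₀ x₁ : M} {y : EuclideanSpace ℝ (Fin n)}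
    (hy : y ∈ (chartAt (EuclideanSpace ℝ (Fin n)) x₀).target)
    (hy' : (chartAt (EuclideanSpace ℝ (Fin n)) x₀).symm y ∈
      (chartAt (EuclideanSpace ℝ (Fin n)) x₁).source) (v : EuclideanSpace ℝ (Fin n)) :
    chartFrame x₀ y v = chartFrame x₁ (chartAt (EuclideanSpace ℝ (Fin n)) x₁
        ((chartAt (EuclideanSpace ℝ (Fin n)) x₀).symm y))
      (fderiv ℝ (chartAt (EuclideanSpace ℝ (Fin n)) x₁ ∘
        (chartAt (EuclideanSpace ℝ (Fin n)) x₀).symm) y v) := by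
  have : IsManifold (𝓡 n) 1 M := .of_le (n := ∞) (by norm_cast)
  set e₀ := chartAt (EuclideanSpace ℝ (Fin n)) x₀
  set e₁ := chartAt (EuclideanSpace ℝ (Fin n)) x₁
  have h0 : MDifferentiableAt (𝓡 n) (𝓡 n) e₀.symm y :=
    (mdifferentiable_chart (I := 𝓡 n) x₀).mdifferentiableAt_symm hy
  have h1 : MDifferentiableAt (𝓡 n) (𝓡 n) e₁ (e₀.symm y) :=
    (mdifferentiable_chart (I := 𝓡 n) x₁).mdifferentiableAt hy'
  have hc := mfderiv_comp y h1 h0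
  have hs := (mdifferentiable_chart (I := 𝓡 n) x₁).symm_comp_deriv hy'
  rw [← mfderiv_eq_fderiv, hc]
  exact (DFunLike.congr_fun hs (chartFrame x₀ y v)).symm

theorem hasFDerivAt_transition [IsManifold (𝓡 n) ∞ M] {x₀ x₁ : M}
    {y : EuclideanSpace ℝ (Fin n)}
    (hy : y ∈ (chartAt (EuclideanSpace ℝ (Fin n)) x₀).target)
    (hy' : (chartAt (EuclideanSpace ℝ (Fin n)) x₀).symm y ∈
      (chartAt (EuclideanSpace ℝ (Fin n)) x₁).source) :
    DifferentiableAt ℝ (chartAt (EuclideanSpace ℝ (Fin n)) x₁ ∘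
        (chartAt (EuclideanSpace ℝ (Fin n)) x₀).symm) y := by
  have : IsManifold (𝓡 n) 1 M := .of_le (n := ∞) (by norm_cast)
  rw [← mdifferentiableAt_iff_differentiableAt]
  exact ((mdifferentiable_chart (I := 𝓡 n) x₁).mdifferentiableAt hy').comp y
    ((mdifferentiable_chart (I := 𝓡 n) x₀).mdifferentiableAt_symm hy)

variable [RiemannianBundle (fun x : M => TangentSpace (𝓡 n) x)]

/-- The metric at `x`, as a function on the model space. -/
def tangentInner (x : M) (v w : EuclideanSpace ℝ (Fin n)) : ℝ :=
  @inner ℝ (TangentSpace (𝓡 n) x) _ v w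

theorem metricMatrix_apply (x₀ : M) (y : EuclideanSpace ℝ (Fin n)) (i j : Fin n) :
    metricMatrix x₀ y i j = tangentInner ((chartAt (EuclideanSpace ℝ (Fin n)) x₀).symm y)
      (chartFrame x₀ y (EuclideanSpace.single i 1))
      (chartFrame x₀ y (EuclideanSpace.single j 1)) := rfl

theorem tangentInner_add_left (x : M) (u v w : EuclideanSpace ℝ (Fin n)) :
    tangentInner x (u + v) w = tangentInner x u w + tangentInner x v w :=
  @inner_add_left ℝ (TangentSpace (𝓡 n) x) _ _ _ u v w

theorem tangentInner_smul_left (x : M) (c : ℝ) (v w : EuclideanSpace ℝ (Fin n)) :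
    tangentInner x (c • v) w = c * tangentInner x v w :=
  @real_inner_smul_left (TangentSpace (𝓡 n) x) _ _ v w c

theorem tangentInner_comm (x : M) (v w : EuclideanSpace ℝ (Fin n)) :
    tangentInner x v w = tangentInner x w v :=
  @real_inner_comm (TangentSpace (𝓡 n) x) _ _ w v

/-- `tangentInner` as a bilinear map. -/
def tangentInnerBilin (x : M) :
    EuclideanSpace ℝ (Fin n) →ₗ[ℝ] EuclideanSpace ℝ (Fin n) →ₗ[ℝ] ℝ :=
  LinearMap.mk₂ ℝ (tangentInner x) (tangentInner_add_left x) (tangentInner_smul_left x)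
    (fun u v w => by simp only [tangentInner_comm x u, tangentInner_add_left])
    (fun c v w => by simp only [tangentInner_comm x v, tangentInner_smul_left, smul_eq_mul])

theorem continuousOn_tangentInner_chartFrame [IsManifold (𝓡 n) ∞ M]
    [IsContMDiffRiemannianBundle (𝓡 n) ∞ (EuclideanSpace ℝ (Fin n))
      (fun x : M => TangentSpace (𝓡 n) x)] (x₀ : M) (v w : EuclideanSpace ℝ (Fin n)) :
    ContinuousOn (fun y => tangentInner ((chartAt (EuclideanSpace ℝ (Fin n)) x₀).symm y)
      (chartFrame x₀ y v) (chartFrame x₀ y w))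
      (chartAt (EuclideanSpace ℝ (Fin n)) x₀).target := by
  have : IsManifold (𝓡 n) 1 M := .of_le (n := ∞) (by norm_cast)
  have key : ∀ v : EuclideanSpace ℝ (Fin n), ContinuousOn
      (fun y => (⟨(chartAt (EuclideanSpace ℝ (Fin n)) x₀).symm y, chartFrame x₀ y v⟩ :
        TotalSpace (EuclideanSpace ℝ (Fin n)) (fun x : M => TangentSpace (𝓡 n) x)))
      (chartAt (EuclideanSpace ℝ (Fin n)) x₀).target := by
    intro v
    set e := chartAt (EuclideanSpace ℝ (Fin n)) x₀
    have h1 := (contMDiffOn_chart_symm (I := 𝓡 n) (n := 1) (x := x₀)).continuousOn_tangentMapWithin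
      le_rfl e.open_target.uniqueMDiffOn
    let f : EuclideanSpace ℝ (Fin n) → TangentBundle (𝓡 n) (EuclideanSpace ℝ (Fin n)) :=
      fun y => (tangentBundleModelSpaceHomeomorph (𝓡 n)).symm (y, v)
    have hf : Continuous f :=
      (tangentBundleModelSpaceHomeomorph (𝓡 n)).symm.continuous.comp (by fun_prop)
    refine (h1.comp hf.continuousOn (s := e.target) fun y hy => hy).congr fun y hy => ?_
    have : tangentMapWithin (𝓡 n) (𝓡 n) e.symm e.target (f y)
        = tangentMap (𝓡 n) (𝓡 n) e.symm (f y) :=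
      tangentMapWithin_eq_tangentMap (e.open_target.uniqueMDiffOn _ hy)
        ((mdifferentiable_chart (I := 𝓡 n) x₀).mdifferentiableAt_symm hy)
    exact this.symm
  have h : IsContinuousRiemannianBundle (EuclideanSpace ℝ (Fin n))
      (fun x : M => TangentSpace (𝓡 n) x) := by
    obtain ⟨g, hg, hg'⟩ := IsContMDiffRiemannianBundle.exists_contMDiff (IB := 𝓡 n) (n := ∞)
      (F := EuclideanSpace ℝ (Fin n)) (E := fun x : M => TangentSpace (𝓡 n) x)
    exact ⟨⟨g, hg.continuous, hg'⟩⟩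
  exact ContinuousOn.inner_bundle (key v) (key w)

theorem tangentInner_chartFrame (x₀ : M) (y v w : EuclideanSpace ℝ (Fin n)) :
    tangentInner ((chartAt (EuclideanSpace ℝ (Fin n)) x₀).symm y)
      (chartFrame x₀ y v) (chartFrame x₀ y w) = v.ofLp ⬝ᵥ (metricMatrix x₀ y).mulVec w.ofLp := by
  have hsum : ∀ v : EuclideanSpace ℝ (Fin n), chartFrame x₀ y v =
      ∑ i, v i • chartFrame x₀ y (EuclideanSpace.single i 1) := by
    intro v
    conv_lhs => rw [← (EuclideanSpace.basisFun (Fin n) ℝ).sum_repr v]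
    simp [map_sum]
  rw [hsum v, hsum w]
  change tangentInnerBilin _ _ _ = _
  simp only [dotProduct, Matrix.mulVec, Finset.mul_sum, map_sum, map_smul, LinearMap.smul_apply,
    LinearMap.sum_apply, smul_eq_mul]
  rw [Finset.sum_comm]
  refine Finset.sum_congr rfl fun i _ => Finset.sum_congr rfl fun j _ => ?_
  rw [metricMatrix_apply]
  change _ * (_ * tangentInner _ _ _) = _
  ring

end ChartGeometry

theorem ContinuousOn.measurableSet_inter_preimage {X Y : Type*} [TopologicalSpace X]
    [MeasurableSpace X] [BorelSpace X] [TopologicalSpace Y] [MeasurableSpace Y] [BorelSpace Y]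
    {f : X → Y} {s : Set X} (hf : ContinuousOn f s) (hs : MeasurableSet s) {t : Set Y}
    (ht : MeasurableSet t) : MeasurableSet (s ∩ f ⁻¹' t) := by
  have h := hs.subtype_image (hf.domRestrict.measurable ht)
  convert h using 1
  ext x
  simp [and_comm]

section ChartMeasure

variable {n : ℕ} {M : Type*} [TopologicalSpace M] [ChartedSpace (EuclideanSpace ℝ (Fin n)) M]
  [RiemannianBundle (fun x : M => TangentSpace (𝓡 n) x)]

theorem tangentInner_self_pos (x : M) {v : EuclideanSpace ℝ (Fin n)} (hv : v ≠ 0) :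
    0 < tangentInner x v v :=
  (@real_inner_self_pos (TangentSpace (𝓡 n) x) _ _ v).2 hv

theorem metricMatrix_isHermitian (x₀ : M) (y : EuclideanSpace ℝ (Fin n)) :
    (metricMatrix x₀ y).IsHermitian := by
  ext i j
  simp only [Matrix.conjTranspose_apply, metricMatrix_apply, star_trivial]
  exact tangentInner_comm _ _ _

theorem metricMatrix_posDef [IsManifold (𝓡 n) ∞ M] {x₀ : M} {y : EuclideanSpace ℝ (Fin n)}
    (hy : y ∈ (chartAt (EuclideanSpace ℝ (Fin n)) x₀).target) : (metricMatrix x₀ y).PosDef := by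
  refine Matrix.PosDef.of_dotProduct_mulVec_pos (metricMatrix_isHermitian x₀ y) fun v hv => ?_
  have h := tangentInner_chartFrame x₀ y (WithLp.toLp 2 v) (WithLp.toLp 2 v)
  simp only [star_trivial]
  rw [← h]
  refine tangentInner_self_pos _ fun h0 => hv ?_
  have h1 := chartCoframe_chartFrame hy (WithLp.toLp 2 v)
  rw [h0, map_zero] at h1
  simpa using congrArg WithLp.ofLp h1.symm

theorem det_metricMatrix_pos [IsManifold (𝓡 n) ∞ M] {x₀ : M} {y : EuclideanSpace ℝ (Fin n)}
    (hy : y ∈ (chartAt (EuclideanSpace ℝ (Fin n)) x₀).target) : 0 < (metricMatrix x₀ y).det :=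
  (metricMatrix_posDef hy).det_pos

theorem continuousOn_metricMatrix [IsManifold (𝓡 n) ∞ M]
    [IsContMDiffRiemannianBundle (𝓡 n) ∞ (EuclideanSpace ℝ (Fin n))
      (fun x : M => TangentSpace (𝓡 n) x)] (x₀ : M) :
    ContinuousOn (metricMatrix (n := n) x₀) (chartAt (EuclideanSpace ℝ (Fin n)) x₀).target :=
  continuousOn_pi.2 fun _ => continuousOn_pi.2 fun _ =>
    continuousOn_tangentInner_chartFrame x₀ _ _

theorem continuousOn_sqrt_det_metricMatrix [IsManifold (𝓡 n) ∞ M]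
    [IsContMDiffRiemannianBundle (𝓡 n) ∞ (EuclideanSpace ℝ (Fin n))
      (fun x : M => TangentSpace (𝓡 n) x)] (x₀ : M) :
    ContinuousOn (fun y : EuclideanSpace ℝ (Fin n) => Real.sqrt (metricMatrix x₀ y).det)
      (chartAt (EuclideanSpace ℝ (Fin n)) x₀).target :=
  Real.continuous_sqrt.comp_continuousOn
    ((continuous_id.matrix_det).comp_continuousOn (continuousOn_metricMatrix x₀))

theorem det_metricMatrix_transition [IsManifold (𝓡 n) ∞ M] {x₀ x₁ : M}
    {y : EuclideanSpace ℝ (Fin n)} (hy : y ∈ (chartAt (EuclideanSpace ℝ (Fin n)) x₀).target)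
    (hy' : (chartAt (EuclideanSpace ℝ (Fin n)) x₀).symm y ∈
      (chartAt (EuclideanSpace ℝ (Fin n)) x₁).source) :
    (metricMatrix x₀ y).det = (fderiv ℝ (chartAt (EuclideanSpace ℝ (Fin n)) x₁ ∘
        (chartAt (EuclideanSpace ℝ (Fin n)) x₀).symm) y).det ^ 2 *
      (metricMatrix x₁ (chartAt (EuclideanSpace ℝ (Fin n)) x₁
        ((chartAt (EuclideanSpace ℝ (Fin n)) x₀).symm y))).det := by
  set e₀ := chartAt (EuclideanSpace ℝ (Fin n)) x₀
  set e₁ := chartAt (EuclideanSpace ℝ (Fin n)) x₁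
  set D := fderiv ℝ (e₁ ∘ e₀.symm) y
  set T : Matrix (Fin n) (Fin n) ℝ := LinearMap.toMatrix
    (EuclideanSpace.basisFun (Fin n) ℝ).toBasis (EuclideanSpace.basisFun (Fin n) ℝ).toBasis
    D.toLinearMap
  have hT : T.det = D.det := LinearMap.det_toMatrix _ _
  have hTij : ∀ i j, T i j = D (EuclideanSpace.single j 1) i := by
    intro i j
    simp [T, LinearMap.toMatrix_apply]
  have hg : metricMatrix x₀ y = T.transpose * metricMatrix x₁ (e₁ (e₀.symm y)) * T := by
    ext i j
    rw [metricMatrix_apply, chartFrame_transition hy hy', chartFrame_transition hy hy',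
      ← e₁.left_inv hy', e₁.right_inv (e₁.map_source hy'), tangentInner_chartFrame,
      Matrix.mul_assoc,
      Matrix.mul_apply]
    simp only [dotProduct, Matrix.transpose_apply, Matrix.mul_apply, Matrix.mulVec, hTij]
    rfl
  rw [hg, Matrix.det_mul, Matrix.det_mul, Matrix.det_transpose, hT]
  ring

/-- The measure `√(det g_{ij}) dy` on the target of `chartAt x₀`. -/
def coordVolume (x₀ : M) : Measure (EuclideanSpace ℝ (Fin n)) :=
  (volume.restrict (chartAt (EuclideanSpace ℝ (Fin n)) x₀).target).withDensity
    (fun y => ENNReal.ofReal (Real.sqrt (metricMatrix x₀ y).det))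

theorem ae_coordVolume_mem_target (x₀ : M) : ∀ᵐ y ∂(coordVolume (n := n) x₀),
    y ∈ (chartAt (EuclideanSpace ℝ (Fin n)) x₀).target :=
  (withDensity_absolutelyContinuous _ _).ae_le
    (ae_restrict_mem (chartAt (EuclideanSpace ℝ (Fin n)) x₀).open_target.measurableSet)

variable [MeasurableSpace M]

theorem chartVolume_eq_map (x₀ : M) : chartVolume (n := n) x₀ =
    (coordVolume x₀).map (chartAt (EuclideanSpace ℝ (Fin n)) x₀).symm := rfl

variable [BorelSpace M]

theorem aemeasurable_chart_symm (x₀ : M) :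
    AEMeasurable (chartAt (EuclideanSpace ℝ (Fin n)) x₀).symm (coordVolume x₀) :=
  ((chartAt (EuclideanSpace ℝ (Fin n)) x₀).continuousOn_symm.aemeasurable
    (chartAt (EuclideanSpace ℝ (Fin n)) x₀).open_target.measurableSet).mono_ac
      (withDensity_absolutelyContinuous _ _)

theorem ae_chartVolume_mem_source (x₀ : M) : ∀ᵐ x ∂(chartVolume (n := n) x₀),
    x ∈ (chartAt (EuclideanSpace ℝ (Fin n)) x₀).source := by
  refine (ae_map_iff (aemeasurable_chart_symm x₀)
    (chartAt (EuclideanSpace ℝ (Fin n)) x₀).open_source.measurableSet).2 ?_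
  filter_upwards [ae_coordVolume_mem_target x₀] with y hy
  exact (chartAt (EuclideanSpace ℝ (Fin n)) x₀).map_target hy

theorem chartVolume_restrict_source (x₀ : M) : (chartVolume (n := n) x₀).restrict
    (chartAt (EuclideanSpace ℝ (Fin n)) x₀).source = chartVolume (n := n) x₀ :=
  Measure.restrict_eq_self_of_ae_mem (ae_chartVolume_mem_source x₀)

theorem aemeasurable_chart (x₀ : M) :
    AEMeasurable (chartAt (EuclideanSpace ℝ (Fin n)) x₀) (chartVolume (n := n) x₀) := by
  rw [← chartVolume_restrict_source]
  exact (chartAt (EuclideanSpace ℝ (Fin n)) x₀).continuousOn.aemeasurable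
    (chartAt (EuclideanSpace ℝ (Fin n)) x₀).open_source.measurableSet

theorem map_chart_chartVolume (x₀ : M) :
    (chartVolume (n := n) x₀).map (chartAt (EuclideanSpace ℝ (Fin n)) x₀) = coordVolume x₀ := by
  have h := AEMeasurable.map_map_of_aemeasurable (aemeasurable_chart (n := n) x₀)
    (aemeasurable_chart_symm x₀)
  refine h.trans ?_
  conv_rhs => rw [← Measure.map_id (μ := coordVolume (n := n) x₀)]
  refine Measure.map_congr ?_
  filter_upwards [ae_coordVolume_mem_target x₀] with y hy
  exact (chartAt (EuclideanSpace ℝ (Fin n)) x₀).right_inv hy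

theorem aemeasurable_chartVolume_iff (x₀ : M) {β : Type*} [MeasurableSpace β] {f : M → β} :
    AEMeasurable f (chartVolume (n := n) x₀) ↔
      AEMeasurable (fun y => f ((chartAt (EuclideanSpace ℝ (Fin n)) x₀).symm y))
        (coordVolume (n := n) x₀) := by
  constructor
  · exact fun h => h.comp_aemeasurable (aemeasurable_chart_symm x₀)
  · intro h
    rw [← map_chart_chartVolume] at h
    refine (h.comp_aemeasurable (aemeasurable_chart x₀)).congr ?_
    filter_upwards [ae_chartVolume_mem_source x₀] with x hx
    simp [(chartAt (EuclideanSpace ℝ (Fin n)) x₀).left_inv hx]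

theorem chartVolume_restrict_source_le [IsManifold (𝓡 n) ∞ M] (x₀ x₁ : M) :
    (chartVolume (n := n) x₀).restrict (chartAt (EuclideanSpace ℝ (Fin n)) x₁).source ≤
      chartVolume (n := n) x₁ := by
  refine Measure.le_iff.2 fun A hA => ?_
  set e₀ := chartAt (EuclideanSpace ℝ (Fin n)) x₀ with he₀
  set e₁ := chartAt (EuclideanSpace ℝ (Fin n)) x₁ with he₁
  rw [Measure.restrict_apply hA, chartVolume_eq_map, chartVolume_eq_map,
    Measure.map_apply_of_aemeasurable (aemeasurable_chart_symm x₀)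
      (hA.inter e₁.open_source.measurableSet),
    Measure.map_apply_of_aemeasurable (aemeasurable_chart_symm x₁) hA]
  set B := e₀.target ∩ e₀.symm ⁻¹' (A ∩ e₁.source) with hB
  have hBm : MeasurableSet B := e₀.continuousOn_symm.measurableSet_inter_preimage
    e₀.open_target.measurableSet (hA.inter e₁.open_source.measurableSet)
  have h1 : coordVolume x₀ (e₀.symm ⁻¹' (A ∩ e₁.source)) = coordVolume x₀ B := by
    refine measure_congr ?_
    filter_upwards [ae_coordVolume_mem_target x₀] with y hy
    exact propext ⟨fun h => ⟨hy, h⟩, fun h => h.2⟩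
  have hinj : Set.InjOn (e₁ ∘ e₀.symm) B := by
    intro y hy z hz hyz
    exact e₀.symm.injOn hy.1 hz.1 (e₁.injOn hy.2.2 hz.2.2 hyz)
  have hsub : (e₁ ∘ e₀.symm) '' B ⊆ e₁.symm ⁻¹' A ∩ e₁.target := by
    rintro _ ⟨y, hy, rfl⟩
    refine ⟨?_, e₁.map_source hy.2.2⟩
    simpa [e₁.left_inv hy.2.2] using hy.2.1
  rw [h1, coordVolume, withDensity_apply _ hBm, Measure.restrict_restrict_of_subset
    (Set.inter_subset_left)]
  calc ∫⁻ y in B, ENNReal.ofReal (Real.sqrt (metricMatrix x₀ y).det)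
      = ∫⁻ y in B, ENNReal.ofReal |(fderiv ℝ (e₁ ∘ e₀.symm) y).det| *
          ENNReal.ofReal (Real.sqrt (metricMatrix x₁ ((e₁ ∘ e₀.symm) y)).det) := by
        refine setLIntegral_congr_fun hBm fun y hy => ?_
        rw [det_metricMatrix_transition hy.1 hy.2.2, Real.sqrt_mul (sq_nonneg _),
          Real.sqrt_sq_eq_abs,
          ENNReal.ofReal_mul (abs_nonneg _)]
        rfl
    _ = ∫⁻ z in (e₁ ∘ e₀.symm) '' B, ENNReal.ofReal (Real.sqrt (metricMatrix x₁ z).det) :=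
        (lintegral_image_eq_lintegral_abs_det_fderiv_mul volume hBm
          (fun y hy => (hasFDerivAt_transition hy.1 hy.2.2).hasFDerivAt.hasFDerivWithinAt) hinj
          (fun z => ENNReal.ofReal (Real.sqrt (metricMatrix x₁ z).det))).symm
    _ = ∫⁻ z in (e₁ ∘ e₀.symm) '' B, ENNReal.ofReal (Real.sqrt (metricMatrix x₁ z).det)
          ∂(volume.restrict e₁.target) := by
        rw [Measure.restrict_restrict_of_subset (hsub.trans Set.inter_subset_right)]
    _ ≤ coordVolume x₁ ((e₁ ∘ e₀.symm) '' B) := withDensity_apply_le _ _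
    _ ≤ coordVolume x₁ (e₁.symm ⁻¹' A) := measure_mono (hsub.trans Set.inter_subset_left)

/-- On the domain of a chart, the Riemannian volume is `√(det g_{ij}) dy`. -/
theorem riemannianVolume_restrict_source [IsManifold (𝓡 n) ∞ M] (x₀ : M) :
    (riemannianVolume n M).restrict (chartAt (EuclideanSpace ℝ (Fin n)) x₀).source =
      chartVolume (n := n) x₀ := by
  set S := (chartAt (EuclideanSpace ℝ (Fin n)) x₀).source
  have hS : MeasurableSet S := (chartAt (EuclideanSpace ℝ (Fin n)) x₀).open_source.measurableSet
  apply le_antisymm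
  · have hle : riemannianVolume n M ≤
        chartVolume (n := n) x₀ + (riemannianVolume n M).restrict Sᶜ := by
      refine iSup_le fun x₁ => ?_
      rw [← Measure.restrict_add_restrict_compl (μ := chartVolume (n := n) x₁) hS]
      exact add_le_add (chartVolume_restrict_source_le x₁ x₀)
        (Measure.restrict_mono le_rfl (le_iSup (fun x : M => chartVolume (n := n) x) x₁))
    have := Measure.restrict_mono (le_refl S) hle
    rw [Measure.restrict_add, Measure.restrict_restrict hS, Set.inter_compl_self,
      Measure.restrict_empty, add_zero, chartVolume_restrict_source] at this
    exact this
  · rw [← chartVolume_restrict_source]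
    exact Measure.restrict_mono le_rfl (le_iSup (fun x : M => chartVolume (n := n) x) x₀)

end ChartMeasure

section ChartIntegrals

variable {n : ℕ} {M : Type*} [TopologicalSpace M] [ChartedSpace (EuclideanSpace ℝ (Fin n)) M]

/-- The part of `Ω` in the domain of `chartAt x₀`, in coordinates. -/
def chartRegion (Ω : Set M) (x₀ : M) : Set (EuclideanSpace ℝ (Fin n)) :=
  (chartAt (EuclideanSpace ℝ (Fin n)) x₀).target ∩
    (chartAt (EuclideanSpace ℝ (Fin n)) x₀).symm ⁻¹' Ω

theorem chartRegion_subset_target (Ω : Set M) (x₀ : M) :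
    chartRegion (n := n) Ω x₀ ⊆ (chartAt (EuclideanSpace ℝ (Fin n)) x₀).target :=
  Set.inter_subset_left

theorem isOpen_chartRegion {Ω : Set M} (hΩ : IsOpen Ω) (x₀ : M) :
    IsOpen (chartRegion (n := n) Ω x₀) :=
  (chartAt (EuclideanSpace ℝ (Fin n)) x₀).isOpen_inter_preimage_symm hΩ

variable [RiemannianBundle (fun x : M => TangentSpace (𝓡 n) x)]
  [IsManifold (𝓡 n) ∞ M]
  [IsContMDiffRiemannianBundle (𝓡 n) ∞ (EuclideanSpace ℝ (Fin n))
      (fun x : M => TangentSpace (𝓡 n) x)]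

theorem aemeasurable_sqrt_det (x₀ : M) :
    AEMeasurable (fun y : EuclideanSpace ℝ (Fin n) => Real.sqrt (metricMatrix x₀ y).det)
      (volume.restrict (chartAt (EuclideanSpace ℝ (Fin n)) x₀).target) :=
  (continuousOn_sqrt_det_metricMatrix x₀).aemeasurable
    (chartAt (EuclideanSpace ℝ (Fin n)) x₀).open_target.measurableSet

theorem absolutelyContinuous_coordVolume (x₀ : M) :
    volume.restrict (chartAt (EuclideanSpace ℝ (Fin n)) x₀).target ≪ coordVolume (n := n) x₀ := by
  refine withDensity_absolutelyContinuous' (aemeasurable_sqrt_det x₀).ennreal_ofReal ?_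
  filter_upwards [ae_restrict_mem
    (chartAt (EuclideanSpace ℝ (Fin n)) x₀).open_target.measurableSet] with y hy
  simpa using Real.sqrt_pos.2 (det_metricMatrix_pos hy)

variable [MeasurableSpace M] [BorelSpace M]

theorem aestronglyMeasurable_chartVolume_iff (x₀ : M) {f : M → ℝ} :
    AEStronglyMeasurable f (chartVolume (n := n) x₀) ↔
      AEStronglyMeasurable (fun y => f ((chartAt (EuclideanSpace ℝ (Fin n)) x₀).symm y))
        (coordVolume (n := n) x₀) := by
  rw [aestronglyMeasurable_iff_aemeasurable, aestronglyMeasurable_iff_aemeasurable]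
  exact aemeasurable_chartVolume_iff x₀

theorem integral_chartVolume (x₀ : M) (f : M → ℝ) :
    ∫ x, f x ∂(chartVolume (n := n) x₀) =
      ∫ y, f ((chartAt (EuclideanSpace ℝ (Fin n)) x₀).symm y) ∂(coordVolume (n := n) x₀) := by
  by_cases hf : AEStronglyMeasurable f (chartVolume (n := n) x₀)
  · exact integral_map (aemeasurable_chart_symm x₀) hf
  · rw [integral_non_aestronglyMeasurable hf, integral_non_aestronglyMeasurable]
    rwa [aestronglyMeasurable_chartVolume_iff] at hf

theorem integrable_chartVolume_iff (x₀ : M) {f : M → ℝ} :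
    Integrable f (chartVolume (n := n) x₀) ↔
      Integrable (fun y => f ((chartAt (EuclideanSpace ℝ (Fin n)) x₀).symm y))
        (coordVolume (n := n) x₀) := by
  by_cases hf : AEStronglyMeasurable f (chartVolume (n := n) x₀)
  · exact integrable_map_measure hf (aemeasurable_chart_symm x₀)
  · refine iff_of_false (fun h => hf h.1) fun h => hf ?_
    rw [aestronglyMeasurable_chartVolume_iff]
    exact h.1

theorem indicator_comp_chart_symm_ae (Ω : Set M) (x₀ : M) (f : M → ℝ) :
    (fun y => Ω.indicator f ((chartAt (EuclideanSpace ℝ (Fin n)) x₀).symm y)) =ᵐ[volume.restrict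
      (chartAt (EuclideanSpace ℝ (Fin n)) x₀).target] (chartRegion (n := n) Ω x₀).indicator
        (fun y => f ((chartAt (EuclideanSpace ℝ (Fin n)) x₀).symm y)) := by
  filter_upwards [ae_restrict_mem
    (chartAt (EuclideanSpace ℝ (Fin n)) x₀).open_target.measurableSet] with y hy
  by_cases h : (chartAt (EuclideanSpace ℝ (Fin n)) x₀).symm y ∈ Ω
  · rw [Set.indicator_of_mem h, Set.indicator_of_mem (show y ∈ chartRegion Ω x₀ from ⟨hy, h⟩)]
  · rw [Set.indicator_of_notMem h, Set.indicator_of_notMem (fun h' => h h'.2)]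

theorem aemeasurable_coordVolume_iff (x₀ : M) {f : EuclideanSpace ℝ (Fin n) → ℝ} :
    AEMeasurable f (coordVolume x₀) ↔
      AEMeasurable f (volume.restrict (chartAt (EuclideanSpace ℝ (Fin n)) x₀).target) :=
  ⟨fun h => h.mono_ac (absolutelyContinuous_coordVolume x₀),
    fun h => h.mono_ac (withDensity_absolutelyContinuous _ _)⟩

theorem restrict_inter_source (Ω : Set M) (hΩ : MeasurableSet Ω) (x₀ : M) :
    (riemannianVolume n M).restrict
      (Ω ∩ (chartAt (EuclideanSpace ℝ (Fin n)) x₀).source) =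
        (chartVolume (n := n) x₀).restrict Ω := by
  rw [← Measure.restrict_restrict hΩ, riemannianVolume_restrict_source]

theorem aemeasurable_restrict_inter_source_iff {Ω : Set M} (hΩ : IsOpen Ω) (x₀ : M) {f : M → ℝ} :
    AEMeasurable f ((riemannianVolume n M).restrict
      (Ω ∩ (chartAt (EuclideanSpace ℝ (Fin n)) x₀).source)) ↔
    AEMeasurable (fun y => f ((chartAt (EuclideanSpace ℝ (Fin n)) x₀).symm y))
      (volume.restrict (chartRegion (n := n) Ω x₀)) := by
  rw [restrict_inter_source _ hΩ.measurableSet, ← aemeasurable_indicator_iff hΩ.measurableSet,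
    aemeasurable_chartVolume_iff, aemeasurable_coordVolume_iff,
    aemeasurable_congr (indicator_comp_chart_symm_ae Ω x₀ f),
    aemeasurable_indicator_iff (isOpen_chartRegion hΩ x₀).measurableSet,
    Measure.restrict_restrict_of_subset (chartRegion_subset_target Ω x₀)]

theorem setIntegral_inter_source {Ω : Set M} (hΩ : IsOpen Ω) (x₀ : M) (f : M → ℝ) :
    ∫ x in Ω ∩ (chartAt (EuclideanSpace ℝ (Fin n)) x₀).source, f x ∂(riemannianVolume n M) =
    ∫ y in chartRegion (n := n) Ω x₀, Real.sqrt (metricMatrix x₀ y).det *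
      f ((chartAt (EuclideanSpace ℝ (Fin n)) x₀).symm y) := by
  rw [restrict_inter_source _ hΩ.measurableSet, ← integral_indicator hΩ.measurableSet,
    integral_chartVolume, coordVolume, integral_withDensity_eq_integral_toReal_smul₀
      (aemeasurable_sqrt_det x₀).ennreal_ofReal (by simp)]
  set e := chartAt (EuclideanSpace ℝ (Fin n)) x₀
  have h : (fun y => (ENNReal.ofReal (Real.sqrt (metricMatrix x₀ y).det)).toReal •
      Ω.indicator f (e.symm y)) =ᵐ[volume.restrict e.target]
        (chartRegion (n := n) Ω x₀).indicator
          (fun y => Real.sqrt (metricMatrix x₀ y).det * f (e.symm y)) := by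
    filter_upwards [indicator_comp_chart_symm_ae Ω x₀ f] with y hy
    rw [hy, ENNReal.toReal_ofReal (Real.sqrt_nonneg _), smul_eq_mul, Set.indicator_mul_right]
  rw [integral_congr_ae h, integral_indicator (isOpen_chartRegion hΩ x₀).measurableSet,
    Measure.restrict_restrict_of_subset (chartRegion_subset_target Ω x₀)]

theorem integrableOn_inter_source_iff {Ω : Set M} (hΩ : IsOpen Ω) (x₀ : M) {f : M → ℝ} :
    IntegrableOn f (Ω ∩ (chartAt (EuclideanSpace ℝ (Fin n)) x₀).source) (riemannianVolume n M) ↔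
    IntegrableOn (fun y => Real.sqrt (metricMatrix x₀ y).det *
      f ((chartAt (EuclideanSpace ℝ (Fin n)) x₀).symm y)) (chartRegion (n := n) Ω x₀) := by
  rw [IntegrableOn, restrict_inter_source _ hΩ.measurableSet, ← IntegrableOn,
    ← integrable_indicator_iff hΩ.measurableSet, integrable_chartVolume_iff, coordVolume,
    integrable_withDensity_iff_integrable_smul₀' (aemeasurable_sqrt_det x₀).ennreal_ofReal
      (by simp)]
  set e := chartAt (EuclideanSpace ℝ (Fin n)) x₀
  have h : (fun y => (ENNReal.ofReal (Real.sqrt (metricMatrix x₀ y).det)).toReal •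
      Ω.indicator f (e.symm y)) =ᵐ[volume.restrict e.target]
        (chartRegion (n := n) Ω x₀).indicator
          (fun y => Real.sqrt (metricMatrix x₀ y).det * f (e.symm y)) := by
    filter_upwards [indicator_comp_chart_symm_ae Ω x₀ f] with y hy
    rw [hy, ENNReal.toReal_ofReal (Real.sqrt_nonneg _), smul_eq_mul, Set.indicator_mul_right]
  rw [integrable_congr h, integrable_indicator_iff (isOpen_chartRegion hΩ x₀).measurableSet,
    IntegrableOn, Measure.restrict_restrict_of_subset (chartRegion_subset_target Ω x₀),
    ← IntegrableOn]

theorem exists_countable_iUnion_source [SecondCountableTopology M] : ∃ T : Set M, T.Countable ∧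
    ⋃ x ∈ T, (chartAt (EuclideanSpace ℝ (Fin n)) x).source = Set.univ :=
  TopologicalSpace.countable_cover_nhds fun x => chart_source_mem_nhds _ x

theorem aemeasurable_restrict_of_chart [SecondCountableTopology M] {Ω : Set M} (hΩ : IsOpen Ω)
    {f : M → ℝ} (h : ∀ x₀ : M,
      AEMeasurable (fun y => f ((chartAt (EuclideanSpace ℝ (Fin n)) x₀).symm y))
        (volume.restrict (chartRegion (n := n) Ω x₀))) :
    AEMeasurable f ((riemannianVolume n M).restrict Ω) := by
  obtain ⟨T, hT, hTu⟩ := exists_countable_iUnion_source (n := n) (M := M)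
  have := hT.to_subtype
  have hU : Ω = ⋃ x : T, Ω ∩ (chartAt (EuclideanSpace ℝ (Fin n)) (x : M)).source := by
    rw [← Set.inter_iUnion, ← Set.biUnion_eq_iUnion T
      (fun x _ => (chartAt (EuclideanSpace ℝ (Fin n)) x).source), hTu, Set.inter_univ]
  rw [hU, aemeasurable_iUnion_iff]
  exact fun x => (aemeasurable_restrict_inter_source_iff hΩ _).2 (h x)

end ChartIntegrals

section VectorFieldsInCharts

variable {n : ℕ} {M : Type*} [TopologicalSpace M] [ChartedSpace (EuclideanSpace ℝ (Fin n)) M]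

/-- The components of a vector field in a chart. -/
def chartComponents (G : (x : M) → TangentSpace (𝓡 n) x) (x₀ : M)
    (y : EuclideanSpace ℝ (Fin n)) : EuclideanSpace ℝ (Fin n) :=
  chartCoframe x₀ y (G ((chartAt (EuclideanSpace ℝ (Fin n)) x₀).symm y))

variable [RiemannianBundle (fun x : M => TangentSpace (𝓡 n) x)]

/-- The covector field dual to a vector field, in a chart. -/
def chartCovector (G : (x : M) → TangentSpace (𝓡 n) x) (x₀ : M)
    (y : EuclideanSpace ℝ (Fin n)) : EuclideanSpace ℝ (Fin n) :=
  WithLp.toLp 2 fun i =>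
    inner ℝ (G ((chartAt (EuclideanSpace ℝ (Fin n)) x₀).symm y)) (coordVector x₀ y i)

variable [IsManifold (𝓡 n) ∞ M]

theorem chartFrame_chartComponents (G : (x : M) → TangentSpace (𝓡 n) x) {x₀ : M}
    {y : EuclideanSpace ℝ (Fin n)} (hy : y ∈ (chartAt (EuclideanSpace ℝ (Fin n)) x₀).target) :
    chartFrame x₀ y (chartComponents G x₀ y) =
      G ((chartAt (EuclideanSpace ℝ (Fin n)) x₀).symm y) :=
  chartFrame_chartCoframe hy _

theorem inner_eq_inner_chartCovector (G H : (x : M) → TangentSpace (𝓡 n) x) {x₀ : M}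
    {y : EuclideanSpace ℝ (Fin n)} (hy : y ∈ (chartAt (EuclideanSpace ℝ (Fin n)) x₀).target) :
    inner ℝ (G ((chartAt (EuclideanSpace ℝ (Fin n)) x₀).symm y))
      (H ((chartAt (EuclideanSpace ℝ (Fin n)) x₀).symm y)) =
        inner ℝ (chartCovector G x₀ y) (chartComponents H x₀ y) := by
  change tangentInner _ (G _) (H _) = _
  have h : ∀ i, (chartCovector G x₀ y) i =
      ((metricMatrix x₀ y).mulVec (chartComponents G x₀ y).ofLp) i := by
    intro i
    change tangentInner _ (G _) (chartFrame x₀ y (EuclideanSpace.single i 1)) = _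
    rw [← chartFrame_chartComponents G hy, tangentInner_comm, tangentInner_chartFrame]
    simp [Matrix.mulVec]
  rw [← chartFrame_chartComponents G hy, ← chartFrame_chartComponents H hy, tangentInner_comm,
    tangentInner_chartFrame]
  simp only [PiLp.inner_apply, h, dotProduct]
  simp

theorem metricMatrix_inv_mulVec_chartCovector (G : (x : M) → TangentSpace (𝓡 n) x) {x₀ : M}
    {y : EuclideanSpace ℝ (Fin n)} (hy : y ∈ (chartAt (EuclideanSpace ℝ (Fin n)) x₀).target) :
    (chartComponents G x₀ y).ofLp = (metricMatrix x₀ y)⁻¹.mulVec (chartCovector G x₀ y).ofLp := by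
  have h : (chartCovector G x₀ y).ofLp =
      (metricMatrix x₀ y).mulVec (chartComponents G x₀ y).ofLp := by
    ext i
    change tangentInner _ (G _) (chartFrame x₀ y (EuclideanSpace.single i 1)) = _
    rw [← chartFrame_chartComponents G hy, tangentInner_comm, tangentInner_chartFrame]
    simp [Matrix.mulVec]
  rw [h, Matrix.mulVec_mulVec, Matrix.nonsing_inv_mul _
    (isUnit_iff_ne_zero.2 (det_metricMatrix_pos hy).ne'), Matrix.one_mulVec]

variable [IsContMDiffRiemannianBundle (𝓡 n) ∞ (EuclideanSpace ℝ (Fin n))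
      (fun x : M => TangentSpace (𝓡 n) x)]

theorem continuousOn_metricMatrix_inv (x₀ : M) :
    ContinuousOn (fun y : EuclideanSpace ℝ (Fin n) => (metricMatrix x₀ y)⁻¹)
      (chartAt (EuclideanSpace ℝ (Fin n)) x₀).target := by
  simp only [Matrix.inv_def, Ring.inverse_eq_inv']
  refine ContinuousOn.smul (ContinuousOn.inv₀ ?_ fun y hy => (det_metricMatrix_pos hy).ne') ?_
  · exact (continuous_id.matrix_det).comp_continuousOn (continuousOn_metricMatrix x₀)
  · exact (continuous_id.matrix_adjugate).comp_continuousOn (continuousOn_metricMatrix x₀)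

theorem aemeasurable_chartComponents (G : (x : M) → TangentSpace (𝓡 n) x) (x₀ : M)
    {U : Set (EuclideanSpace ℝ (Fin n))}
    (hU : MeasurableSet U) (hUt : U ⊆ (chartAt (EuclideanSpace ℝ (Fin n)) x₀).target)
    (hG : AEMeasurable (chartCovector G x₀) (volume.restrict U)) :
    AEMeasurable (chartComponents G x₀) (volume.restrict U) := by
  have hinv : ∀ i j, AEMeasurable (fun y => (metricMatrix x₀ y)⁻¹ i j) (volume.restrict U) :=
    fun i j => ContinuousOn.aemeasurable
      (((continuousOn_pi.1 (continuousOn_pi.1 (continuousOn_metricMatrix_inv x₀) i) j)).mono hUt) hU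
  have hGi : ∀ j, AEMeasurable (fun y => chartCovector G x₀ y j) (volume.restrict U) := fun j =>
    (EuclideanSpace.proj (𝕜 := ℝ) j).continuous.measurable.comp_aemeasurable hG
  have h : AEMeasurable (fun y => WithLp.toLp 2 ((metricMatrix x₀ y)⁻¹.mulVec
      (chartCovector G x₀ y).ofLp)) (volume.restrict U) := by
    refine (WithLp.measurable_toLp 2 _).comp_aemeasurable (aemeasurable_pi_lambda _ fun i => ?_)
    simp only [Matrix.mulVec, dotProduct]
    exact Finset.aemeasurable_fun_sum _ fun j _ => (hinv i j).mul (hGi j)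
  refine h.congr ?_
  filter_upwards [ae_restrict_mem hU] with y hy
  rw [← metricMatrix_inv_mulVec_chartCovector G (hUt hy)]

theorem norm_sq_eq_inner_chartCovector (G : (x : M) → TangentSpace (𝓡 n) x) {x₀ : M}
    {y : EuclideanSpace ℝ (Fin n)} (hy : y ∈ (chartAt (EuclideanSpace ℝ (Fin n)) x₀).target) :
    ‖G ((chartAt (EuclideanSpace ℝ (Fin n)) x₀).symm y)‖ ^ 2 =
        inner ℝ (chartCovector G x₀ y) (chartComponents G x₀ y) := by
  rw [← inner_eq_inner_chartCovector G G hy, real_inner_self_eq_norm_sq]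

theorem aemeasurable_norm_of_chartCovector (G : (x : M) → TangentSpace (𝓡 n) x) (x₀ : M)
    {U : Set (EuclideanSpace ℝ (Fin n))}
    (hU : MeasurableSet U) (hUt : U ⊆ (chartAt (EuclideanSpace ℝ (Fin n)) x₀).target)
    (hG : AEMeasurable (chartCovector G x₀) (volume.restrict U)) :
    AEMeasurable (fun y => ‖G ((chartAt (EuclideanSpace ℝ (Fin n)) x₀).symm y)‖)
      (volume.restrict U) := by
  have h := (hG.inner (𝕜 := ℝ) (aemeasurable_chartComponents G x₀ hU hUt hG)).sqrt
  refine h.congr ?_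
  filter_upwards [ae_restrict_mem hU] with y hy
  rw [← norm_sq_eq_inner_chartCovector G (hUt hy), Real.sqrt_sq (norm_nonneg _)]

/-- On compact subsets of a chart, the metric is comparable to the Euclidean one. -/
theorem exists_bound_metricMatrix (x₀ : M) {K : Set (EuclideanSpace ℝ (Fin n))}
    (hK : IsCompact K) (hKt : K ⊆ (chartAt (EuclideanSpace ℝ (Fin n)) x₀).target) :
    ∃ c > 0, ∀ y ∈ K, ∀ v : EuclideanSpace ℝ (Fin n),
      c⁻¹ * ‖v‖ ^ 2 ≤ v.ofLp ⬝ᵥ (metricMatrix x₀ y).mulVec v.ofLp ∧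
      v.ofLp ⬝ᵥ (metricMatrix x₀ y).mulVec v.ofLp ≤ c * ‖v‖ ^ 2 := by
  let q : EuclideanSpace ℝ (Fin n) × EuclideanSpace ℝ (Fin n) → ℝ :=
    fun z => z.2.ofLp ⬝ᵥ (metricMatrix x₀ z.1).mulVec z.2.ofLp
  set S := K ×ˢ Metric.sphere (0 : EuclideanSpace ℝ (Fin n)) 1 with hSdef
  have hS : IsCompact S := hK.prod (isCompact_sphere _ _)
  have hq : ContinuousOn q S := by
    have h2 : ContinuousOn (fun z : EuclideanSpace ℝ (Fin n) × EuclideanSpace ℝ (Fin n) =>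
        metricMatrix x₀ z.1) S :=
      (continuousOn_metricMatrix x₀).comp continuous_fst.continuousOn fun z hz => hKt hz.1
    have h3 : ∀ i j, ContinuousOn (fun z : EuclideanSpace ℝ (Fin n) × EuclideanSpace ℝ (Fin n) =>
        metricMatrix x₀ z.1 i j) S := fun i j => continuousOn_pi.1 (continuousOn_pi.1 h2 i) j
    simp only [q, dotProduct, Matrix.mulVec]
    refine continuousOn_finsetSum _ fun i _ => ContinuousOn.mul (by fun_prop)
      (continuousOn_finsetSum _ fun j _ => (h3 i j).mul (by fun_prop))
  have hpos : ∀ z ∈ S, 0 < q z := by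
    rintro ⟨y, v⟩ ⟨hy, hv⟩
    have := (metricMatrix_posDef (hKt hy)).dotProduct_mulVec_pos (x := v.ofLp) (fun h => by
      have : v = 0 := by simpa using congrArg (WithLp.toLp 2) h
      rw [this] at hv
      simp at hv)
    simpa using this
  obtain ⟨c, hc, hcS⟩ : ∃ c > 0, ∀ z ∈ S, c⁻¹ ≤ q z ∧ q z ≤ c := by
    rcases S.eq_empty_or_nonempty with h | h
    · exact ⟨1, one_pos, by simp [h]⟩
    · obtain ⟨a, ha, hamin⟩ := hS.exists_isMinOn h hq
      obtain ⟨b, hb, hbmax⟩ := hS.exists_isMaxOn h hq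
      refine ⟨max (q a)⁻¹ (q b), lt_max_of_lt_right (hpos b hb), fun z hz => ⟨?_, ?_⟩⟩
      · exact (inv_le_of_inv_le₀ (hpos a ha) (le_max_left _ _)).trans (hamin hz)
      · exact (hbmax hz).trans (le_max_right _ _)
  refine ⟨c, hc, fun y hy v => ?_⟩
  rcases eq_or_ne v 0 with rfl | hv
  · simp
  · have hv' : 0 < ‖v‖ := norm_pos_iff.2 hv
    have h := hcS (y, ‖v‖⁻¹ • v) ⟨hy, by simp [norm_smul, hv'.ne']⟩
    have hqv : q (y, ‖v‖⁻¹ • v) =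
        (‖v‖ ^ 2)⁻¹ * (v.ofLp ⬝ᵥ (metricMatrix x₀ y).mulVec v.ofLp) := by
      simp only [q, WithLp.ofLp_smul, Matrix.mulVec_smul, smul_dotProduct, dotProduct_smul,
        smul_eq_mul]
      ring
    rw [hqv, inv_mul_eq_div, le_div_iff₀ (by positivity), div_le_iff₀ (by positivity)] at h
    exact h

theorem exists_bound_chartCovector_chartComponents (x₀ : M) {K : Set (EuclideanSpace ℝ (Fin n))}
    (hK : IsCompact K) (hKt : K ⊆ (chartAt (EuclideanSpace ℝ (Fin n)) x₀).target) :
    ∃ c > 0, ∀ y ∈ K, ∀ G : (x : M) → TangentSpace (𝓡 n) x,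
      ‖chartCovector G x₀ y‖ ≤ c * ‖G ((chartAt (EuclideanSpace ℝ (Fin n)) x₀).symm y)‖ ∧
      ‖chartComponents G x₀ y‖ ≤ c * ‖G ((chartAt (EuclideanSpace ℝ (Fin n)) x₀).symm y)‖ := by
  obtain ⟨c, hc, h⟩ := exists_bound_metricMatrix x₀ hK hKt
  refine ⟨Real.sqrt c, Real.sqrt_pos.2 hc, fun y hy G => ⟨?_, ?_⟩⟩
  · set w := chartCovector G x₀ y with hw
    -- test the covector on itself
    have h1 : ‖w‖ ^ 2 = tangentInner ((chartAt (EuclideanSpace ℝ (Fin n)) x₀).symm y)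
        (G ((chartAt (EuclideanSpace ℝ (Fin n)) x₀).symm y)) (chartFrame x₀ y w) := by
      have := inner_eq_inner_chartCovector G
        (fun x => (chartFrame x₀ y w : EuclideanSpace ℝ (Fin n))) (hKt hy)
      have h2 : chartComponents (fun x : M => (chartFrame x₀ y w : EuclideanSpace ℝ (Fin n))) x₀ y
          = w := chartCoframe_chartFrame (hKt hy) w
      rw [h2, ← hw, real_inner_self_eq_norm_sq] at this
      exact this.symm
    have h2 := @real_inner_le_norm (TangentSpace (𝓡 n)
      ((chartAt (EuclideanSpace ℝ (Fin n)) x₀).symm y)) _ _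
        (G ((chartAt (EuclideanSpace ℝ (Fin n)) x₀).symm y)) (chartFrame x₀ y w)
    set N : ℝ := @norm (TangentSpace (𝓡 n)
      ((chartAt (EuclideanSpace ℝ (Fin n)) x₀).symm y)) _ (chartFrame x₀ y w) with hN
    have h3 : N ^ 2 ≤ c * ‖w‖ ^ 2 := by
      have h4 : N ^ 2 = tangentInner ((chartAt (EuclideanSpace ℝ (Fin n)) x₀).symm y)
          (chartFrame x₀ y w) (chartFrame x₀ y w) :=
        (@real_inner_self_eq_norm_sq (TangentSpace (𝓡 n)
          ((chartAt (EuclideanSpace ℝ (Fin n)) x₀).symm y)) _ _ (chartFrame x₀ y w)).symm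
      rw [h4, tangentInner_chartFrame]
      exact (h y hy w).2
    have h5 : N ≤ Real.sqrt c * ‖w‖ := by
      refine le_of_sq_le_sq ?_ (by positivity)
      rwa [mul_pow, Real.sq_sqrt hc.le]
    have h6 : ‖w‖ ^ 2 ≤ ‖G ((chartAt (EuclideanSpace ℝ (Fin n)) x₀).symm y)‖ * N :=
      h1.trans_le h2
    rcases (norm_nonneg w).eq_or_lt with h7 | h7
    · rw [← h7]; positivity
    · have h8 : ‖w‖ * ‖w‖ ≤
          (Real.sqrt c * ‖G ((chartAt (EuclideanSpace ℝ (Fin n)) x₀).symm y)‖) * ‖w‖ := by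
        calc ‖w‖ * ‖w‖ ≤ ‖G ((chartAt (EuclideanSpace ℝ (Fin n)) x₀).symm y)‖ * N := by
              rw [← sq]; exact h6
          _ ≤ ‖G ((chartAt (EuclideanSpace ℝ (Fin n)) x₀).symm y)‖ * (Real.sqrt c * ‖w‖) := by
              gcongr
          _ = _ := by ring
      exact le_of_mul_le_mul_right h8 h7
  · have h1 := (h y hy (chartComponents G x₀ y)).1
    have h2 : ‖G ((chartAt (EuclideanSpace ℝ (Fin n)) x₀).symm y)‖ ^ 2 =
        (chartComponents G x₀ y).ofLp ⬝ᵥ (metricMatrix x₀ y).mulVec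
          (chartComponents G x₀ y).ofLp := by
      rw [← tangentInner_chartFrame, chartFrame_chartComponents G (hKt hy)]
      exact (@real_inner_self_eq_norm_sq (TangentSpace (𝓡 n)
          ((chartAt (EuclideanSpace ℝ (Fin n)) x₀).symm y)) _ _ _).symm
    rw [← h2, inv_mul_le_iff₀ hc] at h1
    refine le_of_sq_le_sq ?_ (by positivity)
    rwa [mul_pow, Real.sq_sqrt hc.le]

end VectorFieldsInCharts

section Measurability

variable {n : ℕ} {M : Type*} [TopologicalSpace M] [ChartedSpace (EuclideanSpace ℝ (Fin n)) M]
  [RiemannianBundle (fun x : M => TangentSpace (𝓡 n) x)] [IsManifold (𝓡 n) ∞ M]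
  [IsContMDiffRiemannianBundle (𝓡 n) ∞ (EuclideanSpace ℝ (Fin n))
      (fun x : M => TangentSpace (𝓡 n) x)] [MeasurableSpace M] [BorelSpace M]
  [SecondCountableTopology M] {Ω : Set M} {f : M → ℝ} {G : (x : M) → TangentSpace (𝓡 n) x}

theorem HasWeakGradientOn.aemeasurable (hΩ : IsOpen Ω) (h : HasWeakGradientOn Ω f G) :
    AEMeasurable f ((riemannianVolume n M).restrict Ω) :=
  aemeasurable_restrict_of_chart hΩ fun x₀ => (h x₀).1.aestronglyMeasurable.aemeasurable

theorem HasWeakGradientOn.aemeasurable_chartCovector (h : HasWeakGradientOn Ω f G) (x₀ : M) :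
    AEMeasurable (chartCovector G x₀) (volume.restrict (chartRegion (n := n) Ω x₀)) :=
  (WithLp.measurable_toLp 2 _).comp_aemeasurable (aemeasurable_pi_lambda _ fun i =>
    ((h x₀).2 i).1.aestronglyMeasurable.aemeasurable)

theorem HasWeakGradientOn.aemeasurable_norm (hΩ : IsOpen Ω) (h : HasWeakGradientOn Ω f G) :
    AEMeasurable (fun x => ‖G x‖) ((riemannianVolume n M).restrict Ω) :=
  aemeasurable_restrict_of_chart hΩ fun x₀ =>
    aemeasurable_norm_of_chartCovector G x₀ (isOpen_chartRegion hΩ x₀).measurableSet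
      (chartRegion_subset_target Ω x₀) (h.aemeasurable_chartCovector x₀)

end Measurability

section TestFunctions

variable {n : ℕ} {M : Type*} [TopologicalSpace M] [ChartedSpace (EuclideanSpace ℝ (Fin n)) M]
  {Ω : Set M} {u : M → ℝ}

theorem abs_rpow_sub_two_mul_self_mul_self {p : ℝ} (hp : p ≠ 0) (t : ℝ) :
    |t| ^ (p - 2) * t * t = |t| ^ p := by
  rcases eq_or_ne t 0 with rfl | ht
  · simp [Real.zero_rpow hp]
  · rw [mul_assoc, ← sq, ← sq_abs, ← Real.rpow_natCast, ← Real.rpow_add (abs_pos.2 ht)]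
    norm_num

theorem IsTestFunction.abs_rpow (hu : IsTestFunction n Ω u) {p : ℝ} (hp : 1 < p) :
    IsTestFunction n Ω (fun x => |u x| ^ p) := by
  have hsub : tsupport (fun x => |u x| ^ p) ⊆ tsupport u := by
    refine closure_mono fun x hx => ?_
    rw [Function.mem_support] at hx ⊢
    intro h
    exact hx (by simp [h, Real.zero_rpow (by linarith : p ≠ 0)])
  have hc : ContDiff ℝ 1 (fun t : ℝ => |t| ^ p) := contDiff_norm_rpow (E := ℝ) hp
  exact ⟨hc.contMDiff.comp hu.contMDiff, hu.hasCompactSupport.mono' (subset_closure.trans hsub),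
    hsub.trans hu.tsupport_subset⟩

variable [RiemannianBundle (fun x : M => TangentSpace (𝓡 n) x)]

theorem inner_riemannianGradient_comp {f : M → ℝ} {g : ℝ → ℝ} {g' : ℝ} {x : M}
    (hf : MDifferentiableAt (𝓡 n) 𝓘(ℝ, ℝ) f x) (hg : HasDerivAt g g' (f x))
    (X : TangentSpace (𝓡 n) x) :
    inner ℝ (riemannianGradient (fun z => g (f z)) x) X =
      g' * inner ℝ (riemannianGradient f x) X := by
  rw [inner_riemannianGradient, inner_riemannianGradient]
  have h := mfderiv_comp x hg.differentiableAt.mdifferentiableAt hf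
  have h2 : mfderiv (𝓡 n) 𝓘(ℝ, ℝ) (fun z => g (f z)) x =
    (mfderiv 𝓘(ℝ, ℝ) 𝓘(ℝ, ℝ) g (f x)).comp (mfderiv (𝓡 n) 𝓘(ℝ, ℝ) f x) := h
  rw [h2, mfderiv_eq_fderiv, hg.hasFDerivAt.fderiv]
  exact mul_comm (G := ℝ) (mfderiv (𝓡 n) 𝓘(ℝ, ℝ) f x X) g'

theorem IsTestFunction.inner_riemannianGradient_abs_rpow (hu : IsTestFunction n Ω u) {p : ℝ}
    (hp : 1 < p) (x : M) (X : TangentSpace (𝓡 n) x) :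
    inner ℝ (riemannianGradient (fun z => |u z| ^ p) x) X =
      p * |u x| ^ (p - 2) * u x * inner ℝ (riemannianGradient u x) X :=
  inner_riemannianGradient_comp (g := fun t => |t| ^ p)
    (hu.contMDiff.mdifferentiable one_ne_zero x) (hasDerivAt_abs_rpow (u x) hp) X

variable [MeasurableSpace M] [BorelSpace M]

theorem IsTestFunction.integrableOn_mul [T2Space M] (hu : IsTestFunction n Ω u) (hΩ : IsOpen Ω)
    {μ : Measure M} {f : M → ℝ}
    (hf : LocallyIntegrableOn f Ω μ) : IntegrableOn (fun x => f x * u x) Ω μ := by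
  have hK := hu.hasCompactSupport.isCompact
  have h := hf.integrableOn_compact_subset hu.tsupport_subset hK
  have h2 : IntegrableOn (fun x => f x * u x) (tsupport u) μ :=
    h.mul_continuousOn hu.contMDiff.continuous.continuousOn hK
  refine h2.of_forall_sdiff_eq_zero hΩ.measurableSet fun x hx => ?_
  rw [image_eq_zero_of_notMem_tsupport hx.2, mul_zero]

end TestFunctions

theorem ofReal_integral_le_lintegral_ofReal {X : Type*} [MeasurableSpace X] {μ : Measure X}
    {f : X → ℝ} (hf : Integrable f μ) :
    ENNReal.ofReal (∫ x, f x ∂μ) ≤ ∫⁻ x, ENNReal.ofReal (f x) ∂μ := by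
  calc ENNReal.ofReal (∫ x, f x ∂μ) ≤ ENNReal.ofReal (∫ x, max (f x) 0 ∂μ) :=
        ENNReal.ofReal_le_ofReal (integral_mono hf hf.pos_part fun x => le_max_left _ _)
    _ = ∫⁻ x, ENNReal.ofReal (max (f x) 0) ∂μ :=
        ofReal_integral_eq_lintegral_ofReal hf.pos_part (Eventually.of_forall fun x =>
          le_max_right _ _)
    _ = ∫⁻ x, ENNReal.ofReal (f x) ∂μ := by
        congr with x
        rcases le_total 0 (f x) with h | h
        · rw [max_eq_left h]
        · rw [max_eq_right h, ENNReal.ofReal_zero, ENNReal.ofReal_of_nonpos h]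

theorem norm_smul_rpow_mul_inner {V : Type*} [NormedAddCommGroup V] [InnerProductSpace ℝ V]
    (p c : ℝ) (v w : V) : ‖c • v‖ ^ (p - 2) * inner ℝ (c • v) w =
      |c| ^ (p - 2) * c * (‖v‖ ^ (p - 2) * inner ℝ v w) := by
  rw [norm_smul, Real.mul_rpow (norm_nonneg _) (norm_nonneg _), real_inner_smul_left,
    Real.norm_eq_abs]
  ring

/-- The pointwise inequality behind the Hardy inequality: `W` stands for `∇u`, `R` for `∇ρ`, `Φ`
for `∇φ`, and `t` for `u`. -/
theorem hardy_pointwise {V : Type*} [NormedAddCommGroup V] [InnerProductSpace ℝ V]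
    [FiniteDimensional ℝ V] {p α γ C κ r f t : ℝ} (hp : 1 < p) (hγ : γ ≠ 0)
    (hC : IsRemainderConstant p C) (hκ : κ = if p < 2 then 2 else 1) (hr : 0 < r) (hf : 0 < f)
    (W R Φ : V) :
    (1 - κ * p) * (|γ| / p) ^ p * (‖R‖ ^ p / r ^ (p - α) * |t| ^ p)
      + (|γ| / p) ^ p * p * (1 / γ) *
        (p * |t| ^ (p - 2) * t * (‖R‖ ^ (p - 2) * inner ℝ W R) * r ^ (-p + 1 + α))
      + C * (p * |t| ^ (p - 2) * t * (‖Φ‖ ^ (p - 2) * inner ℝ Φ W) * f ^ (-p + 1) * r ^ α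
        - (p - 1) * (‖Φ‖ ^ p * |t| ^ p * r ^ α * f ^ (-p))
        - γ * (‖Φ‖ ^ (p - 2) * inner ℝ Φ R * |t| ^ p * f ^ (-p + 1) * r ^ (-1 + α)))
      ≤ ‖W‖ ^ p * r ^ α := by
  have hp0 : 0 < p := by linarith
  set c := γ / p * (t / r) with hc
  set d := t / f with hd
  set X := c • R with hX
  set Y := d • Φ with hY
  have hcabs : |c| = |γ| / p * (|t| / r) := by
    rw [hc, abs_mul, abs_div, abs_div, abs_of_pos hp0, abs_of_pos hr]
  have hdabs : |d| = |t| / f := by rw [hd, abs_div, abs_of_pos hf]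
  have h1 := hC.norm_rpow_le hp hκ X W
  have h2 := mul_norm_rpow_sub_two_mul_inner_le hp Y (W - X)
  have e1 : ‖X‖ ^ p * r ^ α = (|γ| / p) ^ p * (‖R‖ ^ p / r ^ (p - α) * |t| ^ p) := by
    rw [hX, norm_smul, Real.norm_eq_abs, hcabs, Real.mul_rpow (by positivity) (by positivity),
      Real.mul_rpow (by positivity) (by positivity), Real.div_rpow (abs_nonneg t) hr.le,
      Real.rpow_sub hr]
    field_simp
  have e2 : p * ‖X‖ ^ (p - 2) * inner ℝ X W * r ^ α = (|γ| / p) ^ p * p * (1 / γ) *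
      (p * |t| ^ (p - 2) * t * (‖R‖ ^ (p - 2) * inner ℝ W R) * r ^ (-p + 1 + α)) := by
    rw [mul_assoc p, hX, norm_smul_rpow_mul_inner, hcabs, hc,
      Real.mul_rpow (by positivity) (by positivity),
      Real.div_rpow (abs_nonneg t) hr.le, real_inner_comm W R]
    have h3 : (|γ| / p) ^ p = (|γ| / p) ^ (p - 2) * (γ / p) ^ 2 := by
      rw [← sq_abs (γ / p), abs_div, abs_of_pos hp0, ← Real.rpow_natCast, ← Real.rpow_add
        (by have := abs_pos.2 hγ; positivity)]
      norm_num
    have h4 : r ^ (-p + 1 + α) = r ^ α / (r ^ (p - 2) * r) := by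
      rw [← Real.rpow_add_one hr.ne', ← Real.rpow_sub hr]; congr 1; ring
    rw [h3, h4]
    field_simp
  have e3 : p * ‖Y‖ ^ (p - 2) * inner ℝ Y (W - X) * r ^ α =
      p * |t| ^ (p - 2) * t * (‖Φ‖ ^ (p - 2) * inner ℝ Φ W) * f ^ (-p + 1) * r ^ α
      - γ * (‖Φ‖ ^ (p - 2) * inner ℝ Φ R * |t| ^ p * f ^ (-p + 1) * r ^ (-1 + α)) := by
    rw [mul_assoc p, hY, norm_smul_rpow_mul_inner, hdabs, hd, inner_sub_right, hX,
      real_inner_smul_right, hc, Real.div_rpow (abs_nonneg t) hf.le,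
      ← abs_rpow_sub_two_mul_self_mul_self hp0.ne' t]
    have h4 : f ^ (-p + 1) = 1 / (f ^ (p - 2) * f) := by
      rw [← Real.rpow_add_one hf.ne', one_div, ← Real.rpow_neg hf.le]; congr 1; ring
    have h5 : r ^ (-1 + α) = r ^ α / r := by
      rw [← Real.rpow_sub_one hr.ne']; congr 1; ring
    rw [h4, h5]
    field_simp
  have e4 : ‖Y‖ ^ p * r ^ α = ‖Φ‖ ^ p * |t| ^ p * r ^ α * f ^ (-p) := by
    rw [hY, norm_smul, Real.norm_eq_abs, hdabs, Real.mul_rpow (by positivity) (by positivity),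
      Real.div_rpow (abs_nonneg t) hf.le, Real.rpow_neg hf.le]
    field_simp
  have hrα : 0 < r ^ α := Real.rpow_pos_of_pos hr α
  have hC0 := hC.pos hp
  have h2' := mul_le_mul_of_nonneg_right h2 hrα.le
  have h1' := mul_le_mul_of_nonneg_right h1 hrα.le
  rw [add_mul, e3, mul_assoc (p - 1), e4] at h2'
  have h6 := mul_le_mul_of_nonneg_left h2' hC0.le
  rw [add_mul, add_mul, e2, mul_assoc (1 - κ * p), e1] at h1'
  linarith

section Hardy

variable {n : ℕ} {M : Type*} [TopologicalSpace M] [T2Space M]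
  [ChartedSpace (EuclideanSpace ℝ (Fin n)) M]
  [RiemannianBundle (fun x : M => TangentSpace (𝓡 n) x)] [MeasurableSpace M] [BorelSpace M]
  {Ω : Set M}

/-- The Hardy inequality for `C_c^1` functions. -/
theorem hardy_of_isTestFunction {p α γ C κ : ℝ} (hp : 1 < p) (hγ : γ ≠ 0)
    (hC : IsRemainderConstant p C) (hκ : κ = if p < 2 then 2 else 1) (hΩ : IsOpen Ω)
    {ρ V φ : M → ℝ} {Dρ Dφ : (x : M) → TangentSpace (𝓡 n) x} (hρ : ∀ x ∈ Ω, 0 < ρ x)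
    (hρLp : LocallyIntegrableOn (fun x => (‖Dρ x‖ * ρ x ^ ((-p + α) / p)) ^ p) Ω
      (riemannianVolume n M))
    (hsuper : ∀ ξ : M → ℝ, IsTestFunction n Ω ξ → (∀ x, 0 ≤ ξ x) →
      IntegrableOn (fun x => inner ℝ (riemannianGradient ξ x) (‖Dρ x‖ ^ (p - 2) • Dρ x)
        * ρ x ^ (-p + 1 + α)) Ω (riemannianVolume n M) ∧
      κ * ∫ x in Ω, ‖Dρ x‖ ^ p / ρ x ^ (p - α) * ξ x ∂(riemannianVolume n M) ≤
        1 / γ * ∫ x in Ω, inner ℝ (riemannianGradient ξ x) (‖Dρ x‖ ^ (p - 2) • Dρ x)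
            * ρ x ^ (-p + 1 + α) ∂(riemannianVolume n M))
    (hV : ∀ x ∈ Ω, 0 ≤ V x)
    (hφ : ∀ᵐ x ∂((riemannianVolume n M).restrict Ω), 0 < φ x)
    (hφV : ∀ ξ : M → ℝ, IsTestFunction n Ω ξ → (∀ x, 0 ≤ ξ x) →
      IntegrableOn (fun x => inner ℝ (‖Dφ x‖ ^ (p - 2) • Dφ x) (riemannianGradient ξ x)
        * φ x ^ (-p + 1) * ρ x ^ α) Ω (riemannianVolume n M) ∧
      IntegrableOn (fun x => ‖Dφ x‖ ^ p * ξ x * ρ x ^ α * φ x ^ (-p)) Ω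
        (riemannianVolume n M) ∧
      IntegrableOn (fun x => inner ℝ (‖Dφ x‖ ^ (p - 2) • Dφ x) (Dρ x) * ξ x
        * φ x ^ (-p + 1) * ρ x ^ (-1 + α)) Ω (riemannianVolume n M) ∧
      IntegrableOn (fun x => V x / C * ξ x * ρ x ^ α) Ω (riemannianVolume n M) ∧
      ∫ x in Ω, V x / C * ξ x * ρ x ^ α ∂(riemannianVolume n M) ≤
        ∫ x in Ω, inner ℝ (‖Dφ x‖ ^ (p - 2) • Dφ x) (riemannianGradient ξ x)
            * φ x ^ (-p + 1) * ρ x ^ α ∂(riemannianVolume n M)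
        - (p - 1) *
          ∫ x in Ω, ‖Dφ x‖ ^ p * ξ x * ρ x ^ α * φ x ^ (-p) ∂(riemannianVolume n M)
        - γ * ∫ x in Ω, inner ℝ (‖Dφ x‖ ^ (p - 2) • Dφ x) (Dρ x) * ξ x
            * φ x ^ (-p + 1) * ρ x ^ (-1 + α) ∂(riemannianVolume n M))
    {u : M → ℝ} (hu : IsTestFunction n Ω u) :
    ∫⁻ x in Ω, ENNReal.ofReal (((|γ| / p) ^ p * (‖Dρ x‖ ^ p / ρ x ^ p) + V x) * ρ x ^ α
        * |u x| ^ p) ∂(riemannianVolume n M) ≤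
      ∫⁻ x in Ω, ENNReal.ofReal (‖riemannianGradient (n := n) u x‖ ^ p * ρ x ^ α)
        ∂(riemannianVolume n M) := by
  have hξ := hu.abs_rpow hp
  have hξ0 : ∀ x, 0 ≤ |u x| ^ p := fun x => by positivity
  have hp0 : 0 < p := by linarith
  have hC0 := hC.pos hp
  set μ := (riemannianVolume n M).restrict Ω with hμ
  obtain ⟨h3, hs⟩ := hsuper _ hξ hξ0
  obtain ⟨h5, h6, h7, h8, hv⟩ := hφV _ hξ hξ0
  have hpow : ∀ x ∈ Ω, (‖Dρ x‖ * ρ x ^ ((-p + α) / p)) ^ p = ‖Dρ x‖ ^ p / ρ x ^ (p - α) := by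
    intro x hx
    rw [Real.mul_rpow (norm_nonneg _) (Real.rpow_nonneg (hρ x hx).le _),
      ← Real.rpow_mul (hρ x hx).le, div_mul_cancel₀ _ hp0.ne', div_eq_mul_inv,
      ← Real.rpow_neg (hρ x hx).le]
    congr 2; ring
  have h2 : IntegrableOn (fun x => ‖Dρ x‖ ^ p / ρ x ^ (p - α) * |u x| ^ p) Ω
      (riemannianVolume n M) :=
    (hξ.integrableOn_mul hΩ hρLp).congr_fun (fun x hx => by simp only [hpow x hx])
      hΩ.measurableSet
  set T2 := fun x => ‖Dρ x‖ ^ p / ρ x ^ (p - α) * |u x| ^ p with hT2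
  set T3 := fun x => inner ℝ (riemannianGradient (fun x => |u x| ^ p) x)
    (‖Dρ x‖ ^ (p - 2) • Dρ x) * ρ x ^ (-p + 1 + α) with hT3
  set T5 := fun x => inner ℝ (‖Dφ x‖ ^ (p - 2) • Dφ x) (riemannianGradient (fun x => |u x| ^ p) x)
    * φ x ^ (-p + 1) * ρ x ^ α with hT5
  set T6 := fun x => ‖Dφ x‖ ^ p * |u x| ^ p * ρ x ^ α * φ x ^ (-p) with hT6
  set T7 := fun x => inner ℝ (‖Dφ x‖ ^ (p - 2) • Dφ x) (Dρ x) * |u x| ^ p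
    * φ x ^ (-p + 1) * ρ x ^ (-1 + α) with hT7
  set T8 := fun x => V x / C * |u x| ^ p * ρ x ^ α with hT8
  set c := (|γ| / p) ^ p with hc
  have hc0 : 0 ≤ c := by positivity
  let Q : M → ℝ := fun x => (1 - κ * p) * c * T2 x + c * p * (1 / γ) * T3 x
    + C * (T5 x - (p - 1) * T6 x - γ * T7 x)
  have hQ1 : Integrable (fun x => (1 - κ * p) * c * T2 x) μ := h2.const_mul _
  have hQ2 : Integrable (fun x => c * p * (1 / γ) * T3 x) μ := h3.const_mul _
  have hQ3 : Integrable (fun x => (p - 1) * T6 x) μ := h6.const_mul _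
  have hQ4 : Integrable (fun x => γ * T7 x) μ := h7.const_mul _
  have hQ5 : Integrable (fun x => T5 x - (p - 1) * T6 x) μ := h5.sub hQ3
  have hQ6 : Integrable (fun x => C * (T5 x - (p - 1) * T6 x - γ * T7 x)) μ :=
    (hQ5.sub hQ4).const_mul _
  have hQ7 : Integrable (fun x => (1 - κ * p) * c * T2 x + c * p * (1 / γ) * T3 x) μ :=
    hQ1.add hQ2
  have hQ : Integrable Q μ := hQ7.add hQ6
  have hQle : ∀ᵐ x ∂μ, Q x ≤ ‖riemannianGradient (n := n) u x‖ ^ p * ρ x ^ α := by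
    filter_upwards [hφ, ae_restrict_mem hΩ.measurableSet] with x hx hxΩ
    have : FiniteDimensional ℝ (TangentSpace (𝓡 n) x) :=
      inferInstanceAs (FiniteDimensional ℝ (EuclideanSpace ℝ (Fin n)))
    have h := hardy_pointwise (α := α) (t := u x) hp hγ hC hκ (hρ x hxΩ) hx
      (riemannianGradient u x) (Dρ x) (Dφ x)
    have e3 : T3 x = p * |u x| ^ (p - 2) * u x *
        (‖Dρ x‖ ^ (p - 2) * inner ℝ (riemannianGradient u x) (Dρ x)) * ρ x ^ (-p + 1 + α) := by
      simp only [hT3]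
      rw [hu.inner_riemannianGradient_abs_rpow hp, real_inner_smul_right]
    have e5 : T5 x = p * |u x| ^ (p - 2) * u x *
        (‖Dφ x‖ ^ (p - 2) * inner ℝ (Dφ x) (riemannianGradient u x)) * φ x ^ (-p + 1)
          * ρ x ^ α := by
      simp only [hT5]
      rw [real_inner_comm, hu.inner_riemannianGradient_abs_rpow hp, real_inner_smul_right,
        real_inner_comm]
    have e7 : T7 x = ‖Dφ x‖ ^ (p - 2) * inner ℝ (Dφ x) (Dρ x) * |u x| ^ p * φ x ^ (-p + 1)
        * ρ x ^ (-1 + α) := by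
      simp only [hT7]
      rw [real_inner_smul_left]
    simp only [Q, e3, e5, e7]
    exact h
  have hint : c * ∫ x, T2 x ∂μ + C * ∫ x, T8 x ∂μ ≤ ∫ x, Q x ∂μ := by
    have : ∫ x, Q x ∂μ = (1 - κ * p) * c * ∫ x, T2 x ∂μ + c * p * (1 / γ) * ∫ x, T3 x ∂μ
        + C * (∫ x, T5 x ∂μ - (p - 1) * ∫ x, T6 x ∂μ - γ * ∫ x, T7 x ∂μ) := by
      simp only [Q]
      rw [integral_add hQ7 hQ6, integral_add hQ1 hQ2, integral_const_mul, integral_const_mul,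
        integral_const_mul, integral_sub hQ5 hQ4, integral_sub h5 hQ3, integral_const_mul,
        integral_const_mul]
    rw [this]
    have a1 := mul_le_mul_of_nonneg_left hs (by positivity : 0 ≤ c * p)
    have a2 := mul_le_mul_of_nonneg_left hv hC0.le
    linarith
  have hT2n : ∀ x ∈ Ω, 0 ≤ T2 x := fun x hx => by
    have := hρ x hx
    simp only [hT2]; positivity
  have hT8n : ∀ x ∈ Ω, 0 ≤ T8 x := fun x hx => by
    have := hρ x hx
    have := hV x hx
    simp only [hT8]; positivity
  have hi1 : Integrable (fun x => c * T2 x) μ := h2.const_mul _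
  have hi2 : Integrable (fun x => C * T8 x) μ := h8.const_mul _
  calc ∫⁻ x, ENNReal.ofReal ((c * (‖Dρ x‖ ^ p / ρ x ^ p) + V x) * ρ x ^ α * |u x| ^ p) ∂μ
      = ∫⁻ x, ENNReal.ofReal (c * T2 x + C * T8 x) ∂μ := by
        refine setLIntegral_congr_fun hΩ.measurableSet fun x hx => ?_
        congr 1
        simp only [hT2, hT8]
        rw [Real.rpow_sub (hρ x hx)]
        have : 0 < ρ x ^ p := Real.rpow_pos_of_pos (hρ x hx) _
        have : 0 < ρ x ^ α := Real.rpow_pos_of_pos (hρ x hx) _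
        field_simp
    _ = ENNReal.ofReal (∫ x, (c * T2 x + C * T8 x) ∂μ) := by
        refine (ofReal_integral_eq_lintegral_ofReal (hi1.add hi2) ?_).symm
        filter_upwards [ae_restrict_mem hΩ.measurableSet] with x hx
        exact add_nonneg (mul_nonneg hc0 (hT2n x hx)) (mul_nonneg hC0.le (hT8n x hx))
    _ ≤ ENNReal.ofReal (∫ x, Q x ∂μ) := by
        refine ENNReal.ofReal_le_ofReal ?_
        rw [integral_add hi1 hi2, integral_const_mul, integral_const_mul]
        exact hint
    _ ≤ ∫⁻ x, ENNReal.ofReal (Q x) ∂μ := ofReal_integral_le_lintegral_ofReal hQ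
    _ ≤ ∫⁻ x, ENNReal.ofReal (‖riemannianGradient (n := n) u x‖ ^ p * ρ x ^ α) ∂μ :=
        lintegral_mono_ae (hQle.mono fun x hx => ENNReal.ofReal_le_ofReal hx)

theorem add_rpow_le_of_convex {p l a b : ℝ} (hp : 1 ≤ p) (hl0 : 0 < l) (hl1 : l < 1) (ha : 0 ≤ a)
    (hb : 0 ≤ b) : (a + b) ^ p ≤ l ^ (1 - p) * a ^ p + (1 - l) ^ (1 - p) * b ^ p := by
  have hl2 : 0 < 1 - l := by linarith
  have h := (convexOn_rpow hp).2 (Set.mem_Ici.2 (div_nonneg ha hl0.le))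
    (Set.mem_Ici.2 (div_nonneg hb hl2.le)) hl0.le hl2.le (by ring)
  simp only [smul_eq_mul] at h
  rw [mul_div_cancel₀ _ hl0.ne', mul_div_cancel₀ _ hl2.ne', Real.div_rpow ha hl0.le,
    Real.div_rpow hb hl2.le] at h
  rw [Real.rpow_sub hl0, Real.rpow_sub hl2, Real.rpow_one, Real.rpow_one]
  refine h.trans_eq ?_
  ring

variable [SecondCountableTopology M] [IsManifold (𝓡 n) ∞ M]
  [IsContMDiffRiemannianBundle (𝓡 n) ∞ (EuclideanSpace ℝ (Fin n))
      (fun x : M => TangentSpace (𝓡 n) x)]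

/-- A weighted inequality for `C_c^1` functions extends to the weighted space `W_0^{1,p}`. -/
theorem lintegral_le_of_memSobolevZero {p : ℝ} (hp : 1 < p) (hΩ : IsOpen Ω) {w W : M → ℝ}
    (hw : ∀ x ∈ Ω, 0 < w x) (hwm : AEMeasurable w ((riemannianVolume n M).restrict Ω))
    (hWm : AEMeasurable W ((riemannianVolume n M).restrict Ω))
    (h : ∀ v : M → ℝ, IsTestFunction n Ω v →
      ∫⁻ x in Ω, ENNReal.ofReal (W x * |v x| ^ p) ∂(riemannianVolume n M) ≤
        ∫⁻ x in Ω, ENNReal.ofReal (‖riemannianGradient (n := n) v x‖ ^ p * w x)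
          ∂(riemannianVolume n M))
    {u : M → ℝ} {Du : (x : M) → TangentSpace (𝓡 n) x} (hu : MemSobolevZero Ω p w u Du) :
    ∫⁻ x in Ω, ENNReal.ofReal (W x * |u x| ^ p) ∂(riemannianVolume n M) ≤
      ∫⁻ x in Ω, ENNReal.ofReal (‖Du x‖ ^ p * w x) ∂(riemannianVolume n M) := by
  have hp0 : 0 < p := by linarith
  set μ := (riemannianVolume n M).restrict Ω with hμ
  obtain ⟨hwg, v, hv, hlim⟩ := hu
  have hum : AEMeasurable u μ := hwg.aemeasurable hΩ
  have hDum : AEMeasurable (fun x => ‖Du x‖) μ := hwg.aemeasurable_norm hΩ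
  have hvm : ∀ k, AEMeasurable (v k) μ := fun k =>
    (hv k).contMDiff.continuous.measurable.aemeasurable
  have hΩae : ∀ᵐ x ∂μ, x ∈ Ω := ae_restrict_mem hΩ.measurableSet
  -- a subsequence converges almost everywhere
  have hmeas : TendstoInMeasure μ (fun k x => |v k x - u x| ^ p * w x) atTop 0 := by
    refine tendstoInMeasure_of_tendsto_eLpNorm one_ne_zero (fun k => ?_)
      aestronglyMeasurable_zero ?_
    · exact (((hvm k).sub hum).norm.pow_const p |>.mul hwm).aestronglyMeasurable
    · refine tendsto_of_tendsto_of_tendsto_of_le_of_le tendsto_const_nhds hlim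
        (fun _ => zero_le) fun k => ?_
      rw [sub_zero, eLpNorm_one_eq_lintegral_enorm]
      refine lintegral_mono_ae ?_
      filter_upwards [hΩae] with x hx
      have := hw x hx
      rw [Real.enorm_of_nonneg (by positivity)]
      refine ENNReal.ofReal_le_ofReal ?_
      rw [add_mul]
      exact le_add_of_nonneg_right (by positivity)
  obtain ⟨ns, hns, hae⟩ := hmeas.exists_seq_tendsto_ae
  have hconv : ∀ᵐ x ∂μ, Tendsto (fun k => ENNReal.ofReal (W x * |v (ns k) x| ^ p)) atTop
      (𝓝 (ENNReal.ofReal (W x * |u x| ^ p))) := by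
    filter_upwards [hae, hΩae] with x hx hxΩ
    have h1 : Tendsto (fun k => |v (ns k) x - u x|) atTop (𝓝 0) := by
      have h2 := (hx.div_const (w x)).rpow_const (p := p⁻¹) (Or.inr (by positivity))
      have h3 : (fun k => (|v (ns k) x - u x| ^ p * w x / w x) ^ p⁻¹) =
          fun k => |v (ns k) x - u x| := by
        funext k
        rw [mul_div_cancel_right₀ _ (hw x hxΩ).ne', Real.rpow_rpow_inv (abs_nonneg _) hp0.ne']
      rw [h3] at h2
      simpa [Real.zero_rpow (inv_ne_zero hp0.ne')] using h2
    have h4 : Tendsto (fun k => v (ns k) x) atTop (𝓝 (u x)) :=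
      tendsto_iff_norm_sub_tendsto_zero.2 h1
    exact ENNReal.tendsto_ofReal ((h4.abs.rpow_const (Or.inr hp0.le)).const_mul _)
  set T := ∫⁻ x, ENNReal.ofReal (‖Du x‖ ^ p * w x) ∂μ with hT
  have hbound : ∀ l : ℝ, 0 < l → l < 1 →
      ∫⁻ x, ENNReal.ofReal (W x * |u x| ^ p) ∂μ ≤ ENNReal.ofReal (l ^ (1 - p)) * T := by
    intro l hl0 hl1
    have hl2 : 0 < 1 - l := by linarith
    have hk : ∀ k, ∫⁻ x, ENNReal.ofReal (W x * |v k x| ^ p) ∂μ ≤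
        ENNReal.ofReal (l ^ (1 - p)) * T + ENNReal.ofReal ((1 - l) ^ (1 - p)) *
          ∫⁻ x, ENNReal.ofReal ((|v k x - u x| ^ p +
            ‖riemannianGradient (n := n) (v k) x - Du x‖ ^ p) * w x) ∂μ := by
      intro k
      refine (h _ (hv k)).trans ?_
      have hTm : AEMeasurable (fun x => ENNReal.ofReal (l ^ (1 - p)) *
          ENNReal.ofReal (‖Du x‖ ^ p * w x)) μ :=
        ((hDum.pow_const p).mul hwm).ennreal_ofReal.const_mul _
      rw [hT, ← lintegral_const_mul' _ _ ENNReal.ofReal_ne_top,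
        ← lintegral_const_mul' _ _ ENNReal.ofReal_ne_top,
        ← lintegral_add_left' hTm]
      refine lintegral_mono_ae ?_
      filter_upwards [hΩae] with x hx
      have := hw x hx
      rw [← ENNReal.ofReal_mul (by positivity), ← ENNReal.ofReal_mul (by positivity),
        ← ENNReal.ofReal_add (by positivity) (by positivity)]
      refine ENNReal.ofReal_le_ofReal ?_
      have h1 : ‖riemannianGradient (n := n) (v k) x‖ ≤
          ‖Du x‖ + ‖riemannianGradient (n := n) (v k) x - Du x‖ := norm_le_insert' _ _
      have h2 := (Real.rpow_le_rpow (norm_nonneg _) h1 hp0.le).trans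
        (add_rpow_le_of_convex hp.le hl0 hl1 (norm_nonneg (Du x))
          (norm_nonneg (riemannianGradient (v k) x - Du x)))
      have h3 := mul_le_mul_of_nonneg_right h2 this.le
      have h4 : 0 ≤ (1 - l) ^ (1 - p) * (|v k x - u x| ^ p * w x) := by positivity
      linarith
    have hlim' : Tendsto (fun k => ENNReal.ofReal (l ^ (1 - p)) * T +
        ENNReal.ofReal ((1 - l) ^ (1 - p)) * ∫⁻ x, ENNReal.ofReal ((|v (ns k) x - u x| ^ p +
            ‖riemannianGradient (n := n) (v (ns k)) x - Du x‖ ^ p) * w x) ∂μ) atTop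
        (𝓝 (ENNReal.ofReal (l ^ (1 - p)) * T)) := by
      have h1 := ENNReal.Tendsto.const_mul (hlim.comp hns.tendsto_atTop)
        (Or.inr (ENNReal.ofReal_ne_top (r := (1 - l) ^ (1 - p))))
      rw [mul_zero] at h1
      simpa using h1.const_add (ENNReal.ofReal (l ^ (1 - p)) * T)
    calc ∫⁻ x, ENNReal.ofReal (W x * |u x| ^ p) ∂μ
        = ∫⁻ x, liminf (fun k => ENNReal.ofReal (W x * |v (ns k) x| ^ p)) atTop ∂μ :=
          lintegral_congr_ae (hconv.mono fun x hx => hx.liminf_eq.symm)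
      _ ≤ liminf (fun k => ∫⁻ x, ENNReal.ofReal (W x * |v (ns k) x| ^ p) ∂μ) atTop :=
          lintegral_liminf_le' fun k =>
            (hWm.mul ((hvm (ns k)).norm.pow_const p)).ennreal_ofReal
      _ ≤ liminf (fun k => ENNReal.ofReal (l ^ (1 - p)) * T +
            ENNReal.ofReal ((1 - l) ^ (1 - p)) * ∫⁻ x, ENNReal.ofReal ((|v (ns k) x - u x| ^ p +
            ‖riemannianGradient (n := n) (v (ns k)) x - Du x‖ ^ p) * w x) ∂μ) atTop :=
          liminf_le_liminf (Eventually.of_forall fun k => hk (ns k))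
      _ = ENNReal.ofReal (l ^ (1 - p)) * T := hlim'.liminf_eq
  have hl : Tendsto (fun l : ℝ => ENNReal.ofReal (l ^ (1 - p)) * T) (𝓝[<] 1) (𝓝 T) := by
    have h1 : Tendsto (fun l : ℝ => l ^ (1 - p)) (𝓝[<] 1) (𝓝 ((1 : ℝ) ^ (1 - p))) :=
      (Real.continuousAt_rpow_const 1 (1 - p) (Or.inl one_ne_zero)).mono_left nhdsWithin_le_nhds
    have h2 := ENNReal.Tendsto.mul_const (b := T) (ENNReal.tendsto_ofReal h1) (Or.inl (by simp))
    simpa using h2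
  refine ge_of_tendsto hl ?_
  filter_upwards [Ioo_mem_nhdsLT (zero_lt_one' ℝ)] with l hl
  exact hbound l hl.1 hl.2

end Hardy

section ConvergenceInMean

variable {X : Type*} [MeasurableSpace X] {μ : Measure X}

theorem exists_seq_tendsto_ae_of_integral_abs_sub {g : ℕ → X → ℝ} {G : X → ℝ}
    (hg : ∀ k, Integrable (g k) μ) (hG : Integrable G μ)
    (h : Tendsto (fun k => ∫ x, |g k x - G x| ∂μ) atTop (𝓝 0)) :
    ∃ ns : ℕ → ℕ, StrictMono ns ∧
      ∀ᵐ x ∂μ, Tendsto (fun k => g (ns k) x) atTop (𝓝 (G x)) := by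
  have h1 : Tendsto (fun k => eLpNorm (g k - G) 1 μ) atTop (𝓝 0) := by
    have h2 : ∀ k, eLpNorm (g k - G) 1 μ = ENNReal.ofReal (∫ x, |g k x - G x| ∂μ) := by
      intro k
      rw [eLpNorm_one_eq_lintegral_enorm, ← ofReal_integral_norm_eq_lintegral_enorm
        ((hg k).sub hG)]
      rfl
    simp_rw [h2]
    simpa using ENNReal.tendsto_ofReal h
  exact (tendstoInMeasure_of_tendsto_eLpNorm one_ne_zero
    (fun k => (hg k).aestronglyMeasurable) hG.aestronglyMeasurable h1).exists_seq_tendsto_ae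

/-- Dominated convergence with a sequence of dominating functions that converges in mean. -/
theorem tendsto_integral_of_abs_le_of_tendsto_mean {f g : ℕ → X → ℝ} {F G : X → ℝ}
    (hf : ∀ k, AEStronglyMeasurable (f k) μ) (hg : ∀ k, Integrable (g k) μ)
    (hG : Integrable G μ) (hfg : ∀ k, ∀ᵐ x ∂μ, |f k x| ≤ g k x)
    (h : Tendsto (fun k => ∫ x, |g k x - G x| ∂μ) atTop (𝓝 0))
    (hF : ∀ᵐ x ∂μ, Tendsto (fun k => f k x) atTop (𝓝 (F x))) :
    Tendsto (fun k => ∫ x, f k x ∂μ) atTop (𝓝 (∫ x, F x ∂μ)) := by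
  obtain ⟨ns, hns, hgae⟩ := exists_seq_tendsto_ae_of_integral_abs_sub hg hG h
  have hFG : ∀ᵐ x ∂μ, |F x| ≤ G x := by
    filter_upwards [hF, hgae, ae_all_iff.2 hfg] with x h1 h2 h3
    exact le_of_tendsto_of_tendsto' (h1.comp hns.tendsto_atTop).abs h2 fun k => h3 _
  have hfint : ∀ k, Integrable (f k) μ := fun k =>
    (hg k).mono' (hf k) (by simpa only [Real.norm_eq_abs] using hfg k)
  set c : ℕ → X → ℝ := fun k x => max (-G x) (min (f k x) (G x)) with hc
  have hcm : ∀ k, AEStronglyMeasurable (c k) μ := fun k =>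
    hG.aestronglyMeasurable.neg.sup ((hf k).inf hG.aestronglyMeasurable)
  have hcG : ∀ k, ∀ᵐ x ∂μ, ‖c k x‖ ≤ G x := by
    intro k
    filter_upwards [hFG] with x hx
    have := (abs_nonneg _).trans hx
    rw [Real.norm_eq_abs, abs_le]
    exact ⟨le_max_left _ _, max_le (by linarith) (min_le_right _ _)⟩
  have hcint : ∀ k, Integrable (c k) μ := fun k => hG.mono' (hcm k) (hcG k)
  have hclim : Tendsto (fun k => ∫ x, c k x ∂μ) atTop (𝓝 (∫ x, F x ∂μ)) := by
    refine tendsto_integral_of_dominated_convergence G hcm hG hcG ?_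
    filter_upwards [hF, hFG] with x h1 h2
    rw [abs_le] at h2
    have h3 := (tendsto_const_nhds (x := -G x)).max (h1.min (tendsto_const_nhds (x := G x)))
    rwa [min_eq_left h2.2, max_eq_right h2.1] at h3
  have hdiff : Tendsto (fun k => ∫ x, (f k x - c k x) ∂μ) atTop (𝓝 0) := by
    refine squeeze_zero_norm (fun k => ?_) h
    refine (norm_integral_le_integral_norm _).trans ?_
    refine integral_mono_ae ((hfint k).sub (hcint k)).norm ((hg k).sub hG).abs ?_
    filter_upwards [hfg k, hFG] with x h1 h2
    have h0 := (abs_nonneg _).trans h2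
    have h4 := le_abs_self (g k x - G x)
    rw [abs_le] at h1
    simp only [Real.norm_eq_abs, hc]
    rcases le_total (f k x) (G x) with h5 | h5
    · rw [min_eq_left h5]
      rcases le_total (-G x) (f k x) with h6 | h6
      · rw [max_eq_right h6]; simp
      · rw [max_eq_left h6, abs_of_nonpos (by linarith)]; simp; linarith
    · rw [min_eq_right h5, max_eq_right (by linarith), abs_of_nonneg (by linarith)]; linarith
  have h7 : ∀ k, ∫ x, f k x ∂μ = ∫ x, (f k x - c k x) ∂μ + ∫ x, c k x ∂μ := by
    intro k
    rw [integral_sub (hfint k) (hcint k)]; ring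
  simp_rw [h7]
  simpa using hdiff.add hclim

end ConvergenceInMean

section Translation

variable {E : Type*} [NormedAddCommGroup E] [NormedSpace ℝ E] [FiniteDimensional ℝ E]
  [MeasurableSpace E] [BorelSpace E] {μ : Measure E} [μ.IsAddHaarMeasure]

theorem tendsto_integral_abs_translate_sub {F : E → ℝ} (hF : Integrable F μ) :
    Tendsto (fun h : E => ∫ x, |F (x + h) - F x| ∂μ) (𝓝 0) (𝓝 0) := by
  have hFL : MemLp F 1 μ := memLp_one_iff_integrable.2 hF
  let f : Lp ℝ 1 μ := hFL.toLp F
  have : Fact ((1 : ℝ≥0∞) ≠ ⊤) := ⟨ENNReal.one_ne_top⟩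
  have hcont : Continuous fun h : E => ‖(DomAddAct.mk h +ᵥ f) - f‖ := by
    have h1 : Continuous fun h : E => (DomAddAct.mk h : Eᵈᵃᵃ) +ᵥ f :=
      (DomAddAct.continuous_mk (M := E)).vadd continuous_const
    exact (h1.sub continuous_const).norm
  have h0 := hcont.tendsto 0
  have h2 : ‖((DomAddAct.mk (0 : E)) +ᵥ f) - f‖ = 0 := by
    rw [show (DomAddAct.mk (0 : E)) = 0 from rfl, zero_vadd, sub_self, norm_zero]
  rw [h2] at h0
  refine h0.congr fun h => ?_
  rw [L1.norm_eq_integral_norm]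
  refine integral_congr_ae ?_
  have h3 := DomAddAct.vadd_Lp_ae_eq (DomAddAct.mk h) f
  have h4 : (fun x => f (h +ᵥ x)) =ᵐ[μ] fun x => F (h +ᵥ x) :=
    (measurePreserving_vadd h μ).quasiMeasurePreserving.ae_eq_comp (hFL.coeFn_toLp)
  filter_upwards [h3, h4, hFL.coeFn_toLp, Lp.coeFn_sub (DomAddAct.mk h +ᵥ f) f]
    with x h5 h6 h7 h8
  rw [h8, Pi.sub_apply, h5, Real.norm_eq_abs, h7]
  simp only [Equiv.symm_apply_apply]
  rw [h6, vadd_eq_add, add_comm]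

theorem measurePreserving_shear (h : E) (ν : Measure ℝ) [SFinite ν] :
    MeasurePreserving (fun q : ℝ × E => (q.1, q.2 + q.1 • h)) (ν.prod μ) (ν.prod μ) := by
  refine MeasurePreserving.skew_product (g := fun t x => x + t • h)
    (MeasurePreserving.id ν) (by fun_prop) ?_
  exact ae_of_all _ fun t => (measurePreserving_add_right μ (t • h)).map_eq

theorem integrable_comp_shear {F : E → ℝ} (hF : Integrable F μ) (h : E) :
    Integrable (fun q : ℝ × E => F (q.2 + q.1 • h))
      ((volume.restrict (Set.Ioc (0 : ℝ) 1)).prod μ) := by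
  have h1 : Integrable (fun q : ℝ × E => F q.2) ((volume.restrict (Set.Ioc (0 : ℝ) 1)).prod μ) :=
    hF.comp_snd _
  exact (measurePreserving_shear h _).integrable_comp_of_integrable h1

theorem integrable_average_translate {F : E → ℝ} (hF : Integrable F μ) (h : E) :
    Integrable (fun x => ∫ t in (0 : ℝ)..1, F (x + t • h)) μ := by
  simp_rw [intervalIntegral.integral_of_le (zero_le_one' ℝ)]
  exact (integrable_comp_shear hF h).integral_prod_right

theorem tendsto_integral_abs_average_translate_sub {F : E → ℝ} (hF : Integrable F μ) :
    Tendsto (fun h : E => ∫ x, |(∫ t in (0 : ℝ)..1, F (x + t • h)) - F x| ∂μ) (𝓝 0) (𝓝 0) := by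
  rw [Metric.tendsto_nhds_nhds]
  intro η hη
  obtain ⟨δ, hδ, hd⟩ := Metric.tendsto_nhds_nhds.1 (tendsto_integral_abs_translate_sub hF)
    (η / 2) (half_pos hη)
  refine ⟨δ, hδ, fun h hh => ?_⟩
  set ν : Measure ℝ := volume.restrict (Set.Ioc (0 : ℝ) 1) with hν
  have : IsProbabilityMeasure ν := ⟨by simp [ν]⟩
  have hsh : Integrable (fun q : ℝ × E => F (q.2 + q.1 • h) - F q.2) (ν.prod μ) :=
    (integrable_comp_shear hF h).sub (hF.comp_snd _)
  have hmain : ∫ x, |(∫ t in (0 : ℝ)..1, F (x + t • h)) - F x| ∂μ ≤ η / 2 := by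
    calc ∫ x, |(∫ t in (0 : ℝ)..1, F (x + t • h)) - F x| ∂μ
        ≤ ∫ x, (∫ t, |F (x + t • h) - F x| ∂ν) ∂μ := by
          refine integral_mono_ae ((integrable_average_translate hF h).sub hF).abs
            hsh.abs.integral_prod_right ?_
          filter_upwards [(integrable_comp_shear hF h).prod_left_ae] with x hx
          have h1 : (∫ t in (0 : ℝ)..1, F (x + t • h)) - F x = ∫ t, (F (x + t • h) - F x) ∂ν := by
            rw [intervalIntegral.integral_of_le zero_le_one, integral_sub hx (integrable_const _)]
            simp
          rw [h1]
          exact abs_integral_le_integral_abs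
      _ = ∫ t, (∫ x, |F (x + t • h) - F x| ∂μ) ∂ν :=
          (integral_integral_swap (f := fun t x => |F (x + t • h) - F x|) hsh.abs).symm
      _ ≤ ∫ _t, η / 2 ∂ν := by
          refine integral_mono_ae hsh.abs.integral_prod_left (integrable_const _) ?_
          filter_upwards [ae_restrict_mem measurableSet_Ioc] with t ht
          have h2 : dist (t • h) 0 < δ := by
            rw [dist_zero_right, norm_smul, Real.norm_eq_abs, abs_of_pos ht.1]
            rw [dist_zero_right] at hh
            nlinarith [norm_nonneg h, ht.2]
          have h3 := hd h2
          rw [Real.dist_eq, sub_zero] at h3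
          exact (le_abs_self _).trans h3.le
      _ = η / 2 := by simp
  rw [Real.dist_eq, sub_zero, abs_of_nonneg (integral_nonneg fun _ => abs_nonneg _)]
  linarith

end Translation

section Lines

variable {E : Type*} [NormedAddCommGroup E] [NormedSpace ℝ E] [FiniteDimensional ℝ E]
  [MeasurableSpace E] [BorelSpace E] {μ : Measure E} [μ.IsAddHaarMeasure]

/-- A function with the weak derivative `q` in the direction `h` satisfies the fundamental theorem
of calculus on almost every segment of direction `h`. -/
theorem ae_sub_eq_integral_of_weak_derivative {F q : E → ℝ} {h : E} {W V : Set E}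
    (hF : Integrable F μ) (hq : Integrable q μ)
    (hweak : ∀ ψ : E → ℝ, ContDiff ℝ ∞ ψ → HasCompactSupport ψ → tsupport ψ ⊆ W →
      ∫ x, F x * fderiv ℝ ψ x h ∂μ = -∫ x, q x * ψ x ∂μ)
    (hV : IsOpen V) (hVW : ∀ x ∈ V, ∀ t ∈ Set.Icc (0 : ℝ) 1, x + t • h ∈ W) :
    ∀ᵐ x ∂μ, x ∈ V → F (x + h) - F x = ∫ t in (0 : ℝ)..1, q (x + t • h) := by
  set ν : Measure ℝ := volume.restrict (Set.Ioc (0 : ℝ) 1) with hν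
  have hFh : Integrable (fun x => F (x + h)) μ := hF.comp_add_right h
  have hav := integrable_average_translate hq h
  have hint : Integrable (fun x => F (x + h) - F x - ∫ t in (0 : ℝ)..1, q (x + t • h)) μ :=
    (hFh.sub hF).sub hav
  suffices H : ∀ᵐ x ∂μ, x ∈ V →
      F (x + h) - F x - (∫ t in (0 : ℝ)..1, q (x + t • h)) = 0 by
    filter_upwards [H] with x hx hxV
    exact sub_eq_zero.1 (hx hxV)
  refine hV.ae_eq_zero_of_integral_contDiff_smul_eq_zero
    (hint.locallyIntegrable.locallyIntegrableOn _)
    fun ψ hψ hψc hψV => ?_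
  have hψcont : Continuous ψ := hψ.continuous
  obtain ⟨C, hC⟩ := hψc.exists_bound_of_continuous hψcont
  have hDc : Continuous (fderiv ℝ ψ) := hψ.continuous_fderiv (by simp)
  obtain ⟨C', hC'⟩ := (hψc.fderiv (𝕜 := ℝ)).exists_bound_of_continuous hDc
  have hbd : ∀ {g : E → ℝ}, Integrable g μ → ∀ k : E → E, Continuous k →
      Integrable (fun x => g x * ψ (k x)) μ := fun hg k hk =>
    hg.mul_bdd (c := C) (hψcont.comp hk).aestronglyMeasurable (ae_of_all _ fun x => hC _)
  -- the translated test functions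
  have hstep : ∀ t ∈ Set.Icc (0 : ℝ) 1,
      ∫ x, F x * fderiv ℝ ψ (x - t • h) h ∂μ = -∫ x, q (x + t • h) * ψ x ∂μ := by
    intro t ht
    have h1 : ContDiff ℝ ∞ fun x => ψ (x - t • h) := hψ.comp (contDiff_id.sub contDiff_const)
    have h2 : HasCompactSupport fun x => ψ (x - t • h) := by
      simpa [sub_eq_add_neg, Function.comp_def] using
        hψc.comp_homeomorph (Homeomorph.addRight (-(t • h)))
    have h3 : tsupport (fun x => ψ (x - t • h)) ⊆ W := by
      intro x hx
      have h4 : x - t • h ∈ tsupport ψ :=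
        tsupport_comp_subset_preimage ψ (f := fun x => x - t • h) (by fun_prop) hx
      simpa using hVW _ (hψV h4) t ht
    have h5 := hweak _ h1 h2 h3
    have h6 : ∀ x, fderiv ℝ (fun x => ψ (x - t • h)) x = fderiv ℝ ψ (x - t • h) := fun x => by
      rw [fderiv_comp_sub]
    simp_rw [h6] at h5
    rw [h5, ← integral_add_right_eq_self _ (t • h)]
    simp
  have hdiff : ∀ x, ψ (x - h) - ψ x = -∫ t, fderiv ℝ ψ (x - t • h) h ∂ν := by
    intro x
    have hd : ∀ t : ℝ, HasDerivAt (fun t : ℝ => ψ (x - t • h)) (-(fderiv ℝ ψ (x - t • h) h)) t := by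
      intro t
      have h1 : HasDerivAt (fun t : ℝ => x - t • h) (-h) t := by
        simpa using ((hasDerivAt_id t).smul_const h).const_sub x
      have h2 := ((hψ.differentiable (by simp)) (x - t • h)).hasFDerivAt.comp_hasDerivAt t h1
      rwa [map_neg] at h2
    have h3 := intervalIntegral.integral_eq_sub_of_hasDerivAt (a := 0) (b := 1)
      (fun t _ => hd t) (Continuous.intervalIntegrable (by fun_prop) _ _)
    rw [intervalIntegral.integral_neg, intervalIntegral.integral_of_le zero_le_one] at h3
    simp only [one_smul, zero_smul, sub_zero] at h3
    rw [← h3]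
  have hP1 : Integrable (fun z : E × ℝ => F z.1 * fderiv ℝ ψ (z.1 - z.2 • h) h) (μ.prod ν) := by
    refine (hF.comp_fst ν).mul_bdd (c := C' * ‖h‖) ?_ (ae_of_all _ fun z => ?_)
    · exact Continuous.aestronglyMeasurable (by fun_prop)
    · exact (ContinuousLinearMap.le_opNorm _ _).trans (by gcongr; exact hC' _)
  have hP2 : Integrable (fun z : E × ℝ => q (z.1 + z.2 • h) * ψ z.1) (μ.prod ν) := by
    refine (integrable_comp_shear hq h).swap.mul_bdd (c := C) ?_ (ae_of_all _ fun z => hC _)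
    exact Continuous.aestronglyMeasurable (by fun_prop)
  have e1 : ∫ x, F (x + h) * ψ x ∂μ = ∫ x, F x * ψ (x - h) ∂μ := by
    rw [← integral_add_right_eq_self (fun x => F x * ψ (x - h)) h]
    simp
  have e2 : ∫ x, (∫ t in (0 : ℝ)..1, q (x + t • h)) * ψ x ∂μ =
      ∫ t, (∫ x, q (x + t • h) * ψ x ∂μ) ∂ν := by
    rw [← integral_integral_swap (f := fun x t => q (x + t • h) * ψ x) hP2]
    refine integral_congr_ae (ae_of_all _ fun x => ?_)
    simp only
    rw [integral_mul_const, intervalIntegral.integral_of_le zero_le_one]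
  have e3 : ∫ x, F x * (ψ (x - h) - ψ x) ∂μ =
      -∫ t, (∫ x, F x * fderiv ℝ ψ (x - t • h) h ∂μ) ∂ν := by
    rw [← integral_integral_swap (f := fun x t => F x * fderiv ℝ ψ (x - t • h) h) hP1,
      ← integral_neg]
    refine integral_congr_ae (ae_of_all _ fun x => ?_)
    simp only
    rw [hdiff, integral_const_mul, mul_neg]
  have e4 : ∫ t, (∫ x, F x * fderiv ℝ ψ (x - t • h) h ∂μ) ∂ν =
      -∫ t, (∫ x, q (x + t • h) * ψ x ∂μ) ∂ν := by
    rw [← integral_neg]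
    refine integral_congr_ae ?_
    filter_upwards [ae_restrict_mem measurableSet_Ioc] with t ht
    exact hstep t ⟨ht.1.le, ht.2⟩
  have hA : Integrable (fun x => F (x + h) * ψ x) μ := hbd hFh id continuous_id
  have hB : Integrable (fun x => F x * ψ x) μ := hbd hF id continuous_id
  have hC2 : Integrable (fun x => (∫ t in (0 : ℝ)..1, q (x + t • h)) * ψ x) μ :=
    hbd hav id continuous_id
  have hD := hbd hF (fun x => x - h) (by fun_prop)
  have e5 : ∫ x, ψ x • (F (x + h) - F x - ∫ t in (0 : ℝ)..1, q (x + t • h)) ∂μ =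
      ∫ x, F (x + h) * ψ x ∂μ - ∫ x, F x * ψ x ∂μ -
        ∫ x, (∫ t in (0 : ℝ)..1, q (x + t • h)) * ψ x ∂μ := by
    rw [← integral_sub hA hB]
    refine Eq.trans ?_ (integral_sub (hA.sub hB) hC2)
    refine integral_congr_ae (ae_of_all _ fun x => ?_)
    simp only [smul_eq_mul]
    ring
  have e6 : ∫ x, F x * (ψ (x - h) - ψ x) ∂μ =
      ∫ x, F x * ψ (x - h) ∂μ - ∫ x, F x * ψ x ∂μ := by
    rw [← integral_sub hD hB]
    simp_rw [mul_sub]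
  rw [e5, e1, ← e6, e3, e4, e2, neg_neg, sub_self]

end Lines

section Levels

theorem Set.Ioo_inter_Ioo_volume_eq_truncation {a b A B r₀ r₁ : ℝ} (hA : A < r₀) (hr : r₀ ≤ r₁)
    (hB : r₁ < B) (hab : max a A < min b B) :
    volume (Set.Ioo a b ∩ Set.Ioo r₀ r₁) =
      ENNReal.ofReal (max (max a A) (min r₁ (min b B)) - max (max a A) (min r₀ (min b B))) := by
  rw [Set.Ioo_inter_Ioo, Real.volume_Ioo]
  simp only [max_def, min_def] at *
  split_ifs at * <;> first
    | rfl
    | (congr 1; linarith)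
    | exact (ENNReal.ofReal_of_nonpos (by linarith)).trans
        (ENNReal.ofReal_of_nonpos (by linarith)).symm

theorem lintegral_Ioo_le_of_truncations_of_le {ϱ q : ℝ → ℝ} (hϱ : Measurable ϱ)
    (hq : Measurable q) {r₀ r₁ : ℝ} (h0 : 0 < r₀) (h01 : r₀ ≤ r₁)
    (h : ∀ a b : ℚ, (0 : ℝ) < a → (a : ℝ) < b →
      IntegrableOn ({t | (a : ℝ) < ϱ t ∧ ϱ t < b}.indicator q) (Set.Ioc 0 1) ∧
      max (a : ℝ) (min r₁ b) - max (a : ℝ) (min r₀ b) =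
        ∫ t in (0 : ℝ)..1, {t | (a : ℝ) < ϱ t ∧ ϱ t < b}.indicator q t)
    {f : ℝ → ℝ≥0∞} (hf : Measurable f) :
    ∫⁻ τ in Set.Ioo r₀ r₁, f τ ≤ ∫⁻ t in Set.Ioc (0 : ℝ) 1, f (ϱ t) * ‖q t‖ₑ := by
  set ν : Measure ℝ := volume.restrict (Set.Ioc 0 1) with hν
  obtain ⟨A, hA0, hA⟩ := exists_rat_btwn h0
  obtain ⟨B, hB, -⟩ := exists_rat_btwn (lt_add_one r₁)
  have hAB : (A : ℝ) < B := by linarith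
  set q' : ℝ → ℝ := {t | (A : ℝ) < ϱ t ∧ ϱ t < B}.indicator q with hq'
  have hS : ∀ a b : ℝ, MeasurableSet {t | a < ϱ t ∧ ϱ t < b} := fun a b =>
    (measurableSet_lt measurable_const hϱ).inter (measurableSet_lt hϱ measurable_const)
  have hq'm : Measurable q' := hq.indicator (hS _ _)
  have hq'i : Integrable q' ν := (h A B hA0 hAB).1
  set mp : Measure ℝ := (ν.withDensity fun t => ENNReal.ofReal (q' t)).map ϱ with hmp
  set mn : Measure ℝ := (ν.withDensity fun t => ENNReal.ofReal (-q' t)).map ϱ with hmn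
  have hfin : ∀ {g : ℝ → ℝ}, Integrable g ν → IsFiniteMeasure
      ((ν.withDensity fun t => ENNReal.ofReal (g t)).map ϱ) := by
    intro g hg
    have := isFiniteMeasure_withDensity_ofReal hg.2
    infer_instance
  have : IsFiniteMeasure mp := hfin hq'i
  have : IsFiniteMeasure mn := hfin hq'i.neg
  have key : mp = mn + volume.restrict (Set.Ioo r₀ r₁) := by
    refine Real.measure_ext_Ioo_rat fun a b => ?_
    have hmeas : ∀ g : ℝ → ℝ, ((ν.withDensity fun t => ENNReal.ofReal (g t)).map ϱ)
        (Set.Ioo (a : ℝ) b) = ∫⁻ t in ϱ ⁻¹' Set.Ioo (a : ℝ) b, ENNReal.ofReal (g t) ∂ν := by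
      intro g
      rw [Measure.map_apply hϱ measurableSet_Ioo,
        withDensity_apply _ (hϱ measurableSet_Ioo)]
    rw [Measure.add_apply, Measure.restrict_apply measurableSet_Ioo, hmp, hmn, hmeas,
      hmeas fun t => -q' t]
    rcases lt_or_ge (max a A) (min b B) with hab | hab
    · have hab' : ((max a A : ℚ) : ℝ) < ((min b B : ℚ) : ℝ) := by exact_mod_cast hab
      obtain ⟨hi, he⟩ := h (max a A) (min b B)
        (lt_of_lt_of_le hA0 (by exact_mod_cast le_max_right a A)) hab'
      set q'' : ℝ → ℝ :=
        {t | ((max a A : ℚ) : ℝ) < ϱ t ∧ ϱ t < ((min b B : ℚ) : ℝ)}.indicator q with hq''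
      have hind : ∀ t, (ϱ ⁻¹' Set.Ioo (a : ℝ) b).indicator q' t = q'' t := by
        intro t
        have hset : ϱ ⁻¹' Set.Ioo (a : ℝ) b ∩ {t | (A : ℝ) < ϱ t ∧ ϱ t < B} =
            {t | ((max a A : ℚ) : ℝ) < ϱ t ∧ ϱ t < ((min b B : ℚ) : ℝ)} := by
          ext t
          simp only [Set.mem_inter_iff, Set.mem_preimage, Set.mem_Ioo, Set.mem_ofPred_eq,
            Rat.cast_max, Rat.cast_min, max_lt_iff, lt_min_iff]
          tauto
        rw [hq', hq'', Set.indicator_indicator, hset]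
      have e1 : ∀ {g g' : ℝ → ℝ}, (∀ t, (ϱ ⁻¹' Set.Ioo (a : ℝ) b).indicator g t = g' t) →
          ∫⁻ t in ϱ ⁻¹' Set.Ioo (a : ℝ) b, ENNReal.ofReal (g t) ∂ν =
            ∫⁻ t, ENNReal.ofReal (g' t) ∂ν := by
        intro g g' hg
        rw [← lintegral_indicator (hϱ measurableSet_Ioo)]
        refine lintegral_congr fun t => ?_
        rw [← hg]
        by_cases ht : t ∈ ϱ ⁻¹' Set.Ioo (a : ℝ) b
        · simp [ht]
        · simp [ht]
      rw [e1 hind, e1 (g := fun t => -q' t) (g' := fun t => -q'' t) (fun t => by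
        rw [← hind]
        by_cases ht : t ∈ ϱ ⁻¹' Set.Ioo (a : ℝ) b
        · rw [Set.indicator_of_mem ht, Set.indicator_of_mem ht]
        · rw [Set.indicator_of_notMem ht, Set.indicator_of_notMem ht, neg_zero])]
      have h4 := integral_eq_lintegral_pos_part_sub_lintegral_neg_part hi
      rw [intervalIntegral.integral_of_le zero_le_one, h4] at he
      have f1 : ∫⁻ t, ENNReal.ofReal (q'' t) ∂ν ≠ ⊤ := hi.lintegral_lt_top.ne
      have f2 : ∫⁻ t, ENNReal.ofReal (-q'' t) ∂ν ≠ ⊤ := hi.neg.lintegral_lt_top.ne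
      have hv := Set.Ioo_inter_Ioo_volume_eq_truncation (a := a) (b := b) hA h01 hB
        (by exact_mod_cast hab')
      have hmono : max ((max a A : ℚ) : ℝ) (min r₀ ((min b B : ℚ) : ℝ)) ≤
          max ((max a A : ℚ) : ℝ) (min r₁ ((min b B : ℚ) : ℝ)) := by gcongr
      simp only [Rat.cast_max, Rat.cast_min] at he hmono
      rw [hv, ← ENNReal.ofReal_toReal f1, ← ENNReal.ofReal_toReal f2, ← ENNReal.ofReal_add
        ENNReal.toReal_nonneg (by linarith)]
      congr 1
      linarith
    · have hab' : min (b : ℝ) B ≤ max (a : ℝ) A := by exact_mod_cast hab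
      have hE : ∀ x : ℝ, (a : ℝ) < x → x < b → (A : ℝ) < x → x < B → False := by
        intro x h1 h2 h3 h4
        exact absurd (lt_min h2 h4) (not_lt.2 (hab'.trans (max_lt h1 h3).le))
      have e0 : ∀ {g : ℝ → ℝ}, (∀ t, q' t = 0 → g t = 0) →
          ∫⁻ t in ϱ ⁻¹' Set.Ioo (a : ℝ) b, ENNReal.ofReal (g t) ∂ν = 0 := by
        intro g hg
        rw [setLIntegral_congr_fun (g := fun _ => 0) (hϱ measurableSet_Ioo), lintegral_zero]
        intro t ht
        have : q' t = 0 := Set.indicator_of_notMem (fun h' => hE _ ht.1 ht.2 h'.1 h'.2) _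
        simp [hg t this]
      rw [e0 fun t ht => ht, e0 (g := fun t => -q' t) fun t ht => by simp [ht], zero_add]
      have : Set.Ioo (a : ℝ) b ∩ Set.Ioo r₀ r₁ = ∅ := by
        ext x
        simp only [Set.mem_inter_iff, Set.mem_Ioo, Set.mem_empty_iff_false, iff_false]
        rintro ⟨⟨h1, h2⟩, h3, h4⟩
        exact hE x h1 h2 (hA.trans h3) (h4.trans hB)
      rw [this, measure_empty]
  calc ∫⁻ τ in Set.Ioo r₀ r₁, f τ ≤ ∫⁻ τ, f τ ∂mp := by
        rw [key, lintegral_add_measure]; exact le_add_self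
    _ = ∫⁻ t, ENNReal.ofReal (q' t) * f (ϱ t) ∂ν := by
        rw [hmp, lintegral_map hf hϱ]
        exact lintegral_withDensity_eq_lintegral_mul _ hq'm.ennreal_ofReal (hf.comp hϱ)
    _ ≤ ∫⁻ t, f (ϱ t) * ‖q t‖ₑ ∂ν := by
        refine lintegral_mono fun t => ?_
        rw [mul_comm]
        gcongr
        rw [← ofReal_norm]
        refine ENNReal.ofReal_le_ofReal ((le_abs_self _).trans ?_)
        exact norm_indicator_le_norm_self q t

/-- A function of one variable, all truncations of which are absolutely continuous, passes all
levels between its end values. -/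
theorem lintegral_Ioo_le_of_truncations {ϱ q : ℝ → ℝ} (hϱ : Measurable ϱ)
    (hq : Measurable q) {r₀ r₁ : ℝ} (h0 : 0 < r₀) (h1 : 0 < r₁)
    (h : ∀ a b : ℚ, (0 : ℝ) < a → (a : ℝ) < b →
      IntegrableOn ({t | (a : ℝ) < ϱ t ∧ ϱ t < b}.indicator q) (Set.Ioc 0 1) ∧
      max (a : ℝ) (min r₁ b) - max (a : ℝ) (min r₀ b) =
        ∫ t in (0 : ℝ)..1, {t | (a : ℝ) < ϱ t ∧ ϱ t < b}.indicator q t)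
    {f : ℝ → ℝ≥0∞} (hf : Measurable f) :
    ∫⁻ τ in Set.Ioo (min r₀ r₁) (max r₀ r₁), f τ ≤
      ∫⁻ t in Set.Ioc (0 : ℝ) 1, f (ϱ t) * ‖q t‖ₑ := by
  rcases le_total r₀ r₁ with h01 | h01
  · rw [min_eq_left h01, max_eq_right h01]
    exact lintegral_Ioo_le_of_truncations_of_le hϱ hq h0 h01 h hf
  · rw [min_eq_right h01, max_eq_left h01]
    refine (lintegral_Ioo_le_of_truncations_of_le hϱ hq.neg h1 h01 (fun a b ha hab => ?_)
      hf).trans_eq (by simp)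
    obtain ⟨h2, h3⟩ := h a b ha hab
    rw [show -q = fun t => -q t from rfl, Set.indicator_neg]
    refine ⟨h2.neg, ?_⟩
    simp only [intervalIntegral.integral_neg]
    linarith

theorem rpow_le_add_lintegral {c r : ℝ} (hc : 0 < c) (hr : 0 < r) (δ : ℝ) :
    ENNReal.ofReal (r ^ δ) ≤ ENNReal.ofReal (c ^ δ) + ENNReal.ofReal |δ| *
      ∫⁻ τ in Set.Ioo (min c r) (max c r), ENNReal.ofReal (τ ^ (δ - 1)) := by
  have hpos : ∀ τ ∈ Set.uIcc c r, 0 < τ := fun τ hτ => lt_of_lt_of_le (lt_min hc hr) hτ.1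
  have h1 : ∫ τ in c..r, δ * τ ^ (δ - 1) = r ^ δ - c ^ δ := by
    refine intervalIntegral.integral_eq_sub_of_hasDerivAt (f := fun τ : ℝ => τ ^ δ)
      (fun τ hτ => ?_) ?_
    · exact Real.hasDerivAt_rpow_const (Or.inl (hpos τ hτ).ne')
    · refine ContinuousOn.intervalIntegrable fun τ hτ => ?_
      exact ((Real.continuousAt_rpow_const τ (δ - 1) (Or.inl (hpos τ hτ).ne')).const_mul
        δ).continuousWithinAt
  have h2 : r ^ δ ≤ c ^ δ + |∫ τ in c..r, δ * τ ^ (δ - 1)| := by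
    rw [h1]; linarith [le_abs_self (r ^ δ - c ^ δ)]
  refine (ENNReal.ofReal_le_ofReal h2).trans ?_
  rw [ENNReal.ofReal_add (by positivity) (abs_nonneg _)]
  gcongr
  rw [← Real.norm_eq_abs, intervalIntegral.norm_intervalIntegral_eq, ofReal_norm,
    ← lintegral_const_mul' _ _ ENNReal.ofReal_ne_top]
  refine (enorm_integral_le_lintegral_enorm _).trans ?_
  rw [Set.uIoc, Measure.restrict_congr_set Ioo_ae_eq_Ioc.symm]
  refine setLIntegral_mono' measurableSet_Ioo fun τ hτ => ?_
  have : 0 < τ := (lt_min hc hr).trans hτ.1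
  rw [← ENNReal.ofReal_mul (abs_nonneg _), ← ofReal_norm, norm_mul, Real.norm_eq_abs,
    Real.norm_of_nonneg (by positivity)]

theorem exists_rpow_bounds_Icc {a b : ℝ} (ha : 0 < a) (δ : ℝ) :
    ∃ m N : ℝ, 0 < m ∧ 0 < N ∧ ∀ τ ∈ Set.Icc a b, m ≤ τ ^ δ ∧ τ ^ δ ≤ N := by
  have hc : ContinuousOn (fun τ : ℝ => τ ^ δ) (Set.Icc a b) := fun τ hτ =>
    (Real.continuousAt_rpow_const τ δ (Or.inl (ha.trans_le hτ.1).ne')).continuousWithinAt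
  rcases le_or_gt a b with hab | hab
  · obtain ⟨x, hx, hxm⟩ := isCompact_Icc.exists_isMinOn (Set.nonempty_Icc.2 hab) hc
    obtain ⟨y, hy, hym⟩ := isCompact_Icc.exists_isMaxOn (Set.nonempty_Icc.2 hab) hc
    exact ⟨x ^ δ, y ^ δ, Real.rpow_pos_of_pos (ha.trans_le hx.1) _,
      Real.rpow_pos_of_pos (ha.trans_le hy.1) _, fun τ hτ => ⟨hxm hτ, hym hτ⟩⟩
  · exact ⟨1, 1, one_pos, one_pos, fun τ hτ => absurd (hτ.1.trans hτ.2) (not_le.2 hab)⟩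

theorem exists_rpow_mul_abs_truncation_sub_le {a b : ℝ} (ha : 0 < a) (hab : a < b) (δ : ℝ) :
    ∃ C : ℝ, 0 < C ∧ ∀ r₀ r₁ : ℝ, 0 < r₀ → 0 < r₁ →
      ENNReal.ofReal (r₁ ^ δ * |max a (min r₁ b) - max a (min r₀ b)|) ≤
        ENNReal.ofReal C *
          ∫⁻ τ in Set.Ioo (min r₀ r₁) (max r₀ r₁), ENNReal.ofReal (τ ^ (δ - 1)) := by
  obtain ⟨m, N₁, hm, hN₁, hmN⟩ := exists_rpow_bounds_Icc (b := b) ha (δ - 1)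
  obtain ⟨m₁, N, hm₁, hN, hmN'⟩ := exists_rpow_bounds_Icc (b := b) ha δ
  refine ⟨N / m + (b - a) * |δ|, add_pos_of_pos_of_nonneg (by positivity)
    (mul_nonneg (by linarith) (abs_nonneg _)), fun r₀ r₁ h0 h1 => ?_⟩
  set c₀ := max a (min r₀ b) with hc₀
  set c₁ := max a (min r₁ b) with hc₁
  have hc0 : c₀ ∈ Set.Icc a b := ⟨le_max_left _ _, max_le hab.le (min_le_right _ _)⟩
  have hc1 : c₁ ∈ Set.Icc a b := ⟨le_max_left _ _, max_le hab.le (min_le_right _ _)⟩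
  rcases eq_or_ne c₀ c₁ with he | hne
  · simp [he]
  have hc1p : 0 < c₁ := ha.trans_le hc1.1
  set I : ℝ → ℝ → ℝ≥0∞ := fun x y =>
    ∫⁻ τ in Set.Ioo (min x y) (max x y), ENNReal.ofReal (τ ^ (δ - 1)) with hI
  have hord : min r₀ r₁ ≤ min c₀ c₁ ∧ max c₀ c₁ ≤ max r₀ r₁ ∧
      min r₀ r₁ ≤ r₁ ∧ r₁ ≤ max r₀ r₁ := by
    refine ⟨?_, ?_, min_le_right _ _, le_max_right _ _⟩
    all_goals
      simp only [hc₀, hc₁, max_def, min_def] at *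
      split_ifs at * <;> first | linarith | (exfalso; apply hne; linarith)
  have hI1 : I c₀ c₁ ≤ I r₀ r₁ :=
    lintegral_mono_set (Set.Ioo_subset_Ioo hord.1 hord.2.1)
  have hI2 : I c₁ r₁ ≤ I r₀ r₁ :=
    lintegral_mono_set (Set.Ioo_subset_Ioo
      (le_min (hord.1.trans (min_le_right _ _)) hord.2.2.1)
      (max_le ((le_max_right _ _).trans hord.2.1) hord.2.2.2))
  have hI3 : ENNReal.ofReal (m * |c₁ - c₀|) ≤ I c₀ c₁ := by
    calc ENNReal.ofReal (m * |c₁ - c₀|)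
        = ∫⁻ _τ in Set.Ioo (min c₀ c₁) (max c₀ c₁), ENNReal.ofReal m := by
          rw [setLIntegral_const, Real.volume_Ioo, max_sub_min_eq_abs, ENNReal.ofReal_mul hm.le]
      _ ≤ I c₀ c₁ := by
          refine setLIntegral_mono' measurableSet_Ioo fun τ hτ => ENNReal.ofReal_le_ofReal ?_
          exact (hmN τ ⟨(le_min hc0.1 hc1.1).trans hτ.1.le,
            hτ.2.le.trans (max_le hc0.2 hc1.2)⟩).1
  have habs : |c₁ - c₀| ≤ b - a := by
    rw [abs_le]; constructor <;> linarith [hc0.1, hc0.2, hc1.1, hc1.2]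
  calc ENNReal.ofReal (r₁ ^ δ * |c₁ - c₀|)
      = ENNReal.ofReal (r₁ ^ δ) * ENNReal.ofReal |c₁ - c₀| := ENNReal.ofReal_mul (by positivity)
    _ ≤ (ENNReal.ofReal (c₁ ^ δ) + ENNReal.ofReal |δ| * I c₁ r₁) * ENNReal.ofReal |c₁ - c₀| := by
        gcongr
        exact rpow_le_add_lintegral hc1p h1 δ
    _ = ENNReal.ofReal (c₁ ^ δ) * ENNReal.ofReal |c₁ - c₀| +
          ENNReal.ofReal |c₁ - c₀| * ENNReal.ofReal |δ| * I c₁ r₁ := by ring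
    _ ≤ ENNReal.ofReal (N / m) * I r₀ r₁ + ENNReal.ofReal ((b - a) * |δ|) * I r₀ r₁ := by
        gcongr ?_ + ?_
        · refine le_trans ?_ (mul_le_mul_right (hI3.trans hI1) _)
          rw [← ENNReal.ofReal_mul (by positivity), ← ENNReal.ofReal_mul (by positivity)]
          refine ENNReal.ofReal_le_ofReal ?_
          rw [← mul_assoc, div_mul_cancel₀ _ hm.ne']
          gcongr
          exact (hmN' _ hc1).2
        · rw [← ENNReal.ofReal_mul (abs_nonneg _)]
          gcongr
    _ = ENNReal.ofReal (N / m + (b - a) * |δ|) * I r₀ r₁ := by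
        rw [← add_mul, ENNReal.ofReal_add (by positivity)
          (mul_nonneg (by linarith) (abs_nonneg _))]

end Levels

section Mollify

variable {E : Type*} [NormedAddCommGroup E] [NormedSpace ℝ E] [FiniteDimensional ℝ E]
  [MeasurableSpace E] [BorelSpace E] {μ : Measure E} [μ.IsAddHaarMeasure]

theorem integral_comp_add_smul_mul (η κ : E → ℝ) {ε : ℝ} (hε : 0 < ε) (y : E) :
    ∫ w, η (y + ε • w) * κ w ∂μ =
      |(ε ^ Module.finrank ℝ E)⁻¹| * ∫ t, η t * κ (-(ε⁻¹ • (y - t))) ∂μ := by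
  have h1 := Measure.integral_comp_smul μ (fun s => η (y + s) * κ (ε⁻¹ • s)) ε
  simp only [smul_smul, inv_mul_cancel₀ hε.ne', one_smul, smul_eq_mul] at h1
  rw [h1, ← integral_add_left_eq_self (μ := μ) (fun t => η t * κ (-(ε⁻¹ • (y - t)))) y]
  simp

theorem mollified_test_function {η k : E → ℝ} {N ε : ℝ} {K : Set E} (hη : Measurable η)
    (hηN : ∀ x, |η x| ≤ N) (hK : IsCompact K) (hηK : ∀ x ∉ K, η x = 0)
    (hk : ContDiff ℝ ∞ k) (hkc : HasCompactSupport k)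
    (hk1 : ∀ x, k x ≠ 0 → ‖x‖ ≤ 1) (hε : 0 < ε) :
    ContDiff ℝ ∞ (fun y => ∫ w, η (y + ε • w) * k w ∂μ) ∧
    HasCompactSupport (fun y => ∫ w, η (y + ε • w) * k w ∂μ) ∧
    tsupport (fun y => ∫ w, η (y + ε • w) * k w ∂μ) ⊆ Metric.cthickening ε K ∧
    ∀ y v, fderiv ℝ (fun y => ∫ w, η (y + ε • w) * k w ∂μ) y v =
      -(ε⁻¹ * ∫ w, η (y + ε • w) * fderiv ℝ k w v ∂μ) := by
  set c : ℝ := |(ε ^ Module.finrank ℝ E)⁻¹| with hc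
  set kε : E → ℝ := fun x => k (-(ε⁻¹ • x)) with hkε
  have hlin : ContDiff ℝ ∞ fun x : E => -(ε⁻¹ • x) := (contDiff_const_smul ε⁻¹).neg
  have hkεs : ContDiff ℝ ∞ kε := hk.comp hlin
  have hkεc : HasCompactSupport kε := by
    have h1 := hkc.comp_homeomorph
      ((Homeomorph.smulOfNeZero (ε⁻¹) (inv_ne_zero hε.ne')).trans (Homeomorph.neg E))
    exact h1
  have hηi : LocallyIntegrable η μ := by
    have : IntegrableOn η K μ :=
      Measure.integrableOn_of_bounded hK.measure_lt_top.ne hη.aestronglyMeasurable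
        (ae_of_all _ hηN)
    refine (this.integrable_of_forall_notMem_eq_zero hηK).locallyIntegrable
  have hg : (fun y => ∫ w, η (y + ε • w) * k w ∂μ) =
      fun y => c * convolution η kε (ContinuousLinearMap.lsmul ℝ ℝ) μ y := by
    ext y
    rw [integral_comp_add_smul_mul η k hε]
    rfl
  have htsupp : tsupport (fun y => ∫ w, η (y + ε • w) * k w ∂μ) ⊆ Metric.cthickening ε K := by
    refine closure_minimal (fun y hy => ?_) Metric.isClosed_cthickening
    by_contra hyK
    refine hy (integral_eq_zero_of_ae (ae_of_all _ fun w => ?_))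
    by_contra hw
    have h1 : η (y + ε • w) ≠ 0 := left_ne_zero_of_mul hw
    have h2 : k w ≠ 0 := right_ne_zero_of_mul hw
    have h3 : y + ε • w ∈ K := by
      by_contra h
      exact h1 (hηK _ h)
    refine hyK (Metric.mem_cthickening_of_dist_le y _ ε K h3 ?_)
    rw [dist_self_add_right, norm_smul, Real.norm_of_nonneg hε.le]
    nlinarith [hk1 w h2]
  refine ⟨?_, ?_, htsupp, fun y v => ?_⟩
  · rw [hg]
    exact contDiff_const.mul (hkεc.contDiff_convolution_right (n := ⊤) _ hηi hkεs)
  · exact hK.cthickening.of_isClosed_subset (isClosed_tsupport _) htsupp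
  · have h1 := (hkεc.hasFDerivAt_convolution_right (ContinuousLinearMap.lsmul ℝ ℝ) hηi
      (hkεs.of_le (by simp)) y).const_mul c
    rw [hg, h1.fderiv, smul_apply, convolution_precompR_apply _ hηi
      (hkεc.fderiv (𝕜 := ℝ)) (hkεs.continuous_fderiv (by simp)), smul_eq_mul,
      integral_comp_add_smul_mul η (fun w => fderiv ℝ k w v) hε, ← hc, convolution,
      ← integral_const_mul, ← integral_const_mul, ← integral_const_mul, ← integral_neg]
    refine integral_congr_ae (ae_of_all _ fun t => ?_)
    have h2 : fderiv ℝ kε (y - t) v = -(ε⁻¹ * fderiv ℝ k (-(ε⁻¹ • (y - t))) v) := by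
      have h3 : HasFDerivAt (fun x : E => -(ε⁻¹ • x))
          (-(ε⁻¹ • ContinuousLinearMap.id ℝ E)) (y - t) :=
        ((hasFDerivAt_id (y - t)).const_smul ε⁻¹).neg
      have h4 := ((hk.differentiable (by simp)) (-(ε⁻¹ • (y - t)))).hasFDerivAt.comp (y - t) h3
      rw [show kε = k ∘ fun x : E => -(ε⁻¹ • x) from rfl, h4.fderiv]
      simp
    simp only [ContinuousLinearMap.lsmul_apply, smul_eq_mul, h2]
    ring

theorem integral_fderiv_apply_eq_zero {k : E → ℝ} (hk : ContDiff ℝ ∞ k)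
    (hkc : HasCompactSupport k) (v : E) : ∫ w, fderiv ℝ k w v ∂μ = 0 := by
  have h1 : Continuous fun w => fderiv ℝ k w v :=
    (hk.continuous_fderiv (by simp)).clm_apply continuous_const
  have h2 : HasCompactSupport fun w => fderiv ℝ k w v := hkc.fderiv_apply (𝕜 := ℝ) v
  have := integral_mul_fderiv_eq_neg_fderiv_mul_of_integrable (μ := μ) (f := fun _ : E => (1 : ℝ))
    (g := k) (v := v) (by simp) (by simpa using h1.integrable_of_hasCompactSupport h2)
    (by simpa using hk.continuous.integrable_of_hasCompactSupport hkc)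
    (fun x _ => by fun_prop) (fun x _ => hk.differentiable (by simp) x)
  simpa using this

theorem integral_apply_mul_fderiv_apply {k : E → ℝ} (hk : ContDiff ℝ ∞ k)
    (hkc : HasCompactSupport k) (ℓ : E →L[ℝ] ℝ) (v : E) :
    ∫ w, ℓ w * fderiv ℝ k w v ∂μ = -(ℓ v * ∫ w, k w ∂μ) := by
  have h1 : Continuous fun w => fderiv ℝ k w v :=
    (hk.continuous_fderiv (by simp)).clm_apply continuous_const
  have h2 : HasCompactSupport fun w => fderiv ℝ k w v := hkc.fderiv_apply (𝕜 := ℝ) v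
  have := integral_mul_fderiv_eq_neg_fderiv_mul_of_integrable (μ := μ) (f := ℓ)
    (g := k) (v := v)
    (by simpa using (hk.continuous.integrable_of_hasCompactSupport hkc).const_mul (ℓ v))
    ((ℓ.continuous.mul h1).integrable_of_hasCompactSupport h2.mul_left)
    ((ℓ.continuous.mul hk.continuous).integrable_of_hasCompactSupport hkc.mul_left)
    (fun x _ => by fun_prop) (fun x _ => hk.differentiable (by simp) x)
  rw [this]
  simp [integral_const_mul]

theorem integral_average_translate {F : E → ℝ} (hF : Integrable F μ) (h : E) :
    ∫ x, (∫ t in (0 : ℝ)..1, F (x + t • h)) ∂μ = ∫ x, F x ∂μ := by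
  simp_rw [intervalIntegral.integral_of_le (zero_le_one' ℝ)]
  rw [← integral_integral_swap (f := fun t x => F (x + t • h)) (integrable_comp_shear hF h)]
  simp_rw [integral_add_right_eq_self]
  simp

/-- A weak differential inequality for smooth test functions extends to those compactly supported
bounded functions `η` whose difference quotients converge, and are dominated after multiplication
with the vector field `B`. -/
theorem integral_mul_le_integral_apply_of_difference_quotients {B : E → E} {S η : E → ℝ}
    {Dη : E → E →L[ℝ] ℝ} {G : E → ℝ} {K : Set E} {δ N : ℝ} (hδ : 0 < δ)
    (hBm : Measurable B) (hB : Integrable B μ) (hSi : Integrable S μ)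
    (htest : ∀ ψ : E → ℝ, ContDiff ℝ ∞ ψ → HasCompactSupport ψ →
      tsupport ψ ⊆ Metric.cthickening δ K → (∀ x, 0 ≤ ψ x) →
      ∫ x, S x * ψ x ∂μ ≤ ∫ x, fderiv ℝ ψ x (B x) ∂μ)
    (hη : Measurable η) (hη0 : ∀ x, 0 ≤ η x) (hηN : ∀ x, η x ≤ N) (hK : IsCompact K)
    (hηK : ∀ x ∉ K, η x = 0) (hG : Integrable G μ) (hG0 : ∀ x, 0 ≤ G x) (hDηm : Measurable Dη)
    (hDηi : Integrable (fun x => ‖Dη x‖ * ‖B x‖) μ)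
    (hdom : ∀ h : E, ‖h‖ < δ → ∀ᵐ y ∂μ, |η (y + h) - η y| * ‖B y‖ ≤
      ‖h‖ * (G y + ∫ t in (0 : ℝ)..1, G (y + t • h)))
    (hconv : ∀ w : E, ∀ ε : ℕ → ℝ, (∀ k, 0 < ε k) → Tendsto ε atTop (𝓝 0) →
      ∃ ms : ℕ → ℕ, StrictMono ms ∧ ∀ᵐ y ∂μ,
        Tendsto (fun k => (ε (ms k))⁻¹ * (η (y + ε (ms k) • w) - η y)) atTop (𝓝 (Dη y w))) :
    ∫ x, S x * η x ∂μ ≤ ∫ x, Dη x (B x) ∂μ := by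
  obtain ⟨k, hk, hkc, hk0, hk1, hkint⟩ : ∃ k : E → ℝ, ContDiff ℝ ∞ k ∧ HasCompactSupport k ∧
      (∀ x, 0 ≤ k x) ∧ tsupport k ⊆ Metric.closedBall 0 1 ∧ ∫ x, k x ∂μ = 1 := by
    let f : ContDiffBump (0 : E) := ⟨1 / 2, 1, by norm_num, by norm_num⟩
    exact ⟨f.normed μ, f.contDiff_normed, f.hasCompactSupport_normed, f.nonneg_normed,
      f.tsupport_normed_eq.le, f.integral_normed⟩
  have hkn : ∀ x, k x ≠ 0 → ‖x‖ ≤ 1 := fun x hx => by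
    simpa using hk1 (subset_tsupport k hx)
  have hDkn : ∀ x, fderiv ℝ k x ≠ 0 → ‖x‖ ≤ 1 := fun x hx => by
    simpa using hk1 (support_fderiv_subset ℝ hx)
  have hDk : Continuous (fderiv ℝ k) := hk.continuous_fderiv (by simp)
  have hki : Integrable k μ := hk.continuous.integrable_of_hasCompactSupport hkc
  have hDki : Integrable (fderiv ℝ k) μ := hDk.integrable_of_hasCompactSupport (hkc.fderiv (𝕜 := ℝ))
  have hN : ∀ x, |η x| ≤ N := fun x => by rw [abs_of_nonneg (hη0 x)]; exact hηN x
  have hηi : Integrable η μ := by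
    have : IntegrableOn η K μ := Measure.integrableOn_of_bounded hK.measure_lt_top.ne
      hη.aestronglyMeasurable (ae_of_all _ hN)
    exact this.integrable_of_forall_notMem_eq_zero hηK
  set b : ℝ → E → E → ℝ := fun ε w y => S y * η (y + ε • w) * k w with hb
  set a : ℝ → E → E → ℝ := fun ε w y =>
    ε⁻¹ * (η (y + ε • w) - η y) * fderiv ℝ k w (B y) with ha
  have hηm2 : ∀ ε : ℝ, Measurable fun z : E × E => η (z.1 + ε • z.2) := fun ε =>
    hη.comp (by fun_prop)
  have hDkB : Measurable fun z : E × E => fderiv ℝ k z.2 (B z.1) := by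
    have h1 : Measurable fun z : E × E => fderiv ℝ k z.2 := hDk.measurable.comp measurable_snd
    have h2 : Measurable fun z : E × E => B z.1 := hBm.comp measurable_fst
    have h3 : Continuous fun q : (E →L[ℝ] ℝ) × E => q.1 q.2 := by fun_prop
    exact h3.measurable.comp (h1.prodMk h2)
  have hbint : ∀ ε, Integrable (fun z : E × E => b ε z.2 z.1) (μ.prod μ) := by
    intro ε
    have h1 : Integrable (fun z : E × E => S z.1 * k z.2) (μ.prod μ) := hSi.mul_prod hki
    have h2 := h1.mul_bdd (c := N) (hηm2 ε).aestronglyMeasurable (ae_of_all _ fun z => hN _)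
    exact h2.congr (ae_of_all _ fun z => by simp only [hb]; ring)
  have haint : ∀ ε, Integrable (fun z : E × E => a ε z.2 z.1) (μ.prod μ) := by
    intro ε
    have h1 : Integrable (fun z : E × E => ‖B z.1‖ * ‖fderiv ℝ k z.2‖) (μ.prod μ) :=
      hB.norm.mul_prod hDki.norm
    refine (h1.const_mul (|ε⁻¹| * (2 * N))).mono' ?_ (ae_of_all _ fun z => ?_)
    · exact ((((hηm2 ε).sub (hη.comp measurable_fst)).const_mul _).mul
        hDkB).aestronglyMeasurable
    · simp only [ha, norm_mul, Real.norm_eq_abs]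
      have h2 := (abs_sub (η (z.1 + ε • z.2)) (η z.1)).trans (add_le_add (hN _) (hN _))
      have h3 := (fderiv ℝ k z.2).le_opNorm (B z.1)
      rw [Real.norm_eq_abs] at h3
      have hN0 : 0 ≤ N := (abs_nonneg _).trans (hN 0)
      calc |ε⁻¹| * |η (z.1 + ε • z.2) - η z.1| * |fderiv ℝ k z.2 (B z.1)|
          ≤ |ε⁻¹| * (2 * N) * (‖fderiv ℝ k z.2‖ * ‖B z.1‖) := by gcongr; linarith
        _ = _ := by ring
  -- the inequality for the mollified function
  have hmain : ∀ ε, 0 < ε → ε ≤ δ →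
      ∫ w, (∫ y, b ε w y ∂μ) ∂μ + ∫ w, (∫ y, a ε w y ∂μ) ∂μ ≤ 0 := by
    intro ε hε hεδ
    obtain ⟨m1, m2, m3, m4⟩ := mollified_test_function (μ := μ) hη hN hK hηK hk hkc hkn hε
    have m5 := htest _ m1 m2 (m3.trans (Metric.cthickening_mono hεδ K)) fun x =>
      integral_nonneg fun w => mul_nonneg (hη0 _) (hk0 _)
    have e1 : ∫ w, (∫ y, b ε w y ∂μ) ∂μ = ∫ x, S x * ∫ w, η (x + ε • w) * k w ∂μ ∂μ := by
      rw [integral_integral_swap (f := fun w y => b ε w y) (hbint ε).swap]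
      refine integral_congr_ae (ae_of_all _ fun y => ?_)
      simp only [hb, mul_assoc]
      rw [integral_const_mul]
    have e2 : ∫ w, (∫ y, a ε w y ∂μ) ∂μ =
        -∫ x, fderiv ℝ (fun y => ∫ w, η (y + ε • w) * k w ∂μ) x (B x) ∂μ := by
      rw [integral_integral_swap (f := fun w y => a ε w y) (haint ε).swap, ← integral_neg]
      refine integral_congr_ae (ae_of_all _ fun y => ?_)
      simp only [m4, neg_neg]
      have i1 : Integrable (fun w => fderiv ℝ k w (B y)) μ := hDki.apply_continuousLinearMap _
      have i2 : Integrable (fun w => η (y + ε • w) * fderiv ℝ k w (B y)) μ :=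
        i1.bdd_mul (c := N) (hη.comp (by fun_prop)).aestronglyMeasurable
          (ae_of_all _ fun w => hN _)
      have i3 : ∫ w, (η (y + ε • w) - η y) * fderiv ℝ k w (B y) ∂μ =
          ∫ w, η (y + ε • w) * fderiv ℝ k w (B y) ∂μ := by
        simp_rw [sub_mul]
        rw [integral_sub i2 (i1.const_mul _), integral_const_mul,
          integral_fderiv_apply_eq_zero hk hkc, mul_zero, sub_zero]
      rw [← i3, ← integral_const_mul]
      simp only [ha, mul_assoc]
    rw [e1, e2]
    linarith
  -- the passage to the limit
  obtain ⟨ε, hεpos, hεδ, hε0⟩ : ∃ ε : ℕ → ℝ, (∀ k, 0 < ε k) ∧ (∀ k, ε k < δ) ∧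
      Tendsto ε atTop (𝓝 0) := by
    obtain ⟨u, -, hu, hu0⟩ := exists_seq_strictAnti_tendsto' hδ
    exact ⟨u, fun k => (hu k).1, fun k => (hu k).2, hu0⟩
  have hconv' : ∀ w : E, ∀ ε' : ℕ → ℝ, (∀ k, 0 < ε' k) → Tendsto ε' atTop (𝓝 0) →
      ∃ ms : ℕ → ℕ, StrictMono ms ∧ ∀ᵐ y ∂μ,
        Tendsto (fun k => (ε' (ms k))⁻¹ * (η (y + ε' (ms k) • w) - η y)) atTop (𝓝 (Dη y w)) ∧
        Tendsto (fun k => η (y + ε' (ms k) • w)) atTop (𝓝 (η y)) := by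
    intro w ε' h1 h2
    obtain ⟨ms, hms, h3⟩ := hconv w ε' h1 h2
    refine ⟨ms, hms, h3.mono fun y hy => ⟨hy, ?_⟩⟩
    have h4 := ((h2.comp hms.tendsto_atTop).mul hy).add_const (η y)
    simp only [zero_mul, zero_add] at h4
    refine h4.congr fun k => ?_
    simp only [Function.comp_apply]
    rw [mul_inv_cancel_left₀ (h1 _).ne']
    ring
  have hblim : ∀ w : E, Tendsto (fun j => ∫ y, b (ε j) w y ∂μ) atTop
      (𝓝 (∫ y, S y * η y * k w ∂μ)) := by
    intro w
    refine Filter.tendsto_of_subseq_tendsto fun ns hns => ?_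
    obtain ⟨ms, hms, hy⟩ := hconv' w (ε ∘ ns) (fun j => hεpos _) (hε0.comp hns)
    refine ⟨ms, ?_⟩
    refine tendsto_integral_of_dominated_convergence (fun y => ‖S y‖ * N * |k w|)
      (fun j => ?_) ((hSi.norm.mul_const _).mul_const _) (fun j => ae_of_all _ fun y => ?_) ?_
    · exact (hSi.aestronglyMeasurable.mul
        (hη.comp (by fun_prop)).aestronglyMeasurable).mul_const _
    · simp only [hb, norm_mul, Real.norm_eq_abs]
      gcongr
      exact hN _
    · filter_upwards [hy] with y hy
      exact (hy.2.const_mul _).mul_const _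
  have hdomA : ∀ j w, fderiv ℝ k w ≠ 0 → ∀ᵐ y ∂μ, |a (ε j) w y| ≤
      ‖fderiv ℝ k w‖ * (G y + ∫ t in (0 : ℝ)..1, G (y + t • ε j • w)) := by
    intro j w hw
    have hw1 := hDkn w hw
    have hp := hεpos j
    have h5 : ‖ε j • w‖ ≤ ε j := by
      rw [norm_smul, Real.norm_of_nonneg hp.le]
      nlinarith
    filter_upwards [hdom _ (h5.trans_lt (hεδ j))] with y hy
    simp only [ha, abs_mul, abs_inv, abs_of_pos hp]
    have h3 := (fderiv ℝ k w).le_opNorm (B y)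
    rw [Real.norm_eq_abs] at h3
    set I := G y + ∫ t in (0 : ℝ)..1, G (y + t • ε j • w) with hI
    have hI0 : 0 ≤ I := add_nonneg (hG0 y)
      (intervalIntegral.integral_nonneg zero_le_one fun t _ => hG0 _)
    set e := ε j with he
    calc e⁻¹ * |η (y + e • w) - η y| * |fderiv ℝ k w (B y)|
        ≤ e⁻¹ * |η (y + e • w) - η y| * (‖fderiv ℝ k w‖ * ‖B y‖) := by gcongr
      _ = e⁻¹ * ‖fderiv ℝ k w‖ * (|η (y + e • w) - η y| * ‖B y‖) := by ring
      _ ≤ e⁻¹ * ‖fderiv ℝ k w‖ * (e * I) := by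
          exact mul_le_mul_of_nonneg_left (hy.trans (mul_le_mul_of_nonneg_right h5 hI0))
            (by positivity)
      _ = ‖fderiv ℝ k w‖ * I := by field_simp
  have halim : ∀ w : E, Tendsto (fun j => ∫ y, a (ε j) w y ∂μ) atTop
      (𝓝 (∫ y, Dη y w * fderiv ℝ k w (B y) ∂μ)) := by
    intro w
    by_cases hw : fderiv ℝ k w = 0
    · simp [ha, hw]
    refine Filter.tendsto_of_subseq_tendsto fun ns hns => ?_
    obtain ⟨ms, hms, hy⟩ := hconv' w (ε ∘ ns) (fun j => hεpos _) (hε0.comp hns)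
    refine ⟨ms, ?_⟩
    have hms0 : Tendsto (fun j => ε (ns (ms j)) • w) atTop (𝓝 0) := by
      simpa using ((hε0.comp hns).comp hms.tendsto_atTop).smul_const w
    refine tendsto_integral_of_abs_le_of_tendsto_mean
      (g := fun j y => ‖fderiv ℝ k w‖ * (G y + ∫ t in (0 : ℝ)..1, G (y + t • ε (ns (ms j)) • w)))
      (G := fun y => ‖fderiv ℝ k w‖ * (G y + G y)) (fun j => ?_) (fun j => ?_)
      ((hG.add hG).const_mul _) (fun j => ?_) ?_ ?_
    · have h1 : Measurable fun y => fderiv ℝ k w (B y) := (fderiv ℝ k w).measurable.comp hBm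
      exact (((hη.comp (by fun_prop)).sub hη).const_mul _ |>.mul h1).aestronglyMeasurable
    · exact (hG.add (integrable_average_translate hG _)).const_mul _
    · exact hdomA _ w hw
    · have h1 := ((tendsto_integral_abs_average_translate_sub hG).comp hms0).const_mul
        ‖fderiv ℝ k w‖
      rw [mul_zero] at h1
      refine h1.congr fun j => ?_
      simp only [Function.comp_apply]
      rw [← integral_const_mul]
      refine integral_congr_ae (ae_of_all _ fun y => ?_)
      simp only
      rw [← mul_sub, abs_mul, abs_of_nonneg (norm_nonneg _)]
      ring_nf
    · filter_upwards [hy] with y hy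
      exact hy.1.mul_const _
  have hbLim : Tendsto (fun j => ∫ w, (∫ y, b (ε j) w y ∂μ) ∂μ) atTop
      (𝓝 (∫ w, (∫ y, S y * η y * k w ∂μ) ∂μ)) := by
    refine tendsto_integral_of_dominated_convergence (fun w => (∫ y, ‖S y‖ * N ∂μ) * ‖k w‖)
      (fun j => (hbint (ε j)).integral_prod_right.aestronglyMeasurable) (hki.norm.const_mul _)
      (fun j => ae_of_all _ fun w => ?_) (ae_of_all _ hblim)
    rw [← integral_mul_const]
    refine norm_integral_le_of_norm_le ((hSi.norm.mul_const _).mul_const _)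
      (ae_of_all _ fun y => ?_)
    simp only [hb, norm_mul]
    gcongr
    exact hN _
  have haLim : Tendsto (fun j => ∫ w, (∫ y, a (ε j) w y ∂μ) ∂μ) atTop
      (𝓝 (∫ w, (∫ y, Dη y w * fderiv ℝ k w (B y) ∂μ) ∂μ)) := by
    refine tendsto_integral_of_dominated_convergence
      (fun w => ‖fderiv ℝ k w‖ * (∫ y, G y ∂μ + ∫ y, G y ∂μ))
      (fun j => (haint (ε j)).integral_prod_right.aestronglyMeasurable) (hDki.norm.mul_const _)
      (fun j => ae_of_all _ fun w => ?_) (ae_of_all _ halim)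
    by_cases hw : fderiv ℝ k w = 0
    · simp [ha, hw]
    · refine (norm_integral_le_of_norm_le
        ((hG.add (integrable_average_translate hG _)).const_mul _) (hdomA j w hw)).trans_eq ?_
      rw [integral_const_mul]
      congr 1
      refine (integral_add hG (integrable_average_translate hG _)).trans ?_
      rw [integral_average_translate hG]
  have hprod : Integrable (fun z : E × E => Dη z.1 z.2 * fderiv ℝ k z.2 (B z.1)) (μ.prod μ) := by
    have h3 : Continuous fun q : (E →L[ℝ] ℝ) × E => q.1 q.2 := by fun_prop
    refine (hDηi.mul_prod hDki.norm).mono' ?_ (ae_of_all _ fun z => ?_)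
    · exact ((h3.measurable.comp ((hDηm.comp measurable_fst).prodMk measurable_snd)).mul
        hDkB).aestronglyMeasurable
    · by_cases hw : fderiv ℝ k z.2 = 0
      · simp [hw]
      · have h4 := (fderiv ℝ k z.2).le_opNorm (B z.1)
        have h5 : ‖Dη z.1 z.2‖ ≤ ‖Dη z.1‖ :=
          ((Dη z.1).le_opNorm z.2).trans (mul_le_of_le_one_right (norm_nonneg _) (hDkn _ hw))
        rw [norm_mul]
        calc ‖Dη z.1 z.2‖ * ‖fderiv ℝ k z.2 (B z.1)‖
            ≤ ‖Dη z.1‖ * (‖fderiv ℝ k z.2‖ * ‖B z.1‖) := by gcongr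
          _ = _ := by ring
  have hfin := le_of_tendsto' (hbLim.add haLim) fun j => hmain _ (hεpos j) (hεδ j).le
  have e1 : ∫ w, (∫ y, S y * η y * k w ∂μ) ∂μ = ∫ x, S x * η x ∂μ := by
    simp_rw [integral_mul_const]
    rw [integral_const_mul, hkint, mul_one]
  have e2 : ∫ w, (∫ y, Dη y w * fderiv ℝ k w (B y) ∂μ) ∂μ = -∫ x, Dη x (B x) ∂μ := by
    rw [integral_integral_swap (f := fun w y => Dη y w * fderiv ℝ k w (B y)) hprod.swap,
      ← integral_neg]
    refine integral_congr_ae (ae_of_all _ fun y => ?_)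
    simp only
    rw [integral_apply_mul_fderiv_apply hk hkc, hkint, mul_one]
  rw [e1, e2] at hfin
  linarith

end Mollify

section TruncatedGradient

variable {E : Type*} [NormedAddCommGroup E] [NormedSpace ℝ E] [FiniteDimensional ℝ E]
  [MeasurableSpace E] [BorelSpace E] {μ : Measure E} [μ.IsAddHaarMeasure]

theorem Measurable.clm_apply_real {X : Type*} [MeasurableSpace X] {P : X → E →L[ℝ] ℝ} {v : X → E}
    (hP : Measurable P) (hv : Measurable v) : Measurable fun x => P x (v x) := by
  have h3 : Continuous fun q : (E →L[ℝ] ℝ) × E => q.1 q.2 := by fun_prop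
  exact h3.measurable.comp (hP.prodMk hv)

theorem measurableSet_levels {r : E → ℝ} (hr : Measurable r) (a b : ℝ) :
    MeasurableSet {x | a < r x ∧ r x < b} :=
  (measurableSet_lt measurable_const hr).inter (measurableSet_lt hr measurable_const)

theorem integrable_indicator_levels_apply {r : E → ℝ} {P : E → E →L[ℝ] ℝ} {W : Set E}
    (hr : Measurable r) (hP : Measurable P) (hW : IsCompact W) (a b : ℝ)
    (hPi : IntegrableOn ({x | a < r x ∧ r x < b}.indicator fun x => ‖P x‖) W μ) (v : E) :
    Integrable (W.indicator ({x | a < r x ∧ r x < b}.indicator fun x => P x v)) μ := by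
  rw [integrable_indicator_iff hW.measurableSet]
  refine (hPi.mul_const ‖v‖).mono' ?_ (ae_of_all _ fun x => ?_)
  · exact ((hP.clm_apply_real measurable_const).indicator
      (measurableSet_levels hr a b)).aestronglyMeasurable
  · by_cases hx : x ∈ {x | a < r x ∧ r x < b}
    · simp only [Set.indicator_of_mem hx]; exact (P x).le_opNorm v
    · simp [Set.indicator_of_notMem hx]

/-- The fundamental theorem of calculus for the truncations of `r` on almost every segment. -/
theorem ae_truncation_sub_eq_integral {r : E → ℝ} {P : E → E →L[ℝ] ℝ} {W V : Set E} {h : E}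
    (hr : Measurable r) (hP : Measurable P) (hW : IsCompact W) {a b : ℝ} (hab : a < b)
    (hweak : ∀ v : E, ∀ ψ : E → ℝ, ContDiff ℝ ∞ ψ →
      HasCompactSupport ψ → tsupport ψ ⊆ W →
      ∫ x, max a (min (r x) b) * fderiv ℝ ψ x v ∂μ =
        -∫ x, {x | a < r x ∧ r x < b}.indicator (fun x => P x v) x * ψ x ∂μ)
    (hPi : IntegrableOn ({x | a < r x ∧ r x < b}.indicator fun x => ‖P x‖) W μ)
    (hV : IsOpen V) (hVW : ∀ x ∈ V, ∀ t ∈ Set.Icc (0 : ℝ) 1, x + t • h ∈ W) :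
    ∀ᵐ x ∂μ, x ∈ V →
      max a (min (r (x + h)) b) - max a (min (r x) b) =
        ∫ t in (0 : ℝ)..1,
          W.indicator ({x | a < r x ∧ r x < b}.indicator fun x => P x h) (x + t • h) := by
  have hq := integrable_indicator_levels_apply (μ := μ) hr hP hW a b hPi h
  have hF : Integrable (W.indicator fun x => max a (min (r x) b)) μ := by
    rw [integrable_indicator_iff hW.measurableSet]
    refine Measure.integrableOn_of_bounded (M := max |a| |b|) hW.measure_lt_top.ne
      (measurable_const.max (hr.min measurable_const)).aestronglyMeasurable
      (ae_of_all _ fun x => ?_)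
    rw [Real.norm_eq_abs]
    refine abs_le_max_abs_abs (le_max_left _ _) (max_le hab.le (min_le_right _ _))
  have key := ae_sub_eq_integral_of_weak_derivative hF hq (W := W) (V := V) (h := h)
    (fun ψ h1 h2 h3 => ?_) hV hVW
  · filter_upwards [key] with x hx hxV
    rw [← hx hxV, Set.indicator_of_mem (by simpa using hVW x hxV 1 (by simp)),
      Set.indicator_of_mem (by simpa using hVW x hxV 0 (by simp))]
  · have e1 : ∀ x, W.indicator (fun x => max a (min (r x) b)) x * fderiv ℝ ψ x h =
        max a (min (r x) b) * fderiv ℝ ψ x h := by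
      intro x
      by_cases hx : x ∈ W
      · rw [Set.indicator_of_mem hx]
      · have : fderiv ℝ ψ x = 0 := by
          by_contra hne
          exact hx (h3 (support_fderiv_subset ℝ hne))
        simp [this]
    have e2 : ∀ x, W.indicator ({x | a < r x ∧ r x < b}.indicator fun x => P x h) x * ψ x =
        {x | a < r x ∧ r x < b}.indicator (fun x => P x h) x * ψ x := by
      intro x
      by_cases hx : x ∈ W
      · rw [Set.indicator_of_mem hx]
      · rw [image_eq_zero_of_notMem_tsupport fun h' => hx (h3 h')]; simp
    simp_rw [e1, e2]
    exact hweak h ψ h1 h2 h3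

theorem exists_seq_truncation_quotient_tendsto {r : E → ℝ} {P : E → E →L[ℝ] ℝ} {W V : Set E}
    (hr : Measurable r) (hP : Measurable P) (hW : IsCompact W) {a b d : ℝ} (hab : a < b)
    (hweak : ∀ v : E, ∀ ψ : E → ℝ, ContDiff ℝ ∞ ψ →
      HasCompactSupport ψ → tsupport ψ ⊆ W →
      ∫ x, max a (min (r x) b) * fderiv ℝ ψ x v ∂μ =
        -∫ x, {x | a < r x ∧ r x < b}.indicator (fun x => P x v) x * ψ x ∂μ)
    (hPi : IntegrableOn ({x | a < r x ∧ r x < b}.indicator fun x => ‖P x‖) W μ)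
    (hV : IsOpen V) (hd : 0 < d) (hVW : ∀ x ∈ V, ∀ h : E, ‖h‖ < d → x + h ∈ W)
    (w : E) {ε : ℕ → ℝ} (hε : ∀ k, 0 < ε k) (hε0 : Tendsto ε atTop (𝓝 0)) :
    ∃ ms : ℕ → ℕ, StrictMono ms ∧ ∀ᵐ y ∂μ, y ∈ V →
      Tendsto (fun k => (ε (ms k))⁻¹ *
        (max a (min (r (y + ε (ms k) • w)) b) - max a (min (r y) b))) atTop
        (𝓝 ({x | a < r x ∧ r x < b}.indicator (fun x => P x w) y)) := by
  have hq := integrable_indicator_levels_apply (μ := μ) hr hP hW a b hPi w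
  set q := W.indicator ({x | a < r x ∧ r x < b}.indicator fun x => P x w) with hqdef
  have hεw : Tendsto (fun k => ε k • w) atTop (𝓝 0) := by simpa using hε0.smul_const w
  obtain ⟨ms, hms, hlim⟩ := exists_seq_tendsto_ae_of_integral_abs_sub
    (fun k => integrable_average_translate hq (ε k • w)) hq
    ((tendsto_integral_abs_average_translate_sub hq).comp hεw)
  have hftc : ∀ k, ‖ε k • w‖ < d → ∀ᵐ y ∂μ, y ∈ V →
      (ε k)⁻¹ * (max a (min (r (y + ε k • w)) b) - max a (min (r y) b)) =
        ∫ t in (0 : ℝ)..1, q (y + t • ε k • w) := by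
    intro k hk
    have h1 := ae_truncation_sub_eq_integral (h := ε k • w) hr hP hW hab hweak hPi hV
      (fun x hx t ht => hVW x hx _ (by
        rw [norm_smul, Real.norm_of_nonneg ht.1]
        exact (mul_le_of_le_one_left (norm_nonneg _) ht.2).trans_lt hk))
    filter_upwards [h1] with y hy hyV
    rw [hy hyV, ← intervalIntegral.integral_const_mul]
    refine intervalIntegral.integral_congr fun t _ => ?_
    have h2 : ∀ z, W.indicator ({x | a < r x ∧ r x < b}.indicator fun x => P x (ε k • w)) z =
        ε k * q z := by
      intro z
      simp only [hqdef, map_smul, smul_eq_mul]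
      by_cases h3 : z ∈ W <;> by_cases h4 : z ∈ {x | a < r x ∧ r x < b} <;>
        simp only [h3, h4, Set.indicator_of_mem, Set.indicator_of_notMem, not_false_eq_true,
          mul_zero]
    simp only [h2]
    rw [inv_mul_cancel_left₀ (hε k).ne']
  have hftc' : ∀ᵐ y ∂μ, ∀ k, ‖ε k • w‖ < d → y ∈ V →
      (ε k)⁻¹ * (max a (min (r (y + ε k • w)) b) - max a (min (r y) b)) =
        ∫ t in (0 : ℝ)..1, q (y + t • ε k • w) := by
    refine ae_all_iff.2 fun k => ?_
    by_cases hk : ‖ε k • w‖ < d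
    · filter_upwards [hftc k hk] with y hy _ using hy
    · exact ae_of_all _ fun y h => absurd h hk
  have hev : ∀ᶠ k in atTop, ‖ε (ms k) • w‖ < d := by
    have := (hεw.comp hms.tendsto_atTop).norm
    rw [norm_zero] at this
    exact this.eventually_lt_const hd
  refine ⟨ms, hms, ?_⟩
  filter_upwards [hlim, hftc'] with y h1 h2 hyV
  have h3 : q y = {x | a < r x ∧ r x < b}.indicator (fun x => P x w) y :=
    Set.indicator_of_mem (by simpa using hVW y hyV 0 (by simpa using hd)) _
  rw [h3] at h1
  exact h1.congr' (hev.mono fun k hk => (h2 _ hk hyV).symm)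

theorem rpow_mul_rpow_le_add {x y θ : ℝ} (hx : 0 ≤ x) (hy : 0 ≤ y) (h0 : 0 ≤ θ) (h1 : θ ≤ 1) :
    x ^ (1 - θ) * y ^ θ ≤ x + y := by
  have h := Real.geom_mean_le_arith_mean2_weighted (sub_nonneg.2 h1) h0 hx hy (by ring)
  nlinarith

/-- The change of a truncation of `r` along a short segment, weighted by `B`, is controlled by the
average of `S` over the segment. -/
theorem exists_norm_mul_abs_truncation_sub_le {r S : E → ℝ} {P : E → E →L[ℝ] ℝ} {B : E → E}
    {W V : Set E} {p δ C : ℝ} (hp : 1 < p) (hr : Measurable r) (hr0 : ∀ x, 0 < r x)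
    (hP : Measurable P) (hW : IsCompact W)
    (hweak : ∀ a b : ℝ, 0 < a → a < b → ∀ v : E, ∀ ψ : E → ℝ, ContDiff ℝ ∞ ψ →
      HasCompactSupport ψ → tsupport ψ ⊆ W →
      ∫ x, max a (min (r x) b) * fderiv ℝ ψ x v ∂μ =
        -∫ x, {x | a < r x ∧ r x < b}.indicator (fun x => P x v) x * ψ x ∂μ)
    (hPi : ∀ a b : ℝ, 0 < a → a < b →
      IntegrableOn ({x | a < r x ∧ r x < b}.indicator fun x => ‖P x‖) W μ)
    (hS : ∀ x, 0 ≤ S x) (hSi : IntegrableOn S W μ) (hC : 0 ≤ C)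
    (hPb : ∀ x ∈ W, ‖P x‖ ≤ C * S x ^ (1 / p) * r x ^ (1 - δ))
    (hBb : ∀ x ∈ W, ‖B x‖ ≤ C * S x ^ (1 - 1 / p) * r x ^ δ)
    (hV : IsOpen V) {d : ℝ} (hd : 0 < d) (hVW : ∀ x ∈ V, ∀ h : E, ‖h‖ < d → x + h ∈ W)
    {a b : ℝ} (ha : 0 < a) (hab : a < b) :
    ∃ C' : ℝ, 0 ≤ C' ∧ ∀ h : E, ‖h‖ < d → ∀ᵐ y ∂μ, y ∈ V →
      ‖B y‖ * |max a (min (r (y + h)) b) - max a (min (r y) b)| ≤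
        ‖h‖ * (C' * (S y + ∫ t in (0 : ℝ)..1, W.indicator S (y + t • h))) := by
  obtain ⟨C₁, hC₁, h1D⟩ := exists_rpow_mul_abs_truncation_sub_le ha hab δ
  have hp0 : 0 < p := by linarith
  refine ⟨C * C₁ * C, by positivity, fun h hh => ?_⟩
  have hseg : ∀ x ∈ V, ∀ t ∈ Set.Icc (0 : ℝ) 1, x + t • h ∈ W := fun x hx t ht =>
    hVW x hx _ (by
      rw [norm_smul, Real.norm_of_nonneg ht.1]
      exact (mul_le_of_le_one_left (norm_nonneg _) ht.2).trans_lt hh)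
  have hSW : Integrable (W.indicator S) μ := by
    rwa [integrable_indicator_iff hW.measurableSet]
  have hlevels : ∀ᵐ y ∂μ, ∀ a b : ℚ, (0 : ℝ) < a → (a : ℝ) < b → y ∈ V →
      IntegrableOn (fun t : ℝ => W.indicator
        ({x | (a : ℝ) < r x ∧ r x < b}.indicator fun x => P x h) (y + t • h)) (Set.Ioc 0 1) ∧
      max (a : ℝ) (min (r (y + h)) b) - max (a : ℝ) (min (r y) b) =
        ∫ t in (0 : ℝ)..1, W.indicator
          ({x | (a : ℝ) < r x ∧ r x < b}.indicator fun x => P x h) (y + t • h) := by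
    refine ae_all_iff.2 fun a => ae_all_iff.2 fun b => ?_
    by_cases ha : (0 : ℝ) < a
    · by_cases hab : (a : ℝ) < b
      · filter_upwards [ae_truncation_sub_eq_integral (h := h) hr hP hW hab (hweak a b ha hab)
          (hPi a b ha hab) hV hseg, (integrable_comp_shear (integrable_indicator_levels_apply
            (μ := μ) hr hP hW a b (hPi a b ha hab) h) h).prod_left_ae] with y h1 h2 _ _ hyV
        exact ⟨h2, h1 hyV⟩
      · exact ae_of_all _ fun y _ h => absurd h hab
    · exact ae_of_all _ fun y h => absurd h ha
  filter_upwards [hlevels, (integrable_comp_shear hSW h).prod_left_ae] with y hy hSy hyV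
  have hyW : y ∈ W := by simpa using hVW y hyV 0 (by simpa using hd)
  set ϱ : ℝ → ℝ := fun t => r (y + t • h) with hϱ
  set q : ℝ → ℝ := fun t => P (y + t • h) h with hq
  have hmap : Measurable fun t : ℝ => y + t • h := by fun_prop
  have hlev' : ∫⁻ τ in Set.Ioo (min (r (y + h)) (r y)) (max (r (y + h)) (r y)),
      ENNReal.ofReal (τ ^ (δ - 1)) ≤
        ∫⁻ t in Set.Ioc (0 : ℝ) 1, ENNReal.ofReal (ϱ t ^ (δ - 1)) * ‖q t‖ₑ := by
    rw [min_comm, max_comm]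
    refine lintegral_Ioo_le_of_truncations (ϱ := ϱ) (q := q) (hr.comp hmap)
      ((hP.comp hmap).clm_apply_real measurable_const) (hr0 y) (hr0 (y + h))
      (fun a b ha hab => ?_) (f := fun τ => ENNReal.ofReal (τ ^ (δ - 1))) (by fun_prop)
    obtain ⟨h1, h2⟩ := hy a b ha hab hyV
    have h3 : ∀ t ∈ Set.Icc (0 : ℝ) 1, W.indicator
        ({x | (a : ℝ) < r x ∧ r x < b}.indicator fun x => P x h) (y + t • h) =
        {t | (a : ℝ) < ϱ t ∧ ϱ t < b}.indicator q t := by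
      intro t ht
      rw [Set.indicator_of_mem (hseg y hyV t ht)]
      rfl
    refine ⟨h1.congr_fun (fun t ht => h3 t ⟨ht.1.le, ht.2⟩) measurableSet_Ioc, h2.trans ?_⟩
    refine intervalIntegral.integral_congr fun t ht => h3 t ?_
    rwa [Set.uIcc_of_le zero_le_one] at ht
  set Δ := |max a (min (r (y + h)) b) - max a (min (r y) b)| with hΔ
  have hint : Integrable (fun t : ℝ => ‖h‖ * (C * C₁ * C * (S y + W.indicator S (y + t • h))))
      (volume.restrict (Set.Ioc 0 1)) := (((integrable_const _).add hSy).const_mul _).const_mul _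
  have hS0 : ∀ z, 0 ≤ W.indicator S z := fun z => Set.indicator_nonneg (fun x _ => hS x) z
  have hfinal : ENNReal.ofReal (‖B y‖ * Δ) ≤ ENNReal.ofReal (∫ t in Set.Ioc (0 : ℝ) 1,
      ‖h‖ * (C * C₁ * C * (S y + W.indicator S (y + t • h)))) := by
    rw [ofReal_integral_eq_lintegral_ofReal hint (ae_of_all _ fun t => by
      have := hS y; have := hS0 (y + t • h); positivity)]
    have hx := h1D (r (y + h)) (r y) (hr0 _) (hr0 _)
    rw [abs_sub_comm] at hx
    calc ENNReal.ofReal (‖B y‖ * Δ)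
        ≤ ENNReal.ofReal (C * S y ^ (1 - 1 / p)) * ENNReal.ofReal (r y ^ δ * Δ) := by
          have := hS y
          rw [← ENNReal.ofReal_mul (by positivity)]
          refine ENNReal.ofReal_le_ofReal ?_
          rw [← mul_assoc]
          exact mul_le_mul_of_nonneg_right (hBb y hyW) (abs_nonneg _)
      _ ≤ ENNReal.ofReal (C * S y ^ (1 - 1 / p)) * (ENNReal.ofReal C₁ *
            ∫⁻ t in Set.Ioc (0 : ℝ) 1, ENNReal.ofReal (ϱ t ^ (δ - 1)) * ‖q t‖ₑ) := by
          gcongr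
          exact hx.trans (by gcongr)
      _ = ∫⁻ t in Set.Ioc (0 : ℝ) 1, ENNReal.ofReal (C * S y ^ (1 - 1 / p)) *
            (ENNReal.ofReal C₁ * (ENNReal.ofReal (ϱ t ^ (δ - 1)) * ‖q t‖ₑ)) := by
          rw [← lintegral_const_mul' _ _ ENNReal.ofReal_ne_top,
            ← lintegral_const_mul' _ _ ENNReal.ofReal_ne_top]
      _ ≤ _ := by
          refine setLIntegral_mono' measurableSet_Ioc fun t ht => ?_
          have hz : y + t • h ∈ W := hseg y hyV t ⟨ht.1.le, ht.2⟩
          have hSy0 := hS y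
          have hSz := hS (y + t • h)
          have hrz := hr0 (y + t • h)
          rw [← ofReal_norm, ← ENNReal.ofReal_mul (by positivity),
            ← ENNReal.ofReal_mul (by positivity), ← ENNReal.ofReal_mul (by positivity)]
          refine ENNReal.ofReal_le_ofReal ?_
          rw [Set.indicator_of_mem hz]
          have h4 : ‖q t‖ ≤ C * S (y + t • h) ^ (1 / p) * r (y + t • h) ^ (1 - δ) * ‖h‖ :=
            ((P _).le_opNorm h).trans (mul_le_mul_of_nonneg_right (hPb _ hz) (norm_nonneg _))
          have h5 : ϱ t ^ (δ - 1) * r (y + t • h) ^ (1 - δ) = 1 := by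
            simp only [hϱ]
            rw [← Real.rpow_add hrz]; simp
          have h6 := rpow_mul_rpow_le_add hSy0 hSz (θ := 1 / p) (by positivity)
            ((div_le_one hp0).2 hp.le)
          calc C * S y ^ (1 - 1 / p) * (C₁ * (ϱ t ^ (δ - 1) * ‖q t‖))
              ≤ C * S y ^ (1 - 1 / p) * (C₁ * (ϱ t ^ (δ - 1) *
                (C * S (y + t • h) ^ (1 / p) * r (y + t • h) ^ (1 - δ) * ‖h‖))) := by
                gcongr
            _ = ‖h‖ * (C * C₁ * C * (S y ^ (1 - 1 / p) * S (y + t • h) ^ (1 / p))) *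
                (ϱ t ^ (δ - 1) * r (y + t • h) ^ (1 - δ)) := by ring
            _ ≤ _ := by
                rw [h5, mul_one]
                gcongr
  have hI : 0 ≤ ∫ t in Set.Ioc (0 : ℝ) 1, ‖h‖ * (C * C₁ * C * (S y + W.indicator S (y + t • h))) :=
    integral_nonneg fun t => by have := hS y; have := hS0 (y + t • h); positivity
  rw [ENNReal.ofReal_le_ofReal_iff hI] at hfinal
  refine hfinal.trans_eq ?_
  rw [integral_const_mul, integral_const_mul, integral_add (integrable_const _) hSy,
    intervalIntegral.integral_of_le zero_le_one]
  simp

/-- The functions `ζ f(r)`, with `r` truncated, are admissible in a weak differential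
inequality. -/
theorem integral_mul_le_integral_apply_of_truncation {r S : E → ℝ} {P : E → E →L[ℝ] ℝ}
    {B : E → E} {U : Set E} {p δ : ℝ} (hp : 1 < p) (hU : IsOpen U)
    (hr : Measurable r) (hr0 : ∀ x, 0 < r x) (hP : Measurable P) (hBm : Measurable B)
    (hweak : ∀ a b : ℝ, 0 < a → a < b → ∀ v : E, ∀ ψ : E → ℝ, ContDiff ℝ ∞ ψ →
      HasCompactSupport ψ → tsupport ψ ⊆ U →
      ∫ x, max a (min (r x) b) * fderiv ℝ ψ x v ∂μ =
        -∫ x, {x | a < r x ∧ r x < b}.indicator (fun x => P x v) x * ψ x ∂μ)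
    (hS : ∀ x, 0 ≤ S x) (hSi : LocallyIntegrableOn S U μ) (hBi : LocallyIntegrableOn B U μ)
    (hbd : ∀ W ⊆ U, IsCompact W → ∃ C : ℝ, 0 ≤ C ∧ ∀ x ∈ W,
      ‖P x‖ ≤ C * S x ^ (1 / p) * r x ^ (1 - δ) ∧ ‖B x‖ ≤ C * S x ^ (1 - 1 / p) * r x ^ δ)
    (htest : ∀ ψ : E → ℝ, ContDiff ℝ ∞ ψ → HasCompactSupport ψ → tsupport ψ ⊆ U →
      (∀ x, 0 ≤ ψ x) → ∫ x, S x * ψ x ∂μ ≤ ∫ x, fderiv ℝ ψ x (B x) ∂μ)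
    {f f' : ℝ → ℝ} (hf : ∀ τ, 0 < τ → HasDerivAt f (f' τ) τ)
    (hf' : ContinuousOn f' (Set.Ioi 0)) (hf0 : ∀ τ, 0 < τ → 0 ≤ f τ)
    {ζ : E → ℝ} (hζ : ContDiff ℝ 1 ζ) (hζc : HasCompactSupport ζ) (hζU : tsupport ζ ⊆ U)
    (hζ0 : ∀ x, 0 ≤ ζ x) {a b : ℝ} (ha : 0 < a) (hab : a < b) :
    ∫ x, S x * (ζ x * f (max a (min (r x) b))) ∂μ ≤
      ∫ x, (f (max a (min (r x) b)) * fderiv ℝ ζ x (B x) + ζ x *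
        (f' (max a (min (r x) b)) *
          {x | a < r x ∧ r x < b}.indicator (fun x => P x (B x)) x)) ∂μ := by
  have hp0 : 0 < p := by linarith
  set K := tsupport ζ with hK
  have hKc : IsCompact K := hζc
  obtain ⟨d₂, hd₂, hdU⟩ := hKc.exists_cthickening_subset_open hU hζU
  set d := d₂ / 2 with hd_def
  have hd : 0 < d := half_pos hd₂
  set W := Metric.cthickening d₂ K with hW_def
  have hW : IsCompact W := hKc.cthickening
  have hWm := hW.measurableSet
  set V := Metric.thickening d K with hV_def
  have hV : IsOpen V := Metric.isOpen_thickening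
  have hKV : K ⊆ V := Metric.self_subset_thickening hd K
  have hKW : K ⊆ W := Metric.self_subset_cthickening K
  have hVW : ∀ x ∈ V, ∀ h : E, ‖h‖ < d → x + h ∈ W := by
    intro x hx h hh
    obtain ⟨z, hz, hxz⟩ := Metric.mem_thickening_iff.1 hx
    refine Metric.mem_cthickening_of_dist_le _ z _ _ hz ?_
    calc dist (x + h) z ≤ dist (x + h) x + dist x z := dist_triangle _ _ _
      _ ≤ d + d := by
          rw [dist_self_add_left]; linarith
      _ = d₂ := by rw [hd_def]; ring
  have hout : ∀ x ∉ V, ∀ h : E, ‖h‖ < d → ζ (x + h) = 0 := by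
    intro x hx h hh
    by_contra hne
    refine hx (Metric.mem_thickening_iff.2 ⟨x + h, subset_tsupport ζ hne, ?_⟩)
    rwa [dist_self_add_right]
  obtain ⟨C, hC, hCb⟩ := hbd W hdU hW
  have hSW : IntegrableOn S W μ := hSi.integrableOn_compact_subset hdU hW
  have hBW : IntegrableOn B W μ := hBi.integrableOn_compact_subset hdU hW
  have hSW' : Integrable (W.indicator S) μ := by rwa [integrable_indicator_iff hWm]
  have hBW' : Integrable (W.indicator B) μ := by rwa [integrable_indicator_iff hWm]
  have hweakW : ∀ a b : ℝ, 0 < a → a < b → ∀ v : E, ∀ ψ : E → ℝ, ContDiff ℝ ∞ ψ →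
      HasCompactSupport ψ → tsupport ψ ⊆ W →
      ∫ x, max a (min (r x) b) * fderiv ℝ ψ x v ∂μ =
        -∫ x, {x | a < r x ∧ r x < b}.indicator (fun x => P x v) x * ψ x ∂μ :=
    fun a b ha hab v ψ h1 h2 h3 => hweak a b ha hab v ψ h1 h2 (h3.trans hdU)
  have hPi : ∀ a b : ℝ, 0 < a → a < b →
      IntegrableOn ({x | a < r x ∧ r x < b}.indicator fun x => ‖P x‖) W μ := by
    intro a b ha hab
    obtain ⟨m₁, N₁, -, hN₁, hmN⟩ := exists_rpow_bounds_Icc (b := b) ha (1 - δ)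
    have h1 : IntegrableOn (fun x => C * N₁ * (1 + S x)) W μ :=
      ((integrableOn_const hW.measure_lt_top.ne).add hSW).const_mul _
    refine Integrable.mono' h1 (hP.norm.indicator
      (measurableSet_levels hr a b)).aestronglyMeasurable ?_
    filter_upwards [ae_restrict_mem hWm] with x hx
    have hSx := hS x
    have hrx := hr0 x
    by_cases hl : x ∈ {x | a < r x ∧ r x < b}
    · rw [Set.indicator_of_mem hl, norm_norm]
      have h2 := (hmN (r x) ⟨hl.1.le, hl.2.le⟩).2
      have h3 := rpow_mul_rpow_le_add zero_le_one hSx (θ := 1 / p) (by positivity)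
        ((div_le_one hp0).2 hp.le)
      rw [Real.one_rpow, one_mul] at h3
      calc ‖P x‖ ≤ C * S x ^ (1 / p) * r x ^ (1 - δ) := (hCb x hx).1
        _ ≤ C * (1 + S x) * N₁ := by gcongr
        _ = _ := by ring
    · rw [Set.indicator_of_notMem hl, norm_zero]
      positivity
  obtain ⟨C', hC', hbound⟩ := exists_norm_mul_abs_truncation_sub_le (μ := μ) (δ := δ) hp hr hr0
    hP hW hweakW hPi hS hSW hC (fun x hx => (hCb x hx).1) (fun x hx => (hCb x hx).2) hV hd hVW
    ha hab
  -- bounds for the functions of `r`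
  set c : E → ℝ := fun x => max a (min (r x) b) with hc
  have hcI : ∀ x, c x ∈ Set.Icc a b := fun x =>
    ⟨le_max_left _ _, max_le hab.le (min_le_right _ _)⟩
  have hc0 : ∀ x, 0 < c x := fun x => ha.trans_le (hcI x).1
  have hIcc : Set.Icc a b ⊆ Set.Ioi 0 := fun τ hτ => ha.trans_le hτ.1
  have hfc : ContinuousOn f (Set.Ioi 0) := fun τ hτ => (hf τ hτ).continuousAt.continuousWithinAt
  obtain ⟨N, hN⟩ := isCompact_Icc.exists_bound_of_continuousOn (hfc.mono hIcc)
  obtain ⟨N', hN'⟩ := isCompact_Icc.exists_bound_of_continuousOn (hf'.mono hIcc)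
  have hN0 : 0 ≤ N := (norm_nonneg _).trans (hN a ⟨le_rfl, hab.le⟩)
  have hN'0 : 0 ≤ N' := (norm_nonneg _).trans (hN' a ⟨le_rfl, hab.le⟩)
  have hfL : ∀ x y, |f (c x) - f (c y)| ≤ N' * |c x - c y| := fun x y =>
    (convex_Icc a b).norm_image_sub_le_of_norm_hasDerivWithin_le
      (fun τ hτ => (hf τ (hIcc hτ)).hasDerivWithinAt) hN' (hcI y) (hcI x)
  have hclamp : Continuous fun τ : ℝ => max a (min τ b) := by fun_prop
  have hclamp0 : ∀ τ : ℝ, max a (min τ b) ∈ Set.Ioi (0 : ℝ) := fun τ =>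
    ha.trans_le (le_max_left _ _)
  have hTm : Measurable fun x => f (c x) :=
    (hfc.comp_continuous hclamp hclamp0).measurable.comp hr
  have hT'm : Measurable fun x => f' (c x) :=
    (hf'.comp_continuous hclamp hclamp0).measurable.comp hr
  obtain ⟨Nζ, hNζ⟩ := hζc.exists_bound_of_continuous hζ.continuous
  have hNζ0 : 0 ≤ Nζ := (norm_nonneg _).trans (hNζ 0)
  obtain ⟨Lζ, hLζ⟩ := (hζc.fderiv (𝕜 := ℝ)).exists_bound_of_continuous
    (hζ.continuous_fderiv one_ne_zero)
  have hLζ0 : 0 ≤ Lζ := (norm_nonneg _).trans (hLζ 0)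
  have hζL : ∀ x y, |ζ x - ζ y| ≤ Lζ * ‖x - y‖ := fun x y =>
    Convex.norm_image_sub_le_of_norm_fderiv_le (𝕜 := ℝ)
      (fun z _ => hζ.differentiable one_ne_zero z) (fun z _ => hLζ z) convex_univ
      (Set.mem_univ y) (Set.mem_univ x)
  set ind : E → ℝ := {x | a < r x ∧ r x < b}.indicator (fun _ => (1 : ℝ)) with hind
  have hindm : Measurable ind := measurable_const.indicator (measurableSet_levels hr a b)
  have hindP : ∀ (g : E → ℝ) x, {x | a < r x ∧ r x < b}.indicator g x = ind x * g x := by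
    intro g x
    by_cases hx : x ∈ {x | a < r x ∧ r x < b}
    · simp [hind, Set.indicator_of_mem hx]
    · simp [hind, Set.indicator_of_notMem hx]
  set η : E → ℝ := fun x => ζ x * f (c x) with hη
  set Dη : E → E →L[ℝ] ℝ := fun x => f (c x) • fderiv ℝ ζ x + (ζ x * (f' (c x) * ind x)) • P x
    with hDη
  have hζK : ∀ x ∉ K, ζ x = 0 := fun x hx => image_eq_zero_of_notMem_tsupport hx
  have hDζK : ∀ x ∉ K, fderiv ℝ ζ x = 0 := fun x hx => by
    by_contra hne
    exact hx (support_fderiv_subset ℝ hne)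
  set G : E → ℝ := fun x => Lζ * N * ‖W.indicator B x‖ + Nζ * N' * C' * W.indicator S x with hG
  have hSW0 : ∀ z, 0 ≤ W.indicator S z := fun z => Set.indicator_nonneg (fun x _ => hS x) z
  have hG0 : ∀ x, 0 ≤ G x := fun x => by have := hSW0 x; positivity
  have hGi : Integrable G μ := (hBW'.norm.const_mul _).add (hSW'.const_mul _)
  have hDηm : Measurable Dη := by
    refine (hTm.smul (hζ.continuous_fderiv one_ne_zero).measurable).add ?_
    exact (hζ.continuous.measurable.mul (hT'm.mul hindm)).smul hP
  have hmain := integral_mul_le_integral_apply_of_difference_quotients (μ := μ)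
    (B := W.indicator B) (S := W.indicator S) (η := η) (Dη := Dη) (G := G) (K := K) (δ := d)
    (N := Nζ * N) hd (hBm.indicator hWm) hBW' hSW' ?_ (hζ.continuous.measurable.mul hTm)
    (fun x => mul_nonneg (hζ0 x) (hf0 _ (hc0 x))) (fun x => ?_) hKc
    (fun x hx => by simp [hη, hζK x hx]) hGi hG0 hDηm ?_ ?_ ?_
  · have e1 : ∀ x, W.indicator S x * η x = S x * (ζ x * f (c x)) := by
      intro x
      by_cases hx : x ∈ W
      · rw [Set.indicator_of_mem hx]
      · simp [hη, hζK x fun h => hx (hKW h)]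
    have e2 : ∀ x, Dη x (W.indicator B x) = f (c x) * fderiv ℝ ζ x (B x) + ζ x * (f' (c x) *
        {x | a < r x ∧ r x < b}.indicator (fun x => P x (B x)) x) := by
      intro x
      rw [hindP]
      by_cases hx : x ∈ W
      · rw [Set.indicator_of_mem hx]
        simp [hDη]
        ring
      · simp [hζK x fun h => hx (hKW h), hDζK x fun h => hx (hKW h), Set.indicator_of_notMem hx]
    simp_rw [e1, e2] at hmain
    exact hmain
  · intro ψ h1 h2 h3 h4
    have h3' : tsupport ψ ⊆ W := h3.trans (Metric.cthickening_mono (by linarith) K)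
    have h5 := htest ψ h1 h2 (h3'.trans hdU) h4
    have e1 : ∀ x, W.indicator S x * ψ x = S x * ψ x := by
      intro x
      by_cases hx : x ∈ W
      · rw [Set.indicator_of_mem hx]
      · simp [image_eq_zero_of_notMem_tsupport fun h => hx (h3' h)]
    have e2 : ∀ x, fderiv ℝ ψ x (W.indicator B x) = fderiv ℝ ψ x (B x) := by
      intro x
      by_cases hx : x ∈ W
      · rw [Set.indicator_of_mem hx]
      · have : fderiv ℝ ψ x = 0 := by
          by_contra hne
          exact hx (h3' (support_fderiv_subset ℝ hne))
        simp [this]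
    simp_rw [e1, e2]
    exact h5
  · have h1 := hNζ x
    have h2 := hN _ (hcI x)
    rw [Real.norm_eq_abs] at h1 h2
    exact mul_le_mul ((le_abs_self _).trans h1) ((le_abs_self _).trans h2) (hf0 _ (hc0 x)) hNζ0
  · have h1 : Integrable (fun x => N * Lζ * ‖W.indicator B x‖ +
        Nζ * (N' * (C * C * b)) * W.indicator S x) μ :=
      (hBW'.norm.const_mul _).add (hSW'.const_mul _)
    refine h1.mono' (hDηm.norm.mul (hBm.indicator hWm).norm).aestronglyMeasurable
      (ae_of_all _ fun x => ?_)
    by_cases hx : x ∈ W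
    · rw [Set.indicator_of_mem hx, Set.indicator_of_mem hx, norm_mul, norm_norm, norm_norm]
      have hSx := hS x
      have h2 : ‖Dη x‖ ≤ N * Lζ + Nζ * (N' * (ind x * ‖P x‖)) := by
        have i0 : 0 ≤ ind x := Set.indicator_nonneg (fun _ _ => zero_le_one) x
        refine (norm_add_le _ _).trans ?_
        rw [norm_smul, norm_smul, norm_mul, norm_mul, Real.norm_of_nonneg i0, mul_assoc, mul_assoc]
        gcongr
        · exact hN _ (hcI x)
        · exact hLζ x
        · exact hNζ x
        · exact hN' _ (hcI x)
      have h3 : ind x * ‖P x‖ * ‖B x‖ ≤ C * C * b * S x := by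
        by_cases hl : x ∈ {x | a < r x ∧ r x < b}
        · have i1 : ind x = 1 := Set.indicator_of_mem hl _
          have hrx := hr0 x
          rw [i1, one_mul]
          calc ‖P x‖ * ‖B x‖ ≤ (C * S x ^ (1 / p) * r x ^ (1 - δ)) *
                (C * S x ^ (1 - 1 / p) * r x ^ δ) := by
                gcongr
                · exact (hCb x hx).1
                · exact (hCb x hx).2
            _ = C * C * (S x ^ (1 / p) * S x ^ (1 - 1 / p)) * (r x ^ (1 - δ) * r x ^ δ) := by ring
            _ = C * C * S x * r x := by
                rw [← Real.rpow_add hrx, ← Real.rpow_add_of_nonneg hSx (by positivity)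
                  (sub_nonneg.2 ((div_le_one hp0).2 hp.le))]
                simp
            _ ≤ C * C * S x * b := by gcongr; exact hl.2.le
            _ = _ := by ring
        · have i1 : ind x = 0 := Set.indicator_of_notMem hl _
          have : 0 ≤ b := (ha.trans hab).le
          rw [i1, zero_mul, zero_mul]; positivity
      calc ‖Dη x‖ * ‖B x‖ ≤ (N * Lζ + Nζ * (N' * (ind x * ‖P x‖))) * ‖B x‖ := by gcongr
        _ = N * Lζ * ‖B x‖ + Nζ * (N' * (ind x * ‖P x‖ * ‖B x‖)) := by ring
        _ ≤ N * Lζ * ‖B x‖ + Nζ * (N' * (C * C * b * S x)) := by gcongr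
        _ = _ := by ring
    · simp [Set.indicator_of_notMem hx]
  · intro h hh
    filter_upwards [hbound h hh, (integrable_comp_shear hSW' h).prod_left_ae,
      (integrable_comp_shear hBW'.norm h).prod_left_ae] with y hy hy1 hy2
    have hI1 : 0 ≤ ∫ t in (0 : ℝ)..1, ‖W.indicator B (y + t • h)‖ :=
      intervalIntegral.integral_nonneg zero_le_one fun t _ => norm_nonneg _
    have hIG : ∫ t in (0 : ℝ)..1, G (y + t • h) =
        Lζ * N * (∫ t in (0 : ℝ)..1, ‖W.indicator B (y + t • h)‖) +
          Nζ * N' * C' * ∫ t in (0 : ℝ)..1, W.indicator S (y + t • h) := by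
      simp only [hG]
      simp_rw [intervalIntegral.integral_of_le (zero_le_one' ℝ)]
      rw [integral_add (hy2.const_mul _) (hy1.const_mul _), integral_const_mul,
        integral_const_mul]
    by_cases hyV : y ∈ V
    · have hyW : y ∈ W := by simpa using hVW y hyV 0 (by simpa using hd)
      have hy' := hy hyV
      rw [Set.indicator_of_mem hyW, hIG]
      simp only [hG, Set.indicator_of_mem hyW]
      set I₁ := ∫ t in (0 : ℝ)..1, ‖W.indicator B (y + t • h)‖
      set I₂ := ∫ t in (0 : ℝ)..1, W.indicator S (y + t • h)
      have h1 : |η (y + h) - η y| ≤ Lζ * ‖h‖ * N + Nζ * (N' * |c (y + h) - c y|) := by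
        have e : η (y + h) - η y =
            (ζ (y + h) - ζ y) * f (c (y + h)) + ζ y * (f (c (y + h)) - f (c y)) := by
          simp only [hη]; ring
        rw [e]
        refine (abs_add_le _ _).trans ?_
        rw [abs_mul, abs_mul]
        gcongr
        · simpa using hζL (y + h) y
        · exact hN _ (hcI _)
        · exact hNζ y
        · exact hfL _ _
      calc |η (y + h) - η y| * ‖B y‖
          ≤ (Lζ * ‖h‖ * N + Nζ * (N' * |c (y + h) - c y|)) * ‖B y‖ := by gcongr
        _ = ‖h‖ * (Lζ * N * ‖B y‖) + Nζ * N' * (‖B y‖ * |c (y + h) - c y|) := by ring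
        _ ≤ ‖h‖ * (Lζ * N * ‖B y‖) + Nζ * N' * (‖h‖ * (C' * (S y + I₂))) := by gcongr
        _ = ‖h‖ * (Lζ * N * ‖B y‖ + Nζ * N' * C' * S y + Nζ * N' * C' * I₂) := by ring
        _ ≤ _ := by
            gcongr
            have : 0 ≤ Lζ * N * I₁ := by positivity
            linarith
    · have h1 := hout y hyV h hh
      have h2 : ζ y = 0 := hζK y fun h' => hyV (hKV h')
      simp only [hη, h1, h2, zero_mul, sub_zero, abs_zero]
      have : 0 ≤ ∫ t in (0 : ℝ)..1, G (y + t • h) :=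
        intervalIntegral.integral_nonneg zero_le_one fun t _ => hG0 _
      have := hG0 y
      positivity
  · intro w ε hε hε0
    obtain ⟨ms, hms, hlim⟩ := exists_seq_truncation_quotient_tendsto (μ := μ) hr hP hW hab
      (hweakW a b ha hab) (hPi a b ha hab) hV hd hVW w hε hε0
    refine ⟨ms, hms, hlim.mono fun y hy => ?_⟩
    have hε1 := hε0.comp hms.tendsto_atTop
    have hε2 : Tendsto (fun k => ε (ms k) • w) atTop (𝓝 0) := by simpa using hε1.smul_const w
    by_cases hyV : y ∈ V
    · have hq := hy hyV
      rw [hindP] at hq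
      have hcd : Tendsto (fun k => c (y + ε (ms k) • w) - c y) atTop (𝓝 0) := by
        have := hε1.mul hq
        rw [zero_mul] at this
        refine this.congr fun k => ?_
        simp only [Function.comp_apply]
        rw [mul_inv_cancel_left₀ (hε _).ne']
      have hTq : Tendsto (fun k => (ε (ms k))⁻¹ * (f (c (y + ε (ms k) • w)) - f (c y))) atTop
          (𝓝 (f' (c y) * (ind y * P y w))) := by
        have h1 := (hf (c y) (hc0 y)).hasFDerivAt.hasFDerivWithinAt (s := Set.univ)
        have h2 := h1.lim (c := fun k => (ε (ms k))⁻¹) hcd (Eventually.of_forall fun _ => trivial)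
          hq
        simp only [smul_eq_mul, add_sub_cancel] at h2
        convert h2 using 2
        simp [mul_comm]
      have hT : Tendsto (fun k => f (c (y + ε (ms k) • w))) atTop (𝓝 (f (c y))) := by
        have h1 : Tendsto (fun k => c (y + ε (ms k) • w)) atTop (𝓝 (c y)) := by
          simpa using hcd.add_const (c y)
        exact (hf (c y) (hc0 y)).continuousAt.tendsto.comp h1
      have hζq : Tendsto (fun k => (ε (ms k))⁻¹ * (ζ (y + ε (ms k) • w) - ζ y)) atTop
          (𝓝 (fderiv ℝ ζ y w)) := by
        have h1 := (hζ.differentiable one_ne_zero y).hasFDerivAt.hasFDerivWithinAt (s := Set.univ)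
        have h2 := h1.lim (c := fun k => (ε (ms k))⁻¹) (v := w) hε2
          (Eventually.of_forall fun _ => trivial) (tendsto_const_nhds.congr fun k => by
            rw [smul_smul, inv_mul_cancel₀ (hε _).ne', one_smul])
        simpa only [smul_eq_mul] using h2
      have := (hζq.mul hT).add (hTq.const_mul (ζ y))
      convert this using 2
      · simp only [hη]; ring
      · simp [hDη]; ring
    · have h2 : ζ y = 0 := hζK y fun h' => hyV (hKV h')
      have h3 : fderiv ℝ ζ y = 0 := hDζK y fun h' => hyV (hKV h')
      have hev : ∀ᶠ k in atTop, ‖ε (ms k) • w‖ < d := by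
        have := hε2.norm
        rw [norm_zero] at this
        exact this.eventually_lt_const hd
      have h4 : Dη y w = 0 := by simp [hDη, h2, h3]
      rw [h4]
      refine tendsto_const_nhds.congr' (hev.mono fun k hk => ?_)
      simp [hη, h2, hout y hyV _ hk]

end TruncatedGradient

section Doubling

variable {E : Type*} [NormedAddCommGroup E] [NormedSpace ℝ E] [FiniteDimensional ℝ E]
  [MeasurableSpace E] [BorelSpace E] {μ : Measure E} [μ.IsAddHaarMeasure]

theorem rpow_mul_truncation_rpow_neg_le {a b r : ℝ} (γ : ℝ) (ha : 0 < a) (ha1 : a ≤ 1)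
    (hb : 1 ≤ b) (hr : 0 < r) : r ^ γ * (max a (min r b)) ^ (-γ) ≤ 1 + r ^ γ := by
  have hb0 : 0 < b := by linarith
  have hrγ : 0 < r ^ γ := Real.rpow_pos_of_pos hr γ
  rcases lt_or_ge r a with h1 | h1
  · rw [min_eq_left (by linarith), max_eq_left h1.le]
    rcases le_total 0 γ with hγ | hγ
    · have h2 : r ^ γ ≤ a ^ γ := Real.rpow_le_rpow hr.le h1.le hγ
      have h3 : a ^ γ * a ^ (-γ) = 1 := by rw [← Real.rpow_add ha]; simp
      have h4 := mul_le_mul_of_nonneg_right h2 (Real.rpow_pos_of_pos ha (-γ)).le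
      linarith
    · have h2 : a ^ (-γ) ≤ 1 := Real.rpow_le_one ha.le ha1 (by linarith)
      nlinarith
  · rcases lt_or_ge b r with h2 | h2
    · rw [min_eq_right h2.le, max_eq_right (by linarith)]
      rcases le_total 0 γ with hγ | hγ
      · have h2 : b ^ (-γ) ≤ 1 := Real.rpow_le_one_of_one_le_of_nonpos hb (by linarith)
        nlinarith
      · have h2 : r ^ γ ≤ b ^ γ := Real.rpow_le_rpow_of_nonpos hb0 h2.le hγ
        have h3 : b ^ γ * b ^ (-γ) = 1 := by rw [← Real.rpow_add hb0]; simp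
        have h4 := mul_le_mul_of_nonneg_right h2 (Real.rpow_pos_of_pos hb0 (-γ)).le
        linarith
    · rw [min_eq_left h2, max_eq_right h1, ← Real.rpow_add hr]
      simp [hrγ.le]

theorem integrable_indicator_norm_of_locallyIntegrableOn {F : Type*} [NormedAddCommGroup F]
    {g : E → F} {U K : Set E} (hg : LocallyIntegrableOn g U μ) (hK : IsCompact K) (hKU : K ⊆ U) :
    Integrable (K.indicator fun x => ‖g x‖) μ := by
  rw [integrable_indicator_iff hK.measurableSet]
  exact (hg.integrableOn_compact_subset hKU hK).norm

theorem LocallyIntegrableOn.congr_ae_restrict {F : Type*} [NormedAddCommGroup F]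
    {g g' : E → F} {U : Set E} (hU : IsOpen U) (hg : LocallyIntegrableOn g U μ)
    (h : ∀ᵐ x ∂(μ.restrict U), g x = g' x) : LocallyIntegrableOn g' U μ := by
  rw [locallyIntegrableOn_iff hU.isLocallyClosed] at hg ⊢
  intro k hkU hk
  exact (hg k hkU hk).congr (ae_restrict_of_ae_restrict_of_subset hkU h)

/-- If `-div b ≥ e` and `-div (r ^ γ b) ≥ r ^ γ e` weakly, and `⟨∇r, b⟩ = r e / γ`, then
`-div b ≥ 2 e`. -/
theorem two_mul_integral_le_of_measurable {r e : E → ℝ} {P : E → E →L[ℝ] ℝ} {b : E → E}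
    {U : Set E} {p α γ : ℝ} (hp : 1 < p) (hγ : γ ≠ 0) (hU : IsOpen U)
    (hr : Measurable r) (hr0 : ∀ x, 0 < r x) (hP : Measurable P) (hbm : Measurable b)
    (hem : Measurable e) (he : ∀ x, 0 ≤ e x)
    (hweak : ∀ a b : ℝ, 0 < a → a < b → ∀ v : E, ∀ ψ : E → ℝ, ContDiff ℝ ∞ ψ →
      HasCompactSupport ψ → tsupport ψ ⊆ U →
      ∫ x, max a (min (r x) b) * fderiv ℝ ψ x v ∂μ =
        -∫ x, {x | a < r x ∧ r x < b}.indicator (fun x => P x v) x * ψ x ∂μ)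
    (hei : LocallyIntegrableOn e U μ) (hbi : LocallyIntegrableOn b U μ)
    (hsei : LocallyIntegrableOn (fun x => r x ^ γ * e x) U μ)
    (hsbi : LocallyIntegrableOn (fun x => r x ^ γ • b x) U μ)
    (hbd : ∀ W ⊆ U, IsCompact W → ∃ C : ℝ, 0 ≤ C ∧ ∀ x ∈ W,
      ‖P x‖ ≤ C * e x ^ (1 / p) * r x ^ (1 - α / p) ∧
      ‖b x‖ ≤ C * e x ^ (1 - 1 / p) * r x ^ (α / p))
    (hPb : ∀ x, P x (b x) = r x * e x / γ)
    (htest : ∀ ψ : E → ℝ, ContDiff ℝ ∞ ψ → HasCompactSupport ψ → tsupport ψ ⊆ U →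
      (∀ x, 0 ≤ ψ x) →
      ∫ x, r x ^ γ * e x * ψ x ∂μ ≤ ∫ x, r x ^ γ * fderiv ℝ ψ x (b x) ∂μ)
    {ζ : E → ℝ} (hζ : ContDiff ℝ 1 ζ) (hζc : HasCompactSupport ζ) (hζU : tsupport ζ ⊆ U)
    (hζ0 : ∀ x, 0 ≤ ζ x) :
    2 * ∫ x, e x * ζ x ∂μ ≤ ∫ x, fderiv ℝ ζ x (b x) ∂μ := by
  have hp0 : 0 < p := by linarith
  have hsm : Measurable fun x => r x ^ γ := hr.pow_const γ
  have hs0 : ∀ x, 0 < r x ^ γ := fun x => Real.rpow_pos_of_pos (hr0 x) γ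
  have key : ∀ a c : ℝ, 0 < a → a < c →
      ∫ x, r x ^ γ * e x * (ζ x * (max a (min (r x) c)) ^ (-γ)) ∂μ ≤
        ∫ x, ((max a (min (r x) c)) ^ (-γ) * fderiv ℝ ζ x (r x ^ γ • b x) +
          ζ x * (-{x | a < r x ∧ r x < c}.indicator e x)) ∂μ := by
    intro a c ha hac
    have h := integral_mul_le_integral_apply_of_truncation (μ := μ) (r := r)
      (S := fun x => r x ^ γ * e x) (P := P) (B := fun x => r x ^ γ • b x)
      (δ := (α + γ) / p) (f := fun τ => τ ^ (-γ)) (f' := fun τ => -γ * τ ^ (-γ - 1))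
      hp hU hr hr0 hP (hsm.smul hbm) hweak (fun x => mul_nonneg (hs0 x).le (he x)) hsei hsbi
      (fun W hWU hW => ?_) (fun ψ h1 h2 h3 h4 => ?_)
      (fun τ hτ => Real.hasDerivAt_rpow_const (Or.inl hτ.ne'))
      (fun τ hτ => ((Real.continuousAt_rpow_const τ (-γ - 1)
        (Or.inl (ne_of_gt hτ))).const_mul (-γ)).continuousWithinAt)
      (fun τ hτ => (Real.rpow_pos_of_pos hτ _).le) hζ hζc hζU hζ0 ha hac
    · refine h.trans_eq (integral_congr_ae (ae_of_all _ fun x => ?_))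
      simp only
      congr 2
      by_cases hx : x ∈ {x | a < r x ∧ r x < c}
      · rw [Set.indicator_of_mem hx, Set.indicator_of_mem hx, min_eq_left hx.2.le,
          max_eq_right hx.1.le, map_smul, hPb, smul_eq_mul]
        have h1 : r x ^ (-γ - 1) * r x ^ γ * r x = 1 := by
          rw [← Real.rpow_add (hr0 x), ← Real.rpow_add_one (hr0 x).ne',
            show -γ - 1 + γ + 1 = 0 by ring, Real.rpow_zero]
        calc -γ * r x ^ (-γ - 1) * (r x ^ γ * (r x * e x / γ))
            = -(r x ^ (-γ - 1) * r x ^ γ * r x) * e x * (γ / γ) := by ring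
          _ = -e x := by rw [h1, div_self hγ]; ring
      · rw [Set.indicator_of_notMem hx, Set.indicator_of_notMem hx]; simp
    · obtain ⟨C, hC, hCb⟩ := hbd W hWU hW
      refine ⟨C, hC, fun x hx => ?_⟩
      have hrx := hr0 x
      obtain ⟨h1, h2⟩ := hCb x hx
      constructor
      · refine h1.trans_eq ?_
        rw [Real.mul_rpow (hs0 x).le (he x), ← Real.rpow_mul hrx.le]
        have : r x ^ (γ * (1 / p)) * r x ^ (1 - (α + γ) / p) = r x ^ (1 - α / p) := by
          rw [← Real.rpow_add hrx]; congr 1; ring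
        rw [← this]; ring
      · rw [norm_smul, Real.norm_of_nonneg (hs0 x).le]
        refine (mul_le_mul_of_nonneg_left h2 (hs0 x).le).trans_eq ?_
        rw [Real.mul_rpow (hs0 x).le (he x), ← Real.rpow_mul hrx.le]
        have : r x ^ (γ * (1 - 1 / p)) * r x ^ ((α + γ) / p) = r x ^ γ * r x ^ (α / p) := by
          rw [← Real.rpow_add hrx, ← Real.rpow_add hrx]; congr 1; field_simp; ring
        calc r x ^ γ * (C * e x ^ (1 - 1 / p) * r x ^ (α / p))
            = C * e x ^ (1 - 1 / p) * (r x ^ γ * r x ^ (α / p)) := by ring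
          _ = _ := by rw [← this]; ring
    · simpa only [map_smul, smul_eq_mul] using htest ψ h1 h2 h3 h4
  -- exhaustion of the levels
  set K := tsupport ζ with hK
  have hKc : IsCompact K := hζc
  have hKm : MeasurableSet K := (isClosed_tsupport ζ).measurableSet
  obtain ⟨N, hN⟩ := hζc.exists_bound_of_continuous hζ.continuous
  obtain ⟨L, hL⟩ := (hζc.fderiv (𝕜 := ℝ)).exists_bound_of_continuous
    (hζ.continuous_fderiv one_ne_zero)
  have hDc : Continuous (fderiv ℝ ζ) := hζ.continuous_fderiv one_ne_zero
  have hN0 : 0 ≤ N := (norm_nonneg _).trans (hN 0)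
  have hL0 : 0 ≤ L := (norm_nonneg _).trans (hL 0)
  have hζK : ∀ x ∉ K, ζ x = 0 := fun x hx => image_eq_zero_of_notMem_tsupport hx
  have hDζK : ∀ x ∉ K, fderiv ℝ ζ x = 0 := fun x hx => by
    by_contra hne
    exact hx (support_fderiv_subset ℝ hne)
  have hE : Integrable (fun x => N * (K.indicator (fun x => ‖e x‖) x +
      K.indicator (fun x => ‖r x ^ γ * e x‖) x)) μ := 
    ((integrable_indicator_norm_of_locallyIntegrableOn hei hKc hζU).add
      (integrable_indicator_norm_of_locallyIntegrableOn hsei hKc hζU)).const_mul N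
  have hB : Integrable (fun x => L * (K.indicator (fun x => ‖b x‖) x +
      K.indicator (fun x => ‖r x ^ γ • b x‖) x)) μ := 
    ((integrable_indicator_norm_of_locallyIntegrableOn hbi hKc hζU).add
      (integrable_indicator_norm_of_locallyIntegrableOn hsbi hKc hζU)).const_mul L
  set t : ℕ → E → ℝ := fun k x => max ((k : ℝ) + 2)⁻¹ (min (r x) ((k : ℝ) + 2)) with ht
  have hta : ∀ k : ℕ, 0 < ((k : ℝ) + 2)⁻¹ := fun k => by positivity
  have hta1 : ∀ k : ℕ, ((k : ℝ) + 2)⁻¹ ≤ 1 := fun k => inv_le_one_of_one_le₀ (by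
    have : (0 : ℝ) ≤ k := k.cast_nonneg
    linarith)
  have htb1 : ∀ k : ℕ, (1 : ℝ) < (k : ℝ) + 2 := fun k => by
    have : (0 : ℝ) ≤ k := k.cast_nonneg
    linarith
  have htm : ∀ k, Measurable (t k) := fun k => measurable_const.max (hr.min measurable_const)
  have ht0 : ∀ k x, 0 < t k x := fun k x => (hta k).trans_le (le_max_left _ _)
  have hbound : ∀ k x, r x ^ γ * t k x ^ (-γ) ≤ 1 + r x ^ γ := fun k x =>
    rpow_mul_truncation_rpow_neg_le γ (hta k) (hta1 k) (htb1 k).le (hr0 x)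
  have hev : ∀ x, ∀ᶠ k : ℕ in atTop, ((k : ℝ) + 2)⁻¹ < r x ∧ r x < (k : ℝ) + 2 := by
    intro x
    have h1 : Tendsto (fun k : ℕ => (k : ℝ) + 2) atTop atTop :=
      tendsto_atTop_add_const_right _ _ tendsto_natCast_atTop_atTop
    exact (h1.inv_tendsto_atTop.eventually_lt_const (hr0 x)).and (h1.eventually_gt_atTop (r x))
  have hone : ∀ x, r x ^ γ * r x ^ (-γ) = 1 := fun x => by
    rw [← Real.rpow_add (hr0 x)]; simp
  have hlim1 : Tendsto (fun k => ∫ x, r x ^ γ * e x * (ζ x * t k x ^ (-γ)) ∂μ) atTop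
      (𝓝 (∫ x, e x * ζ x ∂μ)) := by
    refine tendsto_integral_of_dominated_convergence _ (fun k => ?_) hE
      (fun k => ae_of_all _ fun x => ?_) (ae_of_all _ fun x => ?_)
    · exact ((hsm.mul hem).mul (hζ.continuous.measurable.mul
        ((htm k).pow_const _))).aestronglyMeasurable
    · by_cases hx : x ∈ K
      · rw [Set.indicator_of_mem hx, Set.indicator_of_mem hx]
        have hp1 := Real.rpow_pos_of_pos (ht0 k x) (-γ)
        have hsx := hs0 x
        have hex := he x
        rw [norm_mul, norm_mul, norm_mul, Real.norm_of_nonneg hex,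
          Real.norm_of_nonneg hsx.le, Real.norm_of_nonneg hp1.le]
        calc r x ^ γ * e x * (‖ζ x‖ * t k x ^ (-γ))
            = ‖ζ x‖ * (r x ^ γ * t k x ^ (-γ)) * e x := by ring
          _ ≤ N * (1 + r x ^ γ) * e x := by
              gcongr
              · exact hN x
              · exact hbound k x
          _ = _ := by ring
      · rw [Set.indicator_of_notMem hx, Set.indicator_of_notMem hx, hζK x hx]; simp
    · refine tendsto_const_nhds.congr' ((hev x).mono fun k hk => ?_)
      simp only [ht]
      rw [min_eq_left hk.2.le, max_eq_right hk.1.le]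
      calc e x * ζ x = (r x ^ γ * r x ^ (-γ)) * (e x * ζ x) := by rw [hone, one_mul]
        _ = _ := by ring
  have hlim2 : Tendsto (fun k : ℕ => ∫ x, (t k x ^ (-γ) * fderiv ℝ ζ x (r x ^ γ • b x) +
      ζ x * (-{x | ((k : ℝ) + 2)⁻¹ < r x ∧ r x < (k : ℝ) + 2}.indicator e x)) ∂μ) atTop
      (𝓝 (∫ x, (fderiv ℝ ζ x (b x) + ζ x * -e x) ∂μ)) := by
    refine tendsto_integral_of_dominated_convergence _ (fun k => ?_) (hB.add hE)
      (fun k => ae_of_all _ fun x => ?_) (ae_of_all _ fun x => ?_)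
    · exact ((((htm k).pow_const _).mul (hDc.measurable.clm_apply_real (hsm.smul hbm))).add
        (hζ.continuous.measurable.mul
          (hem.indicator (measurableSet_levels hr _ _)).neg)).aestronglyMeasurable
    · by_cases hx : x ∈ K
      · simp only [Pi.add_apply, Set.indicator_of_mem hx]
        have hp1 := Real.rpow_pos_of_pos (ht0 k x) (-γ)
        have hsx := hs0 x
        refine (norm_add_le _ _).trans (add_le_add ?_ ?_)
        · rw [map_smul, norm_mul, norm_smul, norm_smul, Real.norm_of_nonneg hsx.le,
            Real.norm_of_nonneg hp1.le]
          calc t k x ^ (-γ) * (r x ^ γ * ‖fderiv ℝ ζ x (b x)‖)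
              = (r x ^ γ * t k x ^ (-γ)) * ‖fderiv ℝ ζ x (b x)‖ := by ring
            _ ≤ (1 + r x ^ γ) * (L * ‖b x‖) := by
                gcongr
                · exact hbound k x
                · exact ((fderiv ℝ ζ x).le_opNorm _).trans (by gcongr; exact hL x)
            _ = _ := by ring
        · rw [norm_mul, norm_neg]
          have h1 := norm_indicator_le_norm_self
            (s := {x | ((k : ℝ) + 2)⁻¹ < r x ∧ r x < (k : ℝ) + 2}) e x
          refine mul_le_mul (hN x) (h1.trans ?_) (norm_nonneg _) hN0
          linarith [norm_nonneg (r x ^ γ * e x)]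
      · simp [Set.indicator_of_notMem hx, hζK x hx, hDζK x hx]
    · refine tendsto_const_nhds.congr' ((hev x).mono fun k hk => ?_)
      simp only [ht]
      rw [min_eq_left hk.2.le, max_eq_right hk.1.le, Set.indicator_of_mem
          (s := {x | ((k : ℝ) + 2)⁻¹ < r x ∧ r x < (k : ℝ) + 2}) hk,
        map_smul, smul_eq_mul, ← mul_assoc, mul_comm (r x ^ (-γ)), hone, one_mul]
  have hle := le_of_tendsto_of_tendsto' hlim1 hlim2 fun k =>
    key _ _ (hta k) (lt_of_le_of_lt (hta1 k) (htb1 k))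
  have i1 : Integrable (fun x => fderiv ℝ ζ x (b x)) μ := by
    refine hB.mono' (hDc.measurable.clm_apply_real hbm).aestronglyMeasurable
      (ae_of_all _ fun x => ?_)
    by_cases hx : x ∈ K
    · rw [Set.indicator_of_mem hx, Set.indicator_of_mem hx]
      refine ((fderiv ℝ ζ x).le_opNorm _).trans ?_
      exact mul_le_mul (hL x) (by linarith [norm_nonneg (r x ^ γ • b x)]) (norm_nonneg _) hL0
    · simp [Set.indicator_of_notMem hx, hDζK x hx]
  have i2 : Integrable (fun x => ζ x * -e x) μ := by
    refine hE.mono' (hζ.continuous.measurable.mul hem.neg).aestronglyMeasurable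
      (ae_of_all _ fun x => ?_)
    by_cases hx : x ∈ K
    · rw [Set.indicator_of_mem hx, Set.indicator_of_mem hx, norm_mul, norm_neg]
      exact mul_le_mul (hN x) (by linarith [norm_nonneg (r x ^ γ * e x)]) (norm_nonneg _) hN0
    · simp [Set.indicator_of_notMem hx, hζK x hx]
  rw [integral_add i1 i2] at hle
  have e1 : ∫ x, ζ x * -e x ∂μ = -∫ x, e x * ζ x ∂μ := by
    rw [← integral_neg]
    refine integral_congr_ae (ae_of_all _ fun x => ?_)
    simp only
    ring
  rw [e1] at hle
  linarith

theorem two_mul_setIntegral_le {r e : E → ℝ} {P : E → E →L[ℝ] ℝ} {b : E → E}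
    {U : Set E} {p α γ : ℝ} (hp : 1 < p) (hγ : γ ≠ 0) (hU : IsOpen U)
    (hr : AEMeasurable r (μ.restrict U)) (hr0 : ∀ x ∈ U, 0 < r x)
    (hP : AEMeasurable P (μ.restrict U)) (hbm : AEMeasurable b (μ.restrict U))
    (hem : AEMeasurable e (μ.restrict U)) (he : ∀ x ∈ U, 0 ≤ e x)
    (hweak : ∀ a b : ℝ, 0 < a → a < b → ∀ v : E, ∀ ψ : E → ℝ, ContDiff ℝ ∞ ψ →
      HasCompactSupport ψ → tsupport ψ ⊆ U →
      ∫ x in U, max a (min (r x) b) * fderiv ℝ ψ x v ∂μ =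
        -∫ x in U, {x | a < r x ∧ r x < b}.indicator (fun x => P x v) x * ψ x ∂μ)
    (hei : LocallyIntegrableOn e U μ) (hbi : LocallyIntegrableOn b U μ)
    (hsei : LocallyIntegrableOn (fun x => r x ^ γ * e x) U μ)
    (hsbi : LocallyIntegrableOn (fun x => r x ^ γ • b x) U μ)
    (hbd : ∀ W ⊆ U, IsCompact W → ∃ C : ℝ, 0 ≤ C ∧ ∀ x ∈ W,
      ‖P x‖ ≤ C * e x ^ (1 / p) * r x ^ (1 - α / p) ∧
      ‖b x‖ ≤ C * e x ^ (1 - 1 / p) * r x ^ (α / p))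
    (hPb : ∀ x ∈ U, P x (b x) = r x * e x / γ)
    (htest : ∀ ψ : E → ℝ, ContDiff ℝ ∞ ψ → HasCompactSupport ψ → tsupport ψ ⊆ U →
      (∀ x, 0 ≤ ψ x) →
      ∫ x in U, r x ^ γ * e x * ψ x ∂μ ≤ ∫ x in U, r x ^ γ * fderiv ℝ ψ x (b x) ∂μ)
    {ζ : E → ℝ} (hζ : ContDiff ℝ 1 ζ) (hζc : HasCompactSupport ζ) (hζU : tsupport ζ ⊆ U)
    (hζ0 : ∀ x, 0 ≤ ζ x) :
    2 * ∫ x in U, e x * ζ x ∂μ ≤ ∫ x in U, fderiv ℝ ζ x (b x) ∂μ := by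
  classical
  have hgood : ∀ᵐ x ∂(μ.restrict U), x ∈ U ∧ r x = hr.mk r x ∧ P x = hP.mk P x ∧
      b x = hbm.mk b x ∧ e x = hem.mk e x := by
    filter_upwards [ae_restrict_mem hU.measurableSet, hr.ae_eq_mk, hP.ae_eq_mk, hbm.ae_eq_mk,
      hem.ae_eq_mk] with x h1 h2 h3 h4 h5 using ⟨h1, h2, h3, h4, h5⟩
  obtain ⟨T, hT, hTm, hT0⟩ := exists_measurable_superset_of_null hgood
  have hG : ∀ x ∉ T, x ∈ U ∧ r x = hr.mk r x ∧ P x = hP.mk P x ∧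
      b x = hbm.mk b x ∧ e x = hem.mk e x := fun x hx => by
    by_contra h
    exact hx (hT h)
  have hTae : ∀ᵐ x ∂(μ.restrict U), x ∉ T := by
    rw [ae_iff]
    simpa using hT0
  set r' : E → ℝ := T.piecewise (fun _ => 1) (hr.mk r) with hr'
  set P' : E → E →L[ℝ] ℝ := T.piecewise (fun _ => 0) (hP.mk P) with hP'
  set b' : E → E := T.piecewise (fun _ => 0) (hbm.mk b) with hb'
  set e' : E → ℝ := T.piecewise (fun _ => 0) (hem.mk e) with he'
  have rT : ∀ x ∉ T, r' x = r x := fun x hx => by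
    rw [hr', Set.piecewise_eq_of_notMem _ _ _ hx, (hG x hx).2.1]
  have PT : ∀ x ∉ T, P' x = P x := fun x hx => by
    rw [hP', Set.piecewise_eq_of_notMem _ _ _ hx, (hG x hx).2.2.1]
  have bT : ∀ x ∉ T, b' x = b x := fun x hx => by
    rw [hb', Set.piecewise_eq_of_notMem _ _ _ hx, (hG x hx).2.2.2.1]
  have eT : ∀ x ∉ T, e' x = e x := fun x hx => by
    rw [he', Set.piecewise_eq_of_notMem _ _ _ hx, (hG x hx).2.2.2.2]
  have rT1 : ∀ x ∈ T, r' x = 1 := fun x hx => Set.piecewise_eq_of_mem _ _ _ hx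
  have PT0 : ∀ x ∈ T, P' x = 0 := fun x hx => Set.piecewise_eq_of_mem _ _ _ hx
  have bT0 : ∀ x ∈ T, b' x = 0 := fun x hx => Set.piecewise_eq_of_mem _ _ _ hx
  have eT0 : ∀ x ∈ T, e' x = 0 := fun x hx => Set.piecewise_eq_of_mem _ _ _ hx
  have hfull : ∀ {g g' : E → ℝ}, (∀ x ∉ T, g' x = g x) → (∀ x ∉ U, g' x = 0) →
      ∫ x, g' x ∂μ = ∫ x in U, g x ∂μ := by
    intro g g' h1 h2
    rw [← setIntegral_eq_integral_of_forall_compl_eq_zero h2]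
    exact integral_congr_ae (hTae.mono h1)
  have hψ0 : ∀ {ψ : E → ℝ}, tsupport ψ ⊆ U → ∀ x ∉ U, ψ x = 0 ∧ fderiv ℝ ψ x = 0 := by
    intro ψ hψ x hx
    refine ⟨image_eq_zero_of_notMem_tsupport fun h => hx (hψ h), ?_⟩
    by_contra hne
    exact hx (hψ (support_fderiv_subset ℝ hne))
  have hres := two_mul_integral_le_of_measurable (μ := μ) (r := r') (e := e') (P := P') (b := b')
    (α := α) hp hγ hU (measurable_const.piecewise hTm hr.measurable_mk) (fun x => ?_)
    (measurable_const.piecewise hTm hP.measurable_mk)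
    (measurable_const.piecewise hTm hbm.measurable_mk)
    (measurable_const.piecewise hTm hem.measurable_mk) (fun x => ?_)
    (fun a c ha hac v ψ h1 h2 h3 => ?_)
    (LocallyIntegrableOn.congr_ae_restrict hU hei (hTae.mono fun x hx => (eT x hx).symm))
    (LocallyIntegrableOn.congr_ae_restrict hU hbi (hTae.mono fun x hx => (bT x hx).symm))
    (LocallyIntegrableOn.congr_ae_restrict hU hsei (hTae.mono fun x hx => by rw [rT x hx, eT x hx]))
    (LocallyIntegrableOn.congr_ae_restrict hU hsbi (hTae.mono fun x hx => by rw [rT x hx, bT x hx]))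
    (fun W hWU hW => ?_) (fun x => ?_)
    (fun ψ h1 h2 h3 h4 => ?_) hζ hζc hζU hζ0
  · rwa [hfull (g := fun x => e x * ζ x) (fun x hx => by rw [eT x hx])
        (fun x hx => by rw [(hψ0 hζU x hx).1, mul_zero]),
      hfull (g := fun x => fderiv ℝ ζ x (b x)) (fun x hx => by rw [bT x hx])
        (fun x hx => by rw [(hψ0 hζU x hx).2]; simp)] at hres
  · by_cases hx : x ∈ T
    · rw [rT1 x hx]; exact one_pos
    · rw [rT x hx]; exact hr0 x (hG x hx).1
  · by_cases hx : x ∈ T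
    · rw [eT0 x hx]
    · rw [eT x hx]; exact he x (hG x hx).1
  · rw [hfull (g := fun x => max a (min (r x) c) * fderiv ℝ ψ x v) (fun x hx => by rw [rT x hx])
        (fun x hx => by rw [(hψ0 h3 x hx).2]; simp),
      hfull (g := fun x => {x | a < r x ∧ r x < c}.indicator (fun x => P x v) x * ψ x)
        (fun x hx => by simp only [Set.indicator_apply, Set.mem_ofPred_eq, rT x hx, PT x hx])
        (fun x hx => by rw [(hψ0 h3 x hx).1, mul_zero])]
    exact hweak a c ha hac v ψ h1 h2 h3
  · obtain ⟨C, hC, hCb⟩ := hbd W hWU hW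
    refine ⟨C, hC, fun x hxW => ?_⟩
    by_cases hx : x ∈ T
    · rw [PT0 x hx, bT0 x hx, eT0 x hx, rT1 x hx]
      simp only [norm_zero]
      constructor <;> positivity
    · rw [PT x hx, bT x hx, eT x hx, rT x hx]
      exact hCb x hxW
  · by_cases hx : x ∈ T
    · rw [PT0 x hx, eT0 x hx]; simp
    · rw [PT x hx, bT x hx, eT x hx, rT x hx]
      exact hPb x (hG x hx).1
  · rw [hfull (g := fun x => r x ^ γ * e x * ψ x) (fun x hx => by rw [rT x hx, eT x hx])
        (fun x hx => by rw [(hψ0 h3 x hx).1, mul_zero]),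
      hfull (g := fun x => r x ^ γ * fderiv ℝ ψ x (b x)) (fun x hx => by rw [rT x hx, bT x hx])
        (fun x hx => by rw [(hψ0 h3 x hx).2]; simp)]
    exact htest ψ h1 h2 h3 h4

end Doubling

section LocalIntegrability

theorem exists_smooth_cutoff {E : Type*} [NormedAddCommGroup E] [NormedSpace ℝ E]
    [FiniteDimensional ℝ E] {k U : Set E} (hk : IsCompact k) (hU : IsOpen U) (hkU : k ⊆ U) :
    ∃ χ : E → ℝ, ContDiff ℝ ∞ χ ∧ HasCompactSupport χ ∧ tsupport χ ⊆ U ∧ (∀ x, 0 ≤ χ x) ∧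
      ∀ x ∈ k, χ =ᶠ[𝓝 x] fun _ => 1 := by
  obtain ⟨k', hk', hkk', hk'U⟩ := exists_compact_between hk hU hkU
  obtain ⟨f, hf1, hf0, hf⟩ := exists_contMDiffMap_one_nhds_of_subset_interior 𝓘(ℝ, E) (n := ⊤)
    hk.isClosed hkk'
  have hsub : tsupport f ⊆ k' := closure_minimal
    (fun x hx => by_contra fun h => hx (hf0 x h)) hk'.isClosed
  refine ⟨f, contMDiff_iff_contDiff.1 f.contMDiff, hk'.of_isClosed_subset (isClosed_tsupport _)
    hsub,
    hsub.trans hk'U, fun x => (hf x).1, fun x hx => ?_⟩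
  exact (eventually_nhdsSet_iff_forall.1 hf1) x hx

theorem integrable_mul_of_locallyIntegrableOn {E : Type*} [NormedAddCommGroup E]
    [MeasurableSpace E] [BorelSpace E] {μ : Measure E} {U : Set E} {g φ : E → ℝ}
    (hg : LocallyIntegrableOn g U μ) (hφ : Continuous φ) (hφc : HasCompactSupport φ)
    (hφU : tsupport φ ⊆ U) : Integrable (fun x => g x * φ x) μ := by
  have h := (hg.integrableOn_compact_subset hφU hφc).mul_continuousOn hφ.continuousOn hφc
  rw [← integrableOn_univ]
  refine h.of_forall_sdiff_eq_zero MeasurableSet.univ fun x hx => ?_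
  rw [image_eq_zero_of_notMem_tsupport hx.2, mul_zero]

variable {n : ℕ} {U : Set (EuclideanSpace ℝ (Fin n))}

theorem locallyIntegrableOn_of_forall_integrableOn_mul {g : EuclideanSpace ℝ (Fin n) → ℝ}
    (hU : IsOpen U)
    (h : ∀ ψ : EuclideanSpace ℝ (Fin n) → ℝ, ContDiff ℝ ∞ ψ → HasCompactSupport ψ →
      tsupport ψ ⊆ U → (∀ x, 0 ≤ ψ x) → IntegrableOn (fun x => g x * ψ x) U) :
    LocallyIntegrableOn g U := by
  rw [locallyIntegrableOn_iff hU.isLocallyClosed]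
  intro k hkU hk
  obtain ⟨χ, h1, h2, h3, h4, h5⟩ := exists_smooth_cutoff hk hU hkU
  refine ((h χ h1 h2 h3 h4).mono_set hkU).congr_fun (fun x hx => ?_) hk.measurableSet
  simp only [(h5 x hx).eq_of_nhds, mul_one]

/-- A vector field `b` is locally integrable if all the functions `⟨∇ψ, b⟩` are integrable. -/
theorem locallyIntegrableOn_of_forall_integrableOn_fderiv
    {b : EuclideanSpace ℝ (Fin n) → EuclideanSpace ℝ (Fin n)} (hU : IsOpen U)
    (hb : AEMeasurable b (volume.restrict U))
    (h : ∀ ψ : EuclideanSpace ℝ (Fin n) → ℝ, ContDiff ℝ ∞ ψ → HasCompactSupport ψ →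
      tsupport ψ ⊆ U → (∀ x, 0 ≤ ψ x) → IntegrableOn (fun x => fderiv ℝ ψ x (b x)) U) :
    LocallyIntegrableOn b U := by
  rw [locallyIntegrableOn_iff hU.isLocallyClosed]
  intro k hkU hk
  obtain ⟨χ, h1, h2, h3, h4, h5⟩ := exists_smooth_cutoff hk hU hkU
  have hi : ∀ i, IntegrableOn (fun x => b x i) k := by
    intro i
    let q : EuclideanSpace ℝ (Fin n) →L[ℝ] ℝ := EuclideanSpace.proj i
    have hx := h (fun x => χ x * Real.exp (q x)) (h1.mul q.contDiff.exp) h2.mul_right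
      ((tsupport_mul_subset_left (f := χ)).trans h3)
      (fun x => mul_nonneg (h4 x) (Real.exp_pos _).le)
    have hx' : IntegrableOn (fun x => Real.exp (q x) * b x i) k := by
      refine (hx.mono_set hkU).congr_fun (fun x hx => ?_) hk.measurableSet
      have : (fun x => χ x * Real.exp (q x)) =ᶠ[𝓝 x] fun x => Real.exp (q x) :=
        (h5 x hx).mono fun z hz => by simp only [hz, one_mul]
      simp only [this.fderiv_eq, (q.hasFDerivAt.exp).fderiv]
      rfl
    have hc : ContinuousOn (fun x => Real.exp (-q x)) k := by fun_prop
    refine (hx'.mul_continuousOn hc hk).congr_fun (fun x _ => ?_) hk.measurableSet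
    simp only
    rw [mul_right_comm, ← Real.exp_add, add_neg_cancel, Real.exp_zero, one_mul]
  refine (integrable_finsetSum Finset.univ fun i _ => (hi i).norm).mono'
    (hb.mono_measure (Measure.restrict_mono hkU le_rfl)).aestronglyMeasurable
    (ae_of_all _ fun x => ?_)
  rw [EuclideanSpace.norm_eq]
  refine Real.sqrt_le_iff.2 ⟨Finset.sum_nonneg fun i _ => norm_nonneg _, ?_⟩
  exact Finset.sum_sq_le_sq_sum_of_nonneg fun i _ => norm_nonneg _

end LocalIntegrability

section ChartTestFunctions

variable {n : ℕ} {M : Type*} [TopologicalSpace M] [ChartedSpace (EuclideanSpace ℝ (Fin n)) M]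
  [IsManifold (𝓡 n) ∞ M] {Ω : Set M}

/-- A function on the model space, carried over to `M` by `chartAt x₀` and extended by zero. -/
def ofChart (x₀ : M) (ψ : EuclideanSpace ℝ (Fin n) → ℝ) : M → ℝ :=
  (chartAt (EuclideanSpace ℝ (Fin n)) x₀).source.indicator
    fun x => ψ (chartAt (EuclideanSpace ℝ (Fin n)) x₀ x)

theorem ofChart_chart_symm {x₀ : M} (ψ : EuclideanSpace ℝ (Fin n) → ℝ)
    {y : EuclideanSpace ℝ (Fin n)} (hy : y ∈ (chartAt (EuclideanSpace ℝ (Fin n)) x₀).target) :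
    ofChart x₀ ψ ((chartAt (EuclideanSpace ℝ (Fin n)) x₀).symm y) = ψ y := by
  rw [ofChart, Set.indicator_of_mem
    ((chartAt (EuclideanSpace ℝ (Fin n)) x₀).map_target hy),
    (chartAt (EuclideanSpace ℝ (Fin n)) x₀).right_inv hy]

theorem ofChart_nonneg (x₀ : M) {ψ : EuclideanSpace ℝ (Fin n) → ℝ} (h : ∀ y, 0 ≤ ψ y) (x : M) :
    0 ≤ ofChart x₀ ψ x :=
  Set.indicator_nonneg (fun _ _ => h _) x

theorem tsupport_ofChart_subset [T2Space M] (x₀ : M) {ψ : EuclideanSpace ℝ (Fin n) → ℝ}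
    (hc : HasCompactSupport ψ)
    (hψ : tsupport ψ ⊆ (chartAt (EuclideanSpace ℝ (Fin n)) x₀).target) :
    IsCompact ((chartAt (EuclideanSpace ℝ (Fin n)) x₀).symm '' tsupport ψ) ∧
    tsupport (ofChart x₀ ψ) ⊆ (chartAt (EuclideanSpace ℝ (Fin n)) x₀).symm '' tsupport ψ := by
  set e := chartAt (EuclideanSpace ℝ (Fin n)) x₀ with he
  have hK : IsCompact (e.symm '' tsupport ψ) :=
    IsCompact.image_of_continuousOn hc (e.continuousOn_symm.mono hψ)
  refine ⟨hK, closure_minimal (fun x hx => ?_) hK.isClosed⟩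
  by_cases hxs : x ∈ e.source
  · refine ⟨e x, subset_closure ?_, e.left_inv hxs⟩
    rw [Function.mem_support] at hx ⊢
    rwa [ofChart, Set.indicator_of_mem hxs] at hx
  · exact absurd (Set.indicator_of_notMem hxs _) hx

theorem isTestFunction_ofChart [T2Space M] (x₀ : M) {ψ : EuclideanSpace ℝ (Fin n) → ℝ}
    (hψ : ContDiff ℝ 1 ψ) (hc : HasCompactSupport ψ)
    (hU : tsupport ψ ⊆ chartRegion Ω x₀) : IsTestFunction n Ω (ofChart x₀ ψ) := by
  have : IsManifold (𝓡 n) 1 M := .of_le (n := ∞) (by norm_cast)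
  obtain ⟨hK, hsub⟩ := tsupport_ofChart_subset x₀ hc (hU.trans (chartRegion_subset_target Ω x₀))
  set e := chartAt (EuclideanSpace ℝ (Fin n)) x₀ with he
  refine ⟨contMDiff_of_tsupport fun x hx => ?_, hK.of_isClosed_subset (isClosed_tsupport _) hsub,
    hsub.trans ?_⟩
  · obtain ⟨y, hy, rfl⟩ := hsub hx
    have hys : e.symm y ∈ e.source := e.map_target (hU hy).1
    have h1 : ContMDiffAt (𝓡 n) 𝓘(ℝ, ℝ) 1 (fun x => ψ (e x)) (e.symm y) :=
      hψ.contMDiff.contMDiffAt.comp _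
        ((contMDiffOn_chart (I := 𝓡 n) (n := 1) (x := x₀)).contMDiffAt (e.open_source.mem_nhds hys))
    refine h1.congr_of_eventuallyEq ?_
    filter_upwards [e.open_source.mem_nhds hys] with z hz
    rw [ofChart, Set.indicator_of_mem hz]
  · rintro _ ⟨y, hy, rfl⟩
    exact (hU hy).2

/-- The expression of a function in a chart, extended by zero. -/
def inChart (x₀ : M) (ξ : M → ℝ) : EuclideanSpace ℝ (Fin n) → ℝ :=
  (chartAt (EuclideanSpace ℝ (Fin n)) x₀).target.indicator
    fun y => ξ ((chartAt (EuclideanSpace ℝ (Fin n)) x₀).symm y)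

theorem IsTestFunction.inChart {ξ : M → ℝ} (hξ : IsTestFunction n Ω ξ) {x₀ : M}
    (hs : tsupport ξ ⊆ (chartAt (EuclideanSpace ℝ (Fin n)) x₀).source) :
    ContDiff ℝ 1 (inChart (n := n) x₀ ξ) ∧ HasCompactSupport (inChart (n := n) x₀ ξ) ∧
      tsupport (inChart (n := n) x₀ ξ) ⊆ chartRegion Ω x₀ := by
  have : IsManifold (𝓡 n) 1 M := .of_le (n := ∞) (by norm_cast)
  set e := chartAt (EuclideanSpace ℝ (Fin n)) x₀ with he
  have hK : IsCompact (e '' tsupport ξ) :=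
    IsCompact.image_of_continuousOn hξ.hasCompactSupport (e.continuousOn.mono hs)
  have hsub : tsupport (_root_.inChart (n := n) x₀ ξ) ⊆ e '' tsupport ξ := by
    refine closure_minimal (fun y hy => ?_) hK.isClosed
    by_cases hyt : y ∈ e.target
    · refine ⟨e.symm y, subset_closure ?_, e.right_inv hyt⟩
      rw [Function.mem_support] at hy ⊢
      rwa [_root_.inChart, Set.indicator_of_mem hyt] at hy
    · exact absurd (Set.indicator_of_notMem hyt _) hy
  refine ⟨?_, hK.of_isClosed_subset (isClosed_tsupport _) hsub, hsub.trans ?_⟩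
  · rw [← contMDiff_iff_contDiff]
    refine contMDiff_of_tsupport fun y hy => ?_
    obtain ⟨x, hx, rfl⟩ := hsub hy
    have hyt := e.map_source (hs hx)
    have h1 : ContMDiffAt (𝓡 n) 𝓘(ℝ, ℝ) 1 (fun y => ξ (e.symm y)) (e x) :=
      hξ.contMDiff.contMDiffAt.comp _
        ((contMDiffOn_chart_symm (I := 𝓡 n) (n := 1) (x := x₀)).contMDiffAt
          (e.open_target.mem_nhds hyt))
    refine h1.congr_of_eventuallyEq ?_
    filter_upwards [e.open_target.mem_nhds hyt] with z hz
    rw [_root_.inChart, Set.indicator_of_mem hz]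
  · rintro _ ⟨x, hx, rfl⟩
    refine ⟨e.map_source (hs hx), ?_⟩
    rw [Set.mem_preimage, e.left_inv (hs hx)]
    exact hξ.tsupport_subset hx

theorem ofChart_inChart {ξ : M → ℝ} {x₀ : M}
    (hs : tsupport ξ ⊆ (chartAt (EuclideanSpace ℝ (Fin n)) x₀).source) :
    ofChart x₀ (inChart (n := n) x₀ ξ) = ξ := by
  ext x
  by_cases hx : x ∈ (chartAt (EuclideanSpace ℝ (Fin n)) x₀).source
  · rw [ofChart, Set.indicator_of_mem hx, inChart, Set.indicator_of_mem
      ((chartAt (EuclideanSpace ℝ (Fin n)) x₀).map_source hx),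
      (chartAt (EuclideanSpace ℝ (Fin n)) x₀).left_inv hx]
  · rw [ofChart, Set.indicator_of_notMem hx,
      image_eq_zero_of_notMem_tsupport fun h => hx (hs h)]

variable [RiemannianBundle (fun x : M => TangentSpace (𝓡 n) x)]

theorem inner_riemannianGradient_ofChart {x₀ : M} {ψ : EuclideanSpace ℝ (Fin n) → ℝ}
    (hψ : ContDiff ℝ 1 ψ) {y : EuclideanSpace ℝ (Fin n)}
    (hy : y ∈ (chartAt (EuclideanSpace ℝ (Fin n)) x₀).target)
    (X : (x : M) → TangentSpace (𝓡 n) x) :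
    inner ℝ (riemannianGradient (ofChart x₀ ψ) ((chartAt (EuclideanSpace ℝ (Fin n)) x₀).symm y))
      (X ((chartAt (EuclideanSpace ℝ (Fin n)) x₀).symm y)) =
      fderiv ℝ ψ y (chartComponents X x₀ y) := by
  have : IsManifold (𝓡 n) 1 M := .of_le (n := ∞) (by norm_cast)
  set e := chartAt (EuclideanSpace ℝ (Fin n)) x₀ with he
  have hys : e.symm y ∈ e.source := e.map_target hy
  have h0 : MDifferentiableAt (𝓡 n) (𝓡 n) e (e.symm y) :=
    (mdifferentiable_chart (I := 𝓡 n) x₀).mdifferentiableAt hys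
  have h1 : MDifferentiableAt (𝓡 n) 𝓘(ℝ, ℝ) ψ (e (e.symm y)) :=
    (hψ.differentiable one_ne_zero _).mdifferentiableAt
  have hc := mfderiv_comp (e.symm y) h1 h0
  have heq : ofChart x₀ ψ =ᶠ[𝓝 (e.symm y)] ψ ∘ e := by
    filter_upwards [e.open_source.mem_nhds hys] with z hz
    rw [ofChart, Set.indicator_of_mem hz]
    rfl
  rw [inner_riemannianGradient, heq.mfderiv_eq, hc, mfderiv_eq_fderiv, e.right_inv hy]
  rfl

variable [IsContMDiffRiemannianBundle (𝓡 n) ∞ (EuclideanSpace ℝ (Fin n))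
      (fun x : M => TangentSpace (𝓡 n) x)] [MeasurableSpace M] [BorelSpace M]

theorem setIntegral_eq_of_tsupport {x₀ : M} (hΩ : IsOpen Ω) {ξ f : M → ℝ}
    (hs : tsupport ξ ⊆ (chartAt (EuclideanSpace ℝ (Fin n)) x₀).source)
    (hf : ∀ x ∉ tsupport ξ, f x = 0) :
    ∫ x in Ω, f x ∂(riemannianVolume n M) = ∫ y in chartRegion (n := n) Ω x₀,
      Real.sqrt (metricMatrix x₀ y).det *
        f ((chartAt (EuclideanSpace ℝ (Fin n)) x₀).symm y) := by
  rw [← setIntegral_inter_source hΩ x₀]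
  refine setIntegral_eq_of_subset_of_forall_sdiff_eq_zero hΩ.measurableSet
    Set.inter_subset_left fun x hx => hf x fun h => hx.2 ⟨hx.1, hs h⟩

theorem riemannianGradient_eq_zero_of_notMem_tsupport {ξ : M → ℝ} {x : M} (hx : x ∉ tsupport ξ) :
    riemannianGradient (n := n) ξ x = 0 := by
  have h : ξ =ᶠ[𝓝 x] fun _ => (0 : ℝ) := notMem_tsupport_iff_eventuallyEq.1 hx
  refine ext_inner_right ℝ fun X => ?_
  rw [inner_riemannianGradient, h.mfderiv_eq, mfderiv_const, inner_zero_left]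
  rfl

end ChartTestFunctions

section TruncatedGradient

variable {n : ℕ} {M : Type*} [TopologicalSpace M] [ChartedSpace (EuclideanSpace ℝ (Fin n)) M]
  [RiemannianBundle (fun x : M => TangentSpace (𝓡 n) x)]
  {Ω : Set M} {ρ : M → ℝ} {G : (x : M) → TangentSpace (𝓡 n) x}

theorem chartComponents_smul (c : M → ℝ) (G : (x : M) → TangentSpace (𝓡 n) x) (x₀ : M)
    (y : EuclideanSpace ℝ (Fin n)) :
    chartComponents (fun x => c x • G x) x₀ y =
      c ((chartAt (EuclideanSpace ℝ (Fin n)) x₀).symm y) • chartComponents G x₀ y :=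
  (chartCoframe x₀ y).map_smul _ _

theorem chartCovector_smul (c : M → ℝ) (G : (x : M) → TangentSpace (𝓡 n) x) (x₀ : M)
    (y : EuclideanSpace ℝ (Fin n)) :
    chartCovector (fun x => c x • G x) x₀ y =
      c ((chartAt (EuclideanSpace ℝ (Fin n)) x₀).symm y) • chartCovector G x₀ y := by
  ext i
  exact real_inner_smul_left _ _ _

theorem eventually_inv_lt_and_lt {r : ℝ} (hr : 0 < r) :
    ∀ᶠ k : ℕ in atTop, ((k : ℝ) + 2)⁻¹ < r ∧ r < (k : ℝ) + 2 := by
  have h1 : Tendsto (fun k : ℕ => (k : ℝ) + 2) atTop atTop :=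
    tendsto_atTop_add_const_right _ _ tendsto_natCast_atTop_atTop
  exact (h1.inv_tendsto_atTop.eventually_lt_const hr).and (h1.eventually_gt_atTop r)

theorem inv_natCast_add_two_pos_and_lt (k : ℕ) :
    0 < ((k : ℝ) + 2)⁻¹ ∧ ((k : ℝ) + 2)⁻¹ < (k : ℝ) + 2 := by
  have : (0 : ℝ) ≤ k := k.cast_nonneg
  have h1 : ((k : ℝ) + 2)⁻¹ ≤ 1 := inv_le_one_of_one_le₀ (by linarith)
  exact ⟨by positivity, by linarith⟩

variable [IsManifold (𝓡 n) ∞ M] [IsContMDiffRiemannianBundle (𝓡 n) ∞ (EuclideanSpace ℝ (Fin n))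
      (fun x : M => TangentSpace (𝓡 n) x)] [MeasurableSpace M] [BorelSpace M]
  [SecondCountableTopology M]

theorem HasTruncatedGradientOn.aemeasurable_chartCovector (h : HasTruncatedGradientOn Ω ρ G)
    (hΩ : IsOpen Ω) (hρ : ∀ x ∈ Ω, 0 < ρ x) (x₀ : M) :
    AEMeasurable (chartCovector G x₀) (volume.restrict (chartRegion (n := n) Ω x₀)) := by
  refine aemeasurable_of_tendsto_metrizable_ae atTop (fun k : ℕ =>
    (h _ _ (inv_natCast_add_two_pos_and_lt k).1
      (inv_natCast_add_two_pos_and_lt k).2).aemeasurable_chartCovector x₀) ?_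
  filter_upwards [ae_restrict_mem (isOpen_chartRegion hΩ x₀).measurableSet] with y hy
  refine tendsto_const_nhds.congr' ((eventually_inv_lt_and_lt (hρ _ hy.2)).mono fun k hk => ?_)
  simp only
  rw [chartCovector_smul, Set.indicator_of_mem (show _ ∈ {z | ((k : ℝ) + 2)⁻¹ < ρ z ∧
    ρ z < (k : ℝ) + 2} from hk), one_smul]

theorem HasTruncatedGradientOn.aemeasurable_comp_chart_symm (h : HasTruncatedGradientOn Ω ρ G)
    (hΩ : IsOpen Ω) (hρ : ∀ x ∈ Ω, 0 < ρ x) (x₀ : M) :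
    AEMeasurable (fun y => ρ ((chartAt (EuclideanSpace ℝ (Fin n)) x₀).symm y))
      (volume.restrict (chartRegion (n := n) Ω x₀)) := by
  refine aemeasurable_of_tendsto_metrizable_ae atTop (fun k : ℕ =>
    (h _ _ (inv_natCast_add_two_pos_and_lt k).1
      (inv_natCast_add_two_pos_and_lt k).2 x₀).1.aestronglyMeasurable.aemeasurable) ?_
  filter_upwards [ae_restrict_mem (isOpen_chartRegion hΩ x₀).measurableSet] with y hy
  refine tendsto_const_nhds.congr' ((eventually_inv_lt_and_lt (hρ _ hy.2)).mono fun k hk => ?_)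
  simp only
  rw [min_eq_left hk.2.le, max_eq_right hk.1.le]

/-- The weak derivative of the truncations in an arbitrary direction of a chart. -/
theorem HasTruncatedGradientOn.integral_truncation_mul_fderiv (h : HasTruncatedGradientOn Ω ρ G)
    (x₀ : M) {a b : ℝ} (ha : 0 < a) (hab : a < b) (v : EuclideanSpace ℝ (Fin n))
    {ψ : EuclideanSpace ℝ (Fin n) → ℝ} (hψ : ContDiff ℝ ∞ ψ) (hψc : HasCompactSupport ψ)
    (hψU : tsupport ψ ⊆ chartRegion Ω x₀) :
    let r := fun y => ρ ((chartAt (EuclideanSpace ℝ (Fin n)) x₀).symm y)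
    ∫ y in chartRegion Ω x₀, max a (min (r y) b) * fderiv ℝ ψ y v =
      -∫ y in chartRegion Ω x₀, {y | a < r y ∧ r y < b}.indicator
        (fun y => innerSL ℝ (chartCovector G x₀ y) v) y * ψ y := by
  intro r
  set e := chartAt (EuclideanSpace ℝ (Fin n)) x₀ with he
  set L := {z : M | a < ρ z ∧ ρ z < b}
  set g := fun x => L.indicator (fun _ => (1 : ℝ)) x • G x with hg
  obtain ⟨h0, h1⟩ := h a b ha hab x₀
  have hDc : ∀ w, Continuous fun y => fderiv ℝ ψ y w := fun w =>
    (hψ.continuous_fderiv (by simp)).clm_apply continuous_const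
  have hDs : ∀ w, tsupport (fun y => fderiv ℝ ψ y w) ⊆ tsupport ψ := fun w =>
    tsupport_fderiv_apply_subset ℝ w
  have hDcs : ∀ w, HasCompactSupport fun y => fderiv ℝ ψ y w := fun w =>
    hψc.of_isClosed_subset (isClosed_tsupport _) (hDs w)
  have hsum : ∀ (A : EuclideanSpace ℝ (Fin n) →L[ℝ] ℝ),
      A v = ∑ i, v i * A (EuclideanSpace.single i 1) := by
    intro A
    conv_lhs => rw [← (EuclideanSpace.basisFun (Fin n) ℝ).sum_repr v]
    simp
  have hz : ∀ y ∉ chartRegion (n := n) Ω x₀, ψ y = 0 ∧ fderiv ℝ ψ y = 0 := fun y hy =>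
    ⟨image_eq_zero_of_notMem_tsupport fun h => hy (hψU h),
      by_contra fun hne => hy (hψU (support_fderiv_subset ℝ hne))⟩
  rw [setIntegral_eq_integral_of_forall_compl_eq_zero
      (fun y hy => by rw [(hz y hy).2]; simp),
    setIntegral_eq_integral_of_forall_compl_eq_zero
      (fun y hy => by rw [(hz y hy).1, mul_zero])]
  have e1 : ∀ y, max a (min (r y) b) * fderiv ℝ ψ y v = ∑ i, v i *
      (max a (min (r y) b) * fderiv ℝ ψ y (EuclideanSpace.single i 1)) := fun y => by
    rw [hsum, Finset.mul_sum]
    exact Finset.sum_congr rfl fun i _ => by ring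
  have e2 : ∀ y, {y | a < r y ∧ r y < b}.indicator
        (fun y => innerSL ℝ (chartCovector G x₀ y) v) y * ψ y =
      ∑ i, v i * (inner ℝ (g (e.symm y)) (coordVector x₀ y i) * ψ y) := fun y => by
    have h2 : {y | a < r y ∧ r y < b}.indicator
        (fun y => innerSL ℝ (chartCovector G x₀ y) v) y =
        innerSL ℝ (chartCovector g x₀ y) v := by
      rw [hg, chartCovector_smul]
      by_cases hy : e.symm y ∈ L
      · rw [Set.indicator_of_mem (show y ∈ {y | a < r y ∧ r y < b} from hy),
          Set.indicator_of_mem hy, one_smul]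
      · rw [Set.indicator_of_notMem (show y ∉ {y | a < r y ∧ r y < b} from hy),
          Set.indicator_of_notMem hy, zero_smul]
        simp
    rw [h2, hsum, Finset.sum_mul]
    refine Finset.sum_congr rfl fun i _ => ?_
    have h3 : innerSL ℝ (chartCovector g x₀ y) (EuclideanSpace.single i 1) =
        inner ℝ (g (e.symm y)) (coordVector x₀ y i) := by
      rw [innerSL_apply_apply, EuclideanSpace.inner_single_right]
      simp [chartCovector, e]
    rw [h3, mul_assoc]
  simp only [e1, e2]
  rw [integral_finsetSum _ fun i _ => ((integrable_mul_of_locallyIntegrableOn h0 (hDc _) (hDcs _)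
      ((hDs _).trans hψU)).const_mul _),
    integral_finsetSum _ fun i _ => ((integrable_mul_of_locallyIntegrableOn (h1 i).1
      hψ.continuous hψc hψU).const_mul _), ← Finset.sum_neg_distrib]
  refine Finset.sum_congr rfl fun i _ => ?_
  rw [integral_const_mul, integral_const_mul, (h1 i).2 ψ hψ hψc hψU, mul_neg]

theorem HasTruncatedGradientOn.aemeasurable (h : HasTruncatedGradientOn Ω ρ G)
    (hΩ : IsOpen Ω) (hρ : ∀ x ∈ Ω, 0 < ρ x) :
    AEMeasurable ρ ((riemannianVolume n M).restrict Ω) :=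
  aemeasurable_restrict_of_chart hΩ fun x₀ => h.aemeasurable_comp_chart_symm hΩ hρ x₀

theorem HasTruncatedGradientOn.aemeasurable_norm (h : HasTruncatedGradientOn Ω ρ G)
    (hΩ : IsOpen Ω) (hρ : ∀ x ∈ Ω, 0 < ρ x) :
    AEMeasurable (fun x => ‖G x‖) ((riemannianVolume n M).restrict Ω) :=
  aemeasurable_restrict_of_chart hΩ fun x₀ =>
    aemeasurable_norm_of_chartCovector G x₀ (isOpen_chartRegion hΩ x₀).measurableSet
      (chartRegion_subset_target Ω x₀) (h.aemeasurable_chartCovector hΩ hρ x₀)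

end TruncatedGradient

section ChartBounds

theorem rpow_sub_two_mul_sq {p A : ℝ} (hp : p ≠ 0) (hA : 0 ≤ A) : A ^ (p - 2) * A ^ 2 = A ^ p := by
  rcases hA.eq_or_lt with rfl | hA
  · simp [Real.zero_rpow hp]
  · rw [← Real.rpow_natCast, ← Real.rpow_add hA]; norm_num

theorem rpow_sub_two_mul_self {p A : ℝ} (hp : p ≠ 1) (hA : 0 ≤ A) :
    A ^ (p - 2) * A = A ^ (p - 1) := by
  rcases hA.eq_or_lt with rfl | hA
  · rw [mul_zero, Real.zero_rpow (sub_ne_zero.2 hp)]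
  · rw [← Real.rpow_add_one hA.ne']; congr 1; ring

theorem div_rpow_eq_mul_rpow_neg (x : ℝ) {r s : ℝ} (hr : 0 ≤ r) : x / r ^ s = x * r ^ (-s) := by
  rw [Real.rpow_neg hr, div_eq_mul_inv]

theorem energy_rpow_one_div {p α D A r : ℝ} (hp : p ≠ 0) (hD : 0 ≤ D) (hA : 0 ≤ A) (hr : 0 < r) :
    (D * (A ^ p / r ^ (p - α))) ^ (1 / p) * r ^ (1 - α / p) = D ^ (1 / p) * A := by
  rw [Real.mul_rpow hD (by positivity), div_rpow_eq_mul_rpow_neg _ hr.le,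
    Real.mul_rpow (by positivity) (by positivity), ← Real.rpow_mul hA, ← Real.rpow_mul hr.le,
    mul_one_div_cancel hp, Real.rpow_one, mul_assoc, mul_assoc, ← Real.rpow_add hr,
    show -(p - α) * (1 / p) + (1 - α / p) = 0 by field_simp; ring, Real.rpow_zero, mul_one]

theorem energy_rpow_one_sub {p α D A r : ℝ} (hp : p ≠ 0) (hD : 0 ≤ D) (hA : 0 ≤ A) (hr : 0 < r) :
    (D * (A ^ p / r ^ (p - α))) ^ (1 - 1 / p) * r ^ (α / p) =
      D ^ (1 - 1 / p) * A ^ (p - 1) * r ^ (-p + 1 + α) := by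
  rw [Real.mul_rpow hD (by positivity), div_rpow_eq_mul_rpow_neg _ hr.le,
    Real.mul_rpow (by positivity) (by positivity), ← Real.rpow_mul hA, ← Real.rpow_mul hr.le,
    mul_assoc, mul_assoc, ← Real.rpow_add hr, mul_assoc,
    show p * (1 - 1 / p) = p - 1 by field_simp,
    show -(p - α) * (1 - 1 / p) + α / p = -p + 1 + α by field_simp; ring]

variable {n : ℕ} {M : Type*} [TopologicalSpace M] [ChartedSpace (EuclideanSpace ℝ (Fin n)) M]
  [RiemannianBundle (fun x : M => TangentSpace (𝓡 n) x)]
  [IsManifold (𝓡 n) ∞ M] [IsContMDiffRiemannianBundle (𝓡 n) ∞ (EuclideanSpace ℝ (Fin n))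
      (fun x : M => TangentSpace (𝓡 n) x)]
  {Ω : Set M} {ρ : M → ℝ}

/-- The bounds of the covector `∇ρ` and of the flux `|∇ρ|^{p-2} ∇ρ ρ^{-p+1+α}` in terms of the
energy density, in a chart. -/
theorem exists_bound_flux {p α γ : ℝ} (hp : 1 < p) (hρ : ∀ x ∈ Ω, 0 < ρ x)
    (G : (x : M) → TangentSpace (𝓡 n) x) (x₀ : M) {W : Set (EuclideanSpace ℝ (Fin n))}
    (hWU : W ⊆ chartRegion Ω x₀) (hW : IsCompact W) :
    let r := fun y => ρ ((chartAt (EuclideanSpace ℝ (Fin n)) x₀).symm y)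
    let A := fun y => ‖G ((chartAt (EuclideanSpace ℝ (Fin n)) x₀).symm y)‖
    let D := fun y => Real.sqrt (metricMatrix x₀ y).det
    ∃ C : ℝ, 0 ≤ C ∧ ∀ y ∈ W,
      ‖innerSL ℝ (chartCovector G x₀ y)‖ ≤
        C * (D y * (A y ^ p / r y ^ (p - α))) ^ (1 / p) * r y ^ (1 - α / p) ∧
      ‖(D y * (A y ^ (p - 2) * r y ^ (-p + 1 + α)) / γ) • chartComponents G x₀ y‖ ≤
        C * (D y * (A y ^ p / r y ^ (p - α))) ^ (1 - 1 / p) * r y ^ (α / p) := by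
  intro r A D
  have hp0 : p ≠ 0 := by linarith
  have hWt := hWU.trans (chartRegion_subset_target Ω x₀)
  obtain ⟨c, hc, hcb⟩ := exists_bound_chartCovector_chartComponents x₀ hW hWt
  have hDc : ContinuousOn D W := (continuousOn_sqrt_det_metricMatrix x₀).mono hWt
  have hD0 : ∀ y ∈ W, 0 < D y := fun y hy => Real.sqrt_pos.2 (det_metricMatrix_pos (hWt hy))
  obtain ⟨C₁, hC₁⟩ := hW.exists_bound_of_continuousOn
    (hDc.rpow_const (p := -(1 / p)) fun y hy => Or.inl (hD0 y hy).ne')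
  obtain ⟨C₂, hC₂⟩ := hW.exists_bound_of_continuousOn
    (hDc.rpow_const (p := 1 / p) fun y hy => Or.inl (hD0 y hy).ne')
  refine ⟨c * |C₁| + |γ|⁻¹ * c * |C₂|, by positivity, fun y hy => ?_⟩
  have hr : 0 < r y := hρ _ (hWU hy).2
  have hA : 0 ≤ A y := norm_nonneg _
  have hD := hD0 y hy
  obtain ⟨b1, b2⟩ := hcb y hy G
  have hD1 := Real.rpow_pos_of_pos hD (1 / p)
  have hD2 := Real.rpow_pos_of_pos hD (1 - 1 / p)
  constructor
  · rw [innerSL_apply_norm, mul_assoc, energy_rpow_one_div hp0 hD.le hA hr]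
    have h1 : 1 ≤ |C₁| * D y ^ (1 / p) := by
      have h2 : D y ^ (-(1 / p)) * D y ^ (1 / p) = 1 := by rw [← Real.rpow_add hD]; simp
      exact h2.symm.trans_le (mul_le_mul_of_nonneg_right
        (((le_abs_self _).trans (hC₁ y hy)).trans (le_abs_self _)) hD1.le)
    calc ‖chartCovector G x₀ y‖ ≤ c * A y * 1 := by rw [mul_one]; exact b1
      _ ≤ c * A y * (|C₁| * D y ^ (1 / p)) := by gcongr
      _ = c * |C₁| * (D y ^ (1 / p) * A y) := by ring
      _ ≤ _ := by
          gcongr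
          exact le_add_of_nonneg_right (by positivity)
  · rw [mul_assoc (c * |C₁| + |γ|⁻¹ * c * |C₂|), energy_rpow_one_sub hp0 hD.le hA hr]
    have hg : 0 ≤ D y * (A y ^ (p - 2) * r y ^ (-p + 1 + α)) := by positivity
    rw [norm_smul, norm_div, Real.norm_of_nonneg hg, Real.norm_eq_abs]
    have h1 : D y ≤ |C₂| * D y ^ (1 - 1 / p) := by
      have h2 : D y ^ (1 / p) * D y ^ (1 - 1 / p) = D y := by
        rw [← Real.rpow_add hD]; simp
      conv_lhs => rw [← h2]
      exact mul_le_mul_of_nonneg_right (((le_abs_self _).trans (hC₂ y hy)).trans (le_abs_self _))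
        hD2.le
    have h3 : A y ^ (p - 2) * A y = A y ^ (p - 1) := rpow_sub_two_mul_self hp.ne' hA
    calc D y * (A y ^ (p - 2) * r y ^ (-p + 1 + α)) / |γ| * ‖chartComponents G x₀ y‖
        ≤ D y * (A y ^ (p - 2) * r y ^ (-p + 1 + α)) / |γ| * (c * A y) := by gcongr
      _ = |γ|⁻¹ * c * D y * ((A y ^ (p - 2) * A y) * r y ^ (-p + 1 + α)) := by ring
      _ ≤ |γ|⁻¹ * c * (|C₂| * D y ^ (1 - 1 / p)) *
          ((A y ^ (p - 2) * A y) * r y ^ (-p + 1 + α)) := by gcongr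
      _ = |γ|⁻¹ * c * |C₂| * (D y ^ (1 - 1 / p) * A y ^ (p - 1) * r y ^ (-p + 1 + α)) := by
          rw [h3]; ring
      _ ≤ _ := by
          gcongr
          exact le_add_of_nonneg_left (by positivity)

end ChartBounds

section ChartDoubling

variable {n : ℕ} {M : Type*} [TopologicalSpace M] [T2Space M]
  [ChartedSpace (EuclideanSpace ℝ (Fin n)) M]
  [RiemannianBundle (fun x : M => TangentSpace (𝓡 n) x)]
  [IsManifold (𝓡 n) ∞ M] [IsContMDiffRiemannianBundle (𝓡 n) ∞ (EuclideanSpace ℝ (Fin n))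
      (fun x : M => TangentSpace (𝓡 n) x)] [MeasurableSpace M] [BorelSpace M]
  {Ω : Set M}

theorem tsupport_ofChart_subset_source {x₀ : M} {ψ : EuclideanSpace ℝ (Fin n) → ℝ}
    (hc : HasCompactSupport ψ) (hU : tsupport ψ ⊆ chartRegion Ω x₀) :
    tsupport (ofChart x₀ ψ) ⊆ (chartAt (EuclideanSpace ℝ (Fin n)) x₀).source := by
  refine (tsupport_ofChart_subset x₀ hc (hU.trans (chartRegion_subset_target Ω x₀))).2.trans ?_
  rintro _ ⟨y, hy, rfl⟩
  exact (chartAt (EuclideanSpace ℝ (Fin n)) x₀).map_target (hU hy).1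

theorem setIntegral_inner_riemannianGradient_ofChart (hΩ : IsOpen Ω) {x₀ : M}
    {ψ : EuclideanSpace ℝ (Fin n) → ℝ} (hψ : ContDiff ℝ 1 ψ) (hc : HasCompactSupport ψ)
    (hU : tsupport ψ ⊆ chartRegion Ω x₀) (X : (x : M) → TangentSpace (𝓡 n) x) (w : M → ℝ) :
    ∫ x in Ω, inner ℝ (riemannianGradient (ofChart x₀ ψ) x) (X x) * w x ∂(riemannianVolume n M) =
      ∫ y in chartRegion (n := n) Ω x₀, Real.sqrt (metricMatrix x₀ y).det *
        (fderiv ℝ ψ y (chartComponents X x₀ y) *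
          w ((chartAt (EuclideanSpace ℝ (Fin n)) x₀).symm y)) := by
  rw [setIntegral_eq_of_tsupport hΩ (tsupport_ofChart_subset_source hc hU) fun x hx => by
    rw [riemannianGradient_eq_zero_of_notMem_tsupport hx, inner_zero_left, zero_mul]]
  refine setIntegral_congr_fun (isOpen_chartRegion hΩ x₀).measurableSet fun y hy => ?_
  rw [inner_riemannianGradient_ofChart hψ hy.1]

theorem integrableOn_inner_riemannianGradient_ofChart (hΩ : IsOpen Ω) {x₀ : M}
    {ψ : EuclideanSpace ℝ (Fin n) → ℝ} (hψ : ContDiff ℝ 1 ψ)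
    {X : (x : M) → TangentSpace (𝓡 n) x} {w : M → ℝ}
    (h : IntegrableOn (fun x => inner ℝ (riemannianGradient (ofChart x₀ ψ) x) (X x) * w x) Ω
      (riemannianVolume n M)) :
    IntegrableOn (fun y => Real.sqrt (metricMatrix x₀ y).det *
        (fderiv ℝ ψ y (chartComponents X x₀ y) *
          w ((chartAt (EuclideanSpace ℝ (Fin n)) x₀).symm y))) (chartRegion (n := n) Ω x₀) := by
  refine ((integrableOn_inter_source_iff hΩ x₀).1 (h.mono_set Set.inter_subset_left)).congr_fun
    (fun y hy => ?_) (isOpen_chartRegion hΩ x₀).measurableSet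
  simp only
  rw [inner_riemannianGradient_ofChart hψ hy.1]

theorem setIntegral_mul_ofChart (hΩ : IsOpen Ω) {x₀ : M}
    {ψ : EuclideanSpace ℝ (Fin n) → ℝ} (hc : HasCompactSupport ψ)
    (hU : tsupport ψ ⊆ chartRegion Ω x₀) (f : M → ℝ) :
    ∫ x in Ω, f x * ofChart x₀ ψ x ∂(riemannianVolume n M) =
      ∫ y in chartRegion (n := n) Ω x₀, Real.sqrt (metricMatrix x₀ y).det *
        f ((chartAt (EuclideanSpace ℝ (Fin n)) x₀).symm y) * ψ y := by
  rw [setIntegral_eq_of_tsupport hΩ (tsupport_ofChart_subset_source hc hU) fun x hx => by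
    rw [image_eq_zero_of_notMem_tsupport hx, mul_zero]]
  refine setIntegral_congr_fun (isOpen_chartRegion hΩ x₀).measurableSet fun y hy => ?_
  rw [ofChart_chart_symm ψ hy.1, mul_assoc]

theorem integrableOn_mul_ofChart (hΩ : IsOpen Ω) {x₀ : M}
    {ψ : EuclideanSpace ℝ (Fin n) → ℝ} {f : M → ℝ}
    (h : IntegrableOn (fun x => f x * ofChart x₀ ψ x) Ω (riemannianVolume n M)) :
    IntegrableOn (fun y => Real.sqrt (metricMatrix x₀ y).det *
        f ((chartAt (EuclideanSpace ℝ (Fin n)) x₀).symm y) * ψ y) (chartRegion (n := n) Ω x₀) := by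
  refine ((integrableOn_inter_source_iff hΩ x₀).1 (h.mono_set Set.inter_subset_left)).congr_fun
    (fun y hy => ?_) (isOpen_chartRegion hΩ x₀).measurableSet
  simp only
  rw [ofChart_chart_symm ψ hy.1, mul_assoc]

variable [SecondCountableTopology M] {ρ : M → ℝ} {Dρ : (x : M) → TangentSpace (𝓡 n) x}
  {p α β : ℝ}

/-- The two differential inequalities for `ρ` improve the first one by the factor `2`, for test
functions supported in a chart. -/
theorem two_mul_setIntegral_le_of_tsupport_subset_source (hp : 1 < p) (hβ : p - 1 + β ≠ 0)
    (hΩ : IsOpen Ω) (hρ : ∀ x ∈ Ω, 0 < ρ x) (hDρ : HasTruncatedGradientOn Ω ρ Dρ)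
    (henergy : ∀ ξ : M → ℝ, IsTestFunction n Ω ξ → (∀ x, 0 ≤ ξ x) →
      IntegrableOn (fun x => ‖Dρ x‖ ^ p / ρ x ^ (p - α) * ξ x) Ω (riemannianVolume n M))
    (hflux : ∀ ξ : M → ℝ, IsTestFunction n Ω ξ → (∀ x, 0 ≤ ξ x) →
      IntegrableOn (fun x => inner ℝ (riemannianGradient ξ x) (‖Dρ x‖ ^ (p - 2) • Dρ x)
        * ρ x ^ (-p + 1 + α)) Ω (riemannianVolume n M))
    (hweight : ∀ ξ : M → ℝ, IsTestFunction n Ω ξ → (∀ x, 0 ≤ ξ x) →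
      IntegrableOn (fun x => inner ℝ (riemannianGradient ξ x) (‖Dρ x‖ ^ (p - 2) • Dρ x)
          * ρ x ^ (α + β)) Ω (riemannianVolume n M) ∧
        IntegrableOn (fun x => ‖Dρ x‖ ^ p / ρ x * ρ x ^ (α + β) * ξ x) Ω
          (riemannianVolume n M) ∧
        ∫ x in Ω, ‖Dρ x‖ ^ p / ρ x * ρ x ^ (α + β) * ξ x ∂(riemannianVolume n M) ≤
          1 / (p - 1 + β) *
            ∫ x in Ω, inner ℝ (riemannianGradient ξ x) (‖Dρ x‖ ^ (p - 2) • Dρ x)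
              * ρ x ^ (α + β) ∂(riemannianVolume n M))
    {ξ : M → ℝ} (hξ : IsTestFunction n Ω ξ) (hξ0 : ∀ x, 0 ≤ ξ x) {x₀ : M}
    (hs : tsupport ξ ⊆ (chartAt (EuclideanSpace ℝ (Fin n)) x₀).source) :
    2 * ∫ x in Ω, ‖Dρ x‖ ^ p / ρ x ^ (p - α) * ξ x ∂(riemannianVolume n M) ≤
      1 / (p - 1 + β) *
        ∫ x in Ω, inner ℝ (riemannianGradient ξ x) (‖Dρ x‖ ^ (p - 2) • Dρ x)
          * ρ x ^ (-p + 1 + α) ∂(riemannianVolume n M) := by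
  have hp0 : p ≠ 0 := by linarith
  set γ := p - 1 + β with hγ
  set e := chartAt (EuclideanSpace ℝ (Fin n)) x₀ with he
  set U := chartRegion (n := n) Ω x₀ with hU
  have hUo : IsOpen U := isOpen_chartRegion hΩ x₀
  set r := fun y => ρ (e.symm y) with hr
  set A := fun y => ‖Dρ (e.symm y)‖ with hA
  set D := fun y : EuclideanSpace ℝ (Fin n) => Real.sqrt (metricMatrix x₀ y).det with hD
  set G := chartComponents Dρ x₀ with hG
  have hr0 : ∀ y ∈ U, 0 < r y := fun y hy => hρ _ hy.2
  have hA0 : ∀ y, 0 ≤ A y := fun y => norm_nonneg _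
  set en : EuclideanSpace ℝ (Fin n) → ℝ := fun y => D y * (A y ^ p / r y ^ (p - α)) with hen
  set b : EuclideanSpace ℝ (Fin n) → EuclideanSpace ℝ (Fin n) := fun y =>
    (D y * (A y ^ (p - 2) * r y ^ (-p + 1 + α)) / γ) • G y with hb
  -- the two fluxes
  have hcomp : ∀ y, chartComponents (fun x => ‖Dρ x‖ ^ (p - 2) • Dρ x) x₀ y =
      A y ^ (p - 2) • G y := fun y => chartComponents_smul _ _ _ _
  have hbψ : ∀ (ψ : EuclideanSpace ℝ (Fin n) → ℝ) (y), fderiv ℝ ψ y (b y) = 1 / γ * (D y *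
      (fderiv ℝ ψ y (chartComponents (fun x => ‖Dρ x‖ ^ (p - 2) • Dρ x) x₀ y) *
        ρ (e.symm y) ^ (-p + 1 + α))) := by
    intro ψ y
    rw [hcomp, map_smul, map_smul, smul_eq_mul, smul_eq_mul]
    ring
  have hsbψ : ∀ (ψ : EuclideanSpace ℝ (Fin n) → ℝ), ∀ y ∈ U,
      r y ^ γ * fderiv ℝ ψ y (b y) = 1 / γ * (D y *
      (fderiv ℝ ψ y (chartComponents (fun x => ‖Dρ x‖ ^ (p - 2) • Dρ x) x₀ y) *
        ρ (e.symm y) ^ (α + β))) := by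
    intro ψ y hy
    have h : r y ^ γ * r y ^ (-p + 1 + α) = r y ^ (α + β) := by
      rw [← Real.rpow_add (hr0 y hy)]; congr 1; rw [hγ]; ring
    rw [hbψ]
    change _ = 1 / γ * (D y * (_ * r y ^ (α + β)))
    rw [← h]
    ring
  have hsen : ∀ y ∈ U, r y ^ γ * en y =
      D y * (‖Dρ (e.symm y)‖ ^ p / ρ (e.symm y) * ρ (e.symm y) ^ (α + β)) := by
    intro y hy
    have h : r y ^ γ / r y ^ (p - α) = r y ^ (α + β) / r y := by
      rw [← Real.rpow_sub (hr0 y hy), ← Real.rpow_sub_one (hr0 y hy).ne']; congr 1; rw [hγ]; ring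
    calc r y ^ γ * en y = D y * (A y ^ p * (r y ^ γ / r y ^ (p - α))) := by rw [hen]; ring
      _ = _ := by rw [h, hA, hr]; ring
  -- measurability
  have hrm : AEMeasurable r (volume.restrict U) := hDρ.aemeasurable_comp_chart_symm hΩ hρ x₀
  have hcov := hDρ.aemeasurable_chartCovector hΩ hρ x₀
  have hAm : AEMeasurable A (volume.restrict U) := aemeasurable_norm_of_chartCovector Dρ x₀
    hUo.measurableSet (chartRegion_subset_target Ω x₀) hcov
  have hGm : AEMeasurable G (volume.restrict U) := aemeasurable_chartComponents Dρ x₀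
    hUo.measurableSet (chartRegion_subset_target Ω x₀) hcov
  have hDm : AEMeasurable D (volume.restrict U) := (aemeasurable_sqrt_det x₀).mono_measure
    (Measure.restrict_mono (chartRegion_subset_target Ω x₀) le_rfl)
  have hem : AEMeasurable en (volume.restrict U) :=
    hDm.mul ((hAm.pow_const p).div (hrm.pow_const (p - α)))
  have hbm : AEMeasurable b (volume.restrict U) :=
    ((hDm.mul ((hAm.pow_const (p - 2)).mul (hrm.pow_const (-p + 1 + α)))).div_const γ).smul hGm
  have hPm : AEMeasurable (fun y => innerSL ℝ (chartCovector Dρ x₀ y)) (volume.restrict U) :=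
    (innerSL ℝ).continuous.measurable.comp_aemeasurable hcov
  have hsm : AEMeasurable (fun y => r y ^ γ) (volume.restrict U) := hrm.pow_const γ
  -- local integrability
  have test : ∀ ψ : EuclideanSpace ℝ (Fin n) → ℝ, ContDiff ℝ ∞ ψ → HasCompactSupport ψ →
      tsupport ψ ⊆ U → IsTestFunction n Ω (ofChart x₀ ψ) := fun ψ h1 h2 h3 =>
    isTestFunction_ofChart x₀ (h1.of_le (by norm_cast)) h2 h3
  have hei : LocallyIntegrableOn en U := locallyIntegrableOn_of_forall_integrableOn_mul hUo
    fun ψ h1 h2 h3 h4 => integrableOn_mul_ofChart hΩ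
      (henergy _ (test ψ h1 h2 h3) (ofChart_nonneg x₀ h4))
  have hbi : LocallyIntegrableOn b U := by
    refine locallyIntegrableOn_of_forall_integrableOn_fderiv hUo hbm fun ψ h1 h2 h3 h4 => ?_
    refine ((integrableOn_inner_riemannianGradient_ofChart hΩ (h1.of_le (by norm_cast))
      (hflux _ (test ψ h1 h2 h3) (ofChart_nonneg x₀ h4))).const_mul (1 / γ)).congr
        (ae_of_all _ fun y => ?_)
    exact (hbψ ψ y).symm
  have hsei : LocallyIntegrableOn (fun y => r y ^ γ * en y) U := by
    refine locallyIntegrableOn_of_forall_integrableOn_mul hUo fun ψ h1 h2 h3 h4 => ?_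
    refine (integrableOn_mul_ofChart hΩ
      (hweight _ (test ψ h1 h2 h3) (ofChart_nonneg x₀ h4)).2.1).congr_fun
        (fun y hy => ?_) hUo.measurableSet
    simp only
    rw [hsen y hy]
  have hsbi : LocallyIntegrableOn (fun y => r y ^ γ • b y) U := by
    refine locallyIntegrableOn_of_forall_integrableOn_fderiv hUo (hsm.smul hbm)
      fun ψ h1 h2 h3 h4 => ?_
    refine ((integrableOn_inner_riemannianGradient_ofChart hΩ (h1.of_le (by norm_cast))
      (hweight _ (test ψ h1 h2 h3) (ofChart_nonneg x₀ h4)).1).const_mul (1 / γ)).congr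
        ((ae_restrict_mem hUo.measurableSet).mono fun y hy => ?_)
    simp only
    rw [map_smul, smul_eq_mul, hsbψ ψ y hy]
  obtain ⟨hζ, hζc, hζU⟩ := hξ.inChart hs
  have hζ0 : ∀ y, 0 ≤ inChart (n := n) x₀ ξ y := fun y =>
    Set.indicator_nonneg (fun _ _ => hξ0 _) y
  have hmain := two_mul_setIntegral_le (α := α) hp hβ hUo hrm hr0 hPm hbm hem
    (fun y hy => mul_nonneg (Real.sqrt_nonneg _)
      (div_nonneg (Real.rpow_nonneg (hA0 y) _) (Real.rpow_nonneg (hr0 y hy).le _)))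
    (fun a c ha hac v ψ h1 h2 h3 => hDρ.integral_truncation_mul_fderiv x₀ ha hac v h1 h2 h3)
    hei hbi hsei hsbi (fun W hWU hW => exists_bound_flux hp hρ Dρ x₀ hWU hW)
    (fun y hy => ?_) (fun ψ h1 h2 h3 h4 => ?_) hζ hζc hζU hζ0
  · rw [← ofChart_inChart hs, setIntegral_mul_ofChart hΩ hζc hζU,
      setIntegral_inner_riemannianGradient_ofChart hΩ hζ hζc hζU, ← integral_const_mul (1 / γ)]
    refine hmain.trans_eq (integral_congr_ae (ae_of_all _ fun y => hbψ _ y))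
  · have h1 : innerSL ℝ (chartCovector Dρ x₀ y) (G y) = A y ^ 2 := by
      rw [innerSL_apply_apply]
      exact (norm_sq_eq_inner_chartCovector Dρ hy.1).symm
    have h2 : r y ^ (-p + 1 + α) = r y / r y ^ (p - α) := by
      rw [div_rpow_eq_mul_rpow_neg _ (hr0 y hy).le, mul_comm, ← Real.rpow_add_one (hr0 y hy).ne']
      congr 1; ring
    simp only [hb, hen]
    rw [map_smul, h1, smul_eq_mul, h2, ← rpow_sub_two_mul_sq hp0 (hA0 y)]
    ring
  · have hw := (hweight _ (test ψ h1 h2 h3) (ofChart_nonneg x₀ h4)).2.2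
    rw [setIntegral_mul_ofChart hΩ h2 h3, setIntegral_inner_riemannianGradient_ofChart hΩ
      (h1.of_le (by norm_cast)) h2 h3, ← integral_const_mul (1 / γ)] at hw
    refine (le_of_eq ?_).trans (hw.trans_eq ?_)
    · refine setIntegral_congr_fun hUo.measurableSet fun y hy => ?_
      rw [hsen y hy]
    · refine setIntegral_congr_fun hUo.measurableSet fun y hy => ?_
      exact (hsbψ ψ y hy).symm

end ChartDoubling

section Doubling

theorem IsTestFunction.zero {n : ℕ} {M : Type*} [TopologicalSpace M]
    [ChartedSpace (EuclideanSpace ℝ (Fin n)) M] {Ω : Set M} :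
    IsTestFunction n Ω (0 : M → ℝ) := by
  refine ⟨contMDiff_const, HasCompactSupport.zero, ?_⟩
  rw [tsupport_eq_empty_iff.2 rfl]
  exact Set.empty_subset _

theorem IsTestFunction.add {n : ℕ} {M : Type*} [TopologicalSpace M]
    [ChartedSpace (EuclideanSpace ℝ (Fin n)) M] {Ω : Set M} {ξ η : M → ℝ}
    (hξ : IsTestFunction n Ω ξ) (hη : IsTestFunction n Ω η) : IsTestFunction n Ω (ξ + η) :=
  ⟨hξ.contMDiff.add hη.contMDiff, hξ.hasCompactSupport.add hη.hasCompactSupport,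
    (tsupport_add ξ η).trans (Set.union_subset hξ.tsupport_subset hη.tsupport_subset)⟩

variable {n : ℕ} {M : Type*} [TopologicalSpace M] [T2Space M] [SecondCountableTopology M]
  [ChartedSpace (EuclideanSpace ℝ (Fin n)) M] [IsManifold (𝓡 n) ∞ M] {Ω : Set M}

theorem IsTestFunction.induction_on_charts {Q : (M → ℝ) → Prop}
    (hchart : ∀ ξ : M → ℝ, IsTestFunction n Ω ξ → (∀ x, 0 ≤ ξ x) → ∀ x₀ : M,
      tsupport ξ ⊆ (chartAt (EuclideanSpace ℝ (Fin n)) x₀).source → Q ξ)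
    (hzero : Q 0)
    (hadd : ∀ ξ η : M → ℝ, IsTestFunction n Ω ξ → (∀ x, 0 ≤ ξ x) → IsTestFunction n Ω η →
      (∀ x, 0 ≤ η x) → Q ξ → Q η → Q (ξ + η))
    {ξ : M → ℝ} (hξ : IsTestFunction n Ω ξ) (hξ0 : ∀ x, 0 ≤ ξ x) : Q ξ := by
  have : LocallyCompactSpace M := ChartedSpace.locallyCompactSpace (EuclideanSpace ℝ (Fin n)) M
  obtain ⟨f, hf⟩ := SmoothPartitionOfUnity.exists_isSubordinate_chartAt_source (𝓡 n) M
  have hfin := f.locallyFinite.finite_nonempty_inter_compact hξ.hasCompactSupport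
  have hξsum : ξ = ∑ i ∈ hfin.toFinset, fun x => f i x * ξ x := by
    ext x
    rw [Finset.sum_apply, ← Finset.sum_mul]
    by_cases hx : ξ x = 0
    · rw [hx, mul_zero]
    · have h1 := f.sum_eq_one (Set.mem_univ x)
      rw [finsum_eq_sum_of_support_subset (s := hfin.toFinset) _ fun i hi => by
        simpa using ⟨x, hi, subset_closure hx⟩] at h1
      rw [h1, one_mul]
  have htest : ∀ i, IsTestFunction n Ω fun x => f i x * ξ x := fun i =>
    ⟨((f i).contMDiff.of_le (by norm_cast)).mul hξ.contMDiff, hξ.hasCompactSupport.mul_left,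
      (tsupport_mul_subset_right (f := f i) (g := ξ)).trans hξ.tsupport_subset⟩
  have h0 : ∀ i x, 0 ≤ f i x * ξ x := fun i x => mul_nonneg (f.nonneg i x) (hξ0 x)
  have key := Finset.sum_induction (s := hfin.toFinset) (fun i x => f i x * ξ x)
    (fun η : M → ℝ => IsTestFunction n Ω η ∧ (∀ x, 0 ≤ η x) ∧ Q η)
    (fun a b ha hb => ⟨ha.1.add hb.1, fun x => add_nonneg (ha.2.1 x) (hb.2.1 x),
      hadd a b ha.1 ha.2.1 hb.1 hb.2.1 ha.2.2 hb.2.2⟩)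
    ⟨IsTestFunction.zero, fun _ => le_rfl, hzero⟩
    (fun i _ => ⟨htest i, h0 i, hchart _ (htest i) (h0 i) i
      ((tsupport_mul_subset_left (f := f i) (g := ξ)).trans (hf i))⟩)
  rw [hξsum]
  exact key.2.2

variable [RiemannianBundle (fun x : M => TangentSpace (𝓡 n) x)]

theorem inner_riemannianGradient_add {ξ η : M → ℝ} (hξ : IsTestFunction n Ω ξ)
    (hη : IsTestFunction n Ω η) (x : M) (X : TangentSpace (𝓡 n) x) :
    inner ℝ (riemannianGradient (ξ + η) x) X =
      inner ℝ (riemannianGradient ξ x) X + inner ℝ (riemannianGradient η x) X := by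
  rw [inner_riemannianGradient, inner_riemannianGradient, inner_riemannianGradient,
    mfderiv_add (hξ.contMDiff.mdifferentiable one_ne_zero x)
      (hη.contMDiff.mdifferentiable one_ne_zero x)]
  rfl

variable [IsContMDiffRiemannianBundle (𝓡 n) ∞ (EuclideanSpace ℝ (Fin n))
      (fun x : M => TangentSpace (𝓡 n) x)] [MeasurableSpace M] [BorelSpace M]
  {ρ : M → ℝ} {Dρ : (x : M) → TangentSpace (𝓡 n) x} {p α β : ℝ}

/-- The two differential inequalities for `ρ` improve the first one by the factor `2`. -/
theorem two_mul_setIntegral_le_of_supersolution (hp : 1 < p) (hβ : p - 1 + β ≠ 0)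
    (hΩ : IsOpen Ω) (hρ : ∀ x ∈ Ω, 0 < ρ x) (hDρ : HasTruncatedGradientOn Ω ρ Dρ)
    (henergy : ∀ ξ : M → ℝ, IsTestFunction n Ω ξ → (∀ x, 0 ≤ ξ x) →
      IntegrableOn (fun x => ‖Dρ x‖ ^ p / ρ x ^ (p - α) * ξ x) Ω (riemannianVolume n M))
    (hflux : ∀ ξ : M → ℝ, IsTestFunction n Ω ξ → (∀ x, 0 ≤ ξ x) →
      IntegrableOn (fun x => inner ℝ (riemannianGradient ξ x) (‖Dρ x‖ ^ (p - 2) • Dρ x)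
        * ρ x ^ (-p + 1 + α)) Ω (riemannianVolume n M))
    (hweight : ∀ ξ : M → ℝ, IsTestFunction n Ω ξ → (∀ x, 0 ≤ ξ x) →
      IntegrableOn (fun x => inner ℝ (riemannianGradient ξ x) (‖Dρ x‖ ^ (p - 2) • Dρ x)
          * ρ x ^ (α + β)) Ω (riemannianVolume n M) ∧
        IntegrableOn (fun x => ‖Dρ x‖ ^ p / ρ x * ρ x ^ (α + β) * ξ x) Ω
          (riemannianVolume n M) ∧
        ∫ x in Ω, ‖Dρ x‖ ^ p / ρ x * ρ x ^ (α + β) * ξ x ∂(riemannianVolume n M) ≤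
          1 / (p - 1 + β) *
            ∫ x in Ω, inner ℝ (riemannianGradient ξ x) (‖Dρ x‖ ^ (p - 2) • Dρ x)
              * ρ x ^ (α + β) ∂(riemannianVolume n M))
    {ξ : M → ℝ} (hξ : IsTestFunction n Ω ξ) (hξ0 : ∀ x, 0 ≤ ξ x) :
    2 * ∫ x in Ω, ‖Dρ x‖ ^ p / ρ x ^ (p - α) * ξ x ∂(riemannianVolume n M) ≤
      1 / (p - 1 + β) *
        ∫ x in Ω, inner ℝ (riemannianGradient ξ x) (‖Dρ x‖ ^ (p - 2) • Dρ x)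
          * ρ x ^ (-p + 1 + α) ∂(riemannianVolume n M) := by
  refine IsTestFunction.induction_on_charts (Q := fun ξ : M → ℝ =>
    2 * ∫ x in Ω, ‖Dρ x‖ ^ p / ρ x ^ (p - α) * ξ x ∂(riemannianVolume n M) ≤
      1 / (p - 1 + β) *
        ∫ x in Ω, inner ℝ (riemannianGradient ξ x) (‖Dρ x‖ ^ (p - 2) • Dρ x)
          * ρ x ^ (-p + 1 + α) ∂(riemannianVolume n M))
    (fun ξ hξ hξ0 x₀ hs => two_mul_setIntegral_le_of_tsupport_subset_source hp hβ hΩ hρ hDρ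
      henergy hflux hweight hξ hξ0 hs) ?_ (fun ξ η hξ hξ0 hη hη0 h1 h2 => ?_) hξ hξ0
  · have h : ∀ x, riemannianGradient (n := n) (0 : M → ℝ) x = 0 := fun x =>
      riemannianGradient_eq_zero_of_notMem_tsupport (by rw [tsupport_eq_empty_iff.2 rfl]; simp)
    simp only [h, inner_zero_left, zero_mul, Pi.zero_apply, mul_zero, integral_zero, le_refl]
  · simp only [inner_riemannianGradient_add hξ hη, Pi.add_apply, mul_add, add_mul]
    rw [integral_add (henergy ξ hξ hξ0) (henergy η hη hη0),
      integral_add (hflux ξ hξ hξ0) (hflux η hη hη0)]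
    linarith

end Doubling

end

theorem theorem1p2 {n : ℕ} {M : Type*} [EMetricSpace M] [SecondCountableTopology M]
    [CompleteSpace M] [MeasurableSpace M] [BorelSpace M]
    [ChartedSpace (EuclideanSpace ℝ (Fin n)) M] [IsManifold (𝓡 n) ∞ M]
    [RiemannianBundle (fun x : M => TangentSpace (𝓡 n) x)]
    [IsContMDiffRiemannianBundle (𝓡 n) ∞ (EuclideanSpace ℝ (Fin n))
      (fun x : M => TangentSpace (𝓡 n) x)]
    [IsRiemannianManifold (𝓡 n) M]
    (p α β : ℝ) (hp : 1 < p) (hβ : p - 1 + β ≠ 0)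
    (Ω : Set M) (hΩ : IsOpen Ω) (hΩc : IsConnected Ω)
    -- the function `ρ` and its gradient `Dρ`
    (ρ : M → ℝ) (Dρ : (x : M) → TangentSpace (𝓡 n) x)
    (hρ : ∀ x ∈ Ω, 0 < ρ x) (hDρ : HasTruncatedGradientOn Ω ρ Dρ)
    (hρLp : LocallyIntegrableOn (fun x => (‖Dρ x‖ * ρ x ^ ((-p + α) / p)) ^ p) Ω
      (riemannianVolume n M))
    (hsuper : ∀ ξ : M → ℝ, IsTestFunction n Ω ξ → (∀ x, 0 ≤ ξ x) →
      IntegrableOn (fun x => inner ℝ (riemannianGradient ξ x) (‖Dρ x‖ ^ (p - 2) • Dρ x)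
        * ρ x ^ (-p + 1 + α)) Ω (riemannianVolume n M) ∧
      ∫ x in Ω, ‖Dρ x‖ ^ p / ρ x ^ (p - α) * ξ x ∂(riemannianVolume n M) ≤
        1 / (p - 1 + β) *
          ∫ x in Ω, inner ℝ (riemannianGradient ξ x) (‖Dρ x‖ ^ (p - 2) • Dρ x)
            * ρ x ^ (-p + 1 + α) ∂(riemannianVolume n M))
    -- the additional assumption in the case `p < 2`
    (hlt : p < 2 →
      (∃ D : (x : M) → TangentSpace (𝓡 n) x,
        MemSobolevLoc Ω p (fun x => ρ x ^ ((-p + 1 - β) / p)) D) ∧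
      ∀ ξ : M → ℝ, IsTestFunction n Ω ξ → (∀ x, 0 ≤ ξ x) →
        IntegrableOn (fun x => inner ℝ (riemannianGradient ξ x) (‖Dρ x‖ ^ (p - 2) • Dρ x)
          * ρ x ^ (α + β)) Ω (riemannianVolume n M) ∧
        IntegrableOn (fun x => ‖Dρ x‖ ^ p / ρ x * ρ x ^ (α + β) * ξ x) Ω
          (riemannianVolume n M) ∧
        ∫ x in Ω, ‖Dρ x‖ ^ p / ρ x * ρ x ^ (α + β) * ξ x ∂(riemannianVolume n M) ≤
          1 / (p - 1 + β) *
            ∫ x in Ω, inner ℝ (riemannianGradient ξ x) (‖Dρ x‖ ^ (p - 2) • Dρ x)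
              * ρ x ^ (α + β) ∂(riemannianVolume n M)) :
    (∃ C : ℝ, IsRemainderConstant p C) ∧
    ∀ C : ℝ, IsRemainderConstant p C →
      ∀ (V φ : M → ℝ) (Dφ : (x : M) → TangentSpace (𝓡 n) x),
        AEMeasurable V ((riemannianVolume n M).restrict Ω) → (∀ x ∈ Ω, 0 ≤ V x) →
        MemSobolevLoc Ω p φ Dφ → (∀ᵐ x ∂((riemannianVolume n M).restrict Ω), 0 < φ x) →
        -- the weak differential inequality for `φ`
        (∀ ξ : M → ℝ, IsTestFunction n Ω ξ → (∀ x, 0 ≤ ξ x) →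
          IntegrableOn (fun x => inner ℝ (‖Dφ x‖ ^ (p - 2) • Dφ x) (riemannianGradient ξ x)
            * φ x ^ (-p + 1) * ρ x ^ α) Ω (riemannianVolume n M) ∧
          IntegrableOn (fun x => ‖Dφ x‖ ^ p * ξ x * ρ x ^ α * φ x ^ (-p)) Ω
            (riemannianVolume n M) ∧
          IntegrableOn (fun x => inner ℝ (‖Dφ x‖ ^ (p - 2) • Dφ x) (Dρ x) * ξ x
            * φ x ^ (-p + 1) * ρ x ^ (-1 + α)) Ω (riemannianVolume n M) ∧
          IntegrableOn (fun x => V x / C * ξ x * ρ x ^ α) Ω (riemannianVolume n M) ∧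
          ∫ x in Ω, V x / C * ξ x * ρ x ^ α ∂(riemannianVolume n M) ≤
            ∫ x in Ω, inner ℝ (‖Dφ x‖ ^ (p - 2) • Dφ x) (riemannianGradient ξ x)
                * φ x ^ (-p + 1) * ρ x ^ α ∂(riemannianVolume n M)
            - (p - 1) *
              ∫ x in Ω, ‖Dφ x‖ ^ p * ξ x * ρ x ^ α * φ x ^ (-p) ∂(riemannianVolume n M)
            - (p - 1 + β) *
              ∫ x in Ω, inner ℝ (‖Dφ x‖ ^ (p - 2) • Dφ x) (Dρ x) * ξ x
                * φ x ^ (-p + 1) * ρ x ^ (-1 + α) ∂(riemannianVolume n M)) →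
        -- the Hardy inequality with remainder
        ∀ (u : M → ℝ) (Du : (x : M) → TangentSpace (𝓡 n) x),
          MemSobolevZero Ω p (fun x => ρ x ^ α) u Du →
          ENNReal.ofReal ((|p - 1 + β| / p) ^ p) *
              ∫⁻ x in Ω, ENNReal.ofReal (|u x| ^ p * ‖Dρ x‖ ^ p / ρ x ^ p * ρ x ^ α)
                ∂(riemannianVolume n M)
            + ∫⁻ x in Ω, ENNReal.ofReal (V x * |u x| ^ p * ρ x ^ α) ∂(riemannianVolume n M) ≤
          ∫⁻ x in Ω, ENNReal.ofReal (‖Du x‖ ^ p * ρ x ^ α) ∂(riemannianVolume n M) := by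
  refine ⟨exists_isRemainderConstant, fun C hC V φ Dφ hVm hV _ hφ hφV u Du hu => ?_⟩
  have hp0 : 0 < p := by linarith
  have henergy : ∀ ξ : M → ℝ, IsTestFunction n Ω ξ →
      IntegrableOn (fun x => ‖Dρ x‖ ^ p / ρ x ^ (p - α) * ξ x) Ω (riemannianVolume n M) := by
    refine fun ξ hξ => (hξ.integrableOn_mul hΩ hρLp).congr_fun (fun x hx => ?_) hΩ.measurableSet
    simp only
    rw [Real.mul_rpow (norm_nonneg _) (Real.rpow_nonneg (hρ x hx).le _),
      ← Real.rpow_mul (hρ x hx).le, div_mul_cancel₀ _ hp0.ne',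
      div_rpow_eq_mul_rpow_neg _ (hρ x hx).le, neg_sub, neg_add_eq_sub]
  have hdouble : ∀ ξ : M → ℝ, IsTestFunction n Ω ξ → (∀ x, 0 ≤ ξ x) →
      IntegrableOn (fun x => inner ℝ (riemannianGradient ξ x) (‖Dρ x‖ ^ (p - 2) • Dρ x)
        * ρ x ^ (-p + 1 + α)) Ω (riemannianVolume n M) ∧
      (if p < 2 then (2 : ℝ) else 1) *
        ∫ x in Ω, ‖Dρ x‖ ^ p / ρ x ^ (p - α) * ξ x ∂(riemannianVolume n M) ≤
        1 / (p - 1 + β) *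
          ∫ x in Ω, inner ℝ (riemannianGradient ξ x) (‖Dρ x‖ ^ (p - 2) • Dρ x)
            * ρ x ^ (-p + 1 + α) ∂(riemannianVolume n M) := by
    refine fun ξ hξ hξ0 => ⟨(hsuper ξ hξ hξ0).1, ?_⟩
    split_ifs with h2
    · exact two_mul_setIntegral_le_of_supersolution hp hβ hΩ hρ hDρ
        (fun η hη _ => henergy η hη) (fun η hη hη0 => (hsuper η hη hη0).1) (hlt h2).2 hξ hξ0
    · rw [one_mul]
      exact (hsuper ξ hξ hξ0).2
  have hρm : AEMeasurable ρ ((riemannianVolume n M).restrict Ω) := hDρ.aemeasurable hΩ hρ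
  have hDm : AEMeasurable (fun x => ‖Dρ x‖) ((riemannianVolume n M).restrict Ω) :=
    hDρ.aemeasurable_norm hΩ hρ
  have hum : AEMeasurable u ((riemannianVolume n M).restrict Ω) :=
    hu.hasWeakGradientOn.aemeasurable hΩ
  have hWm : AEMeasurable (fun x => ((|p - 1 + β| / p) ^ p * (‖Dρ x‖ ^ p / ρ x ^ p) + V x)
      * ρ x ^ α) ((riemannianVolume n M).restrict Ω) :=
    ((((hDm.pow_const p).div (hρm.pow_const p)).const_mul _).add hVm).mul (hρm.pow_const α)
  have hmain := lintegral_le_of_memSobolevZero hp hΩ (fun x hx => Real.rpow_pos_of_pos (hρ x hx) α)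
    (hρm.pow_const α) hWm
    (fun v hv => hardy_of_isTestFunction hp hβ hC rfl hΩ hρ hρLp hdouble hV hφ hφV hv) hu
  have hVum : AEMeasurable (fun x => ENNReal.ofReal (V x * |u x| ^ p * ρ x ^ α))
      ((riemannianVolume n M).restrict Ω) :=
    ((hVm.mul (hum.norm.pow_const p)).mul (hρm.pow_const α)).ennreal_ofReal
  refine le_of_eq_of_le ?_ hmain
  rw [← lintegral_const_mul' _ _ ENNReal.ofReal_ne_top, ← lintegral_add_right' _ hVum]
  refine setLIntegral_congr_fun hΩ.measurableSet fun x hx => ?_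
  have hx0 := hρ x hx
  have hVx := hV x hx
  rw [← ENNReal.ofReal_mul (by positivity), ← ENNReal.ofReal_add (by positivity) (by positivity)]
  congr 1
  ring
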